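/- **Setting.** Let $k=\mathbb F_q$ be a finite field and $E$ an elliptic curve over $k$ with $q$-th power Frobenius endomorphism $F$. For a prime $r$ let $G_r=\ker(1+F+\dots+F^{r-1})$, which is a finite group of geometric points of $E$, all defined over the extension of $k$ of degree $r$. For a positive integer $m$ put $X_m=\bigcup_{r\mid m,\ r\text{ prime}}G_r$ and let $D_m=(X_m)$ be the divisor that is the sum of the points of $X_m$ (so $X_1=\emptyset$ and $D_1=0$). Let $N$ be a positive square-free integer, $m$ a divisor of $N$, and $K$ a finite extension of $k$ with $N\mid[K:k]$, so that all points of $X_N$ are $K$-rational. Let $\Sigma\subset E(K)$ be a finite set disjoint from the support of $D_N$ with $|\Sigma|>\deg D_N$, let $P\in\Sigma$, put $\Sigma^*=\Sigma\setminus\{P\}$, $n=|\Sigma^*|$, and $$d^*=\Big\lfloor\tfrac12\big(|\Sigma^*|-\deg D_m\big)\Big\rfloor-1 .$$ For a divisor $D$ on $E$ over $K$ let $\mathcal L(D)=\{f\in K(E):\operatorname{div}(f)+D\ge0\}$ (with $0\in\mathcal L(D)$) and let $H^0(E,\Omega^1(D))$ be the space of rational differentials $\omega$ on $E$ over $K$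 with $\operatorname{div}(\omega)+D\ge 0$ (with $0$). Let $\mathcal L_0(D_m)=\{f\in\mathcal L(D_m):f(P)=0\}$. In $K^{\Sigma^*}$ put $$C_L(D,\Sigma^*)=\{(f(s))_{s\in\Sigma^*}:f\in\mathcal L(D)\}\quad\text{for } D=D_m \text{ and } D=(d^*+1)P,$$ $$e^*(\mathcal L_0(D_m))=\{(f(s))_{s\in\Sigma^*}:f\in\mathcal L_0(D_m)\},$$ $$C_\Omega(G,\Sigma^*)=\{(\operatorname{Res}_s\omega)_{s\in\Sigma^*}:\omega\in H^0(E,\Omega^1(G))\}\quad\text{for } G=(\Sigma^*)-D_m-(d^*+1)P .$$ For a linear code $C\subset K^{\Sigma^*}$, $d(C)$ is the least weight of a nonzero word of $C$ ($d(0)=\infty$), $C^\perp$ is the orthogonal complement for $\sum_i x_iy_i$, and $a*b$ is the coordinatewise product. A pair $(A,B)$ of linear subspaces of $K^{\Sigma^*}$ is a *$t$-error-correcting pair* for $C$ if $a*b\in C^\perp$ for all $a\in A$, $b\in B$; $\dim A>t$; $d(A)+d(C)>n$; and $d(B^\perp)>t$. **Proposition.** Suppose that $d^*>0$, and put $A=C_L((d^*+1)P,\Sigma^*)$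 and $B=C_\Omega((\Sigma^*)-D_m-(d^*+1)P,\Sigma^*)$. Then $(A,B)$ is a $d^*$-error-correcting pair for $C_L(D_m,\Sigma^*)$, and it is also a $d^*$-error-correcting pair for $e^*(\mathcal L_0(D_m))$. Moreover, both codes have a decoder of complexity $O(n^3)$ that corrects $d^*$ errors: there are one program for a unit-cost random access machine over a field (whose steps are field operations, tests for zero, operations on integer registers that hold array indices, and rounds of loops) and one constant $c$, both independent of all the data above, such that, for $C=C_L(D_m,\Sigma^*)$ and for $C=e^*(\mathcal L_0(D_m))$, the program, given generator matrices of $A$, $B$ and $C$ (for any numbering of the coordinates) and a word $y\in K^{\Sigma^*}$, stops after at most $c\,n^3$ steps, and outputs $x$ whenever $x\in C$ differs from $y$ in at most $d^*$ places. -/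

import Mathlib

noncomputable section

/-! ## Linear codes -/

namespace Code

variable {ι K : Type*} [Field K]

/-- The rows of `G` form a basis of the code `C`, i.e. `G` is a generator matrix of `C`. -/
def IsGeneratorMatrix {a : ℕ} (G : Fin a → ι → K) (C : Submodule K (ι → K)) : Prop :=
  LinearIndependent K G ∧ Submodule.span K (Set.range G) = C

variable [Fintype ι]

/-- The minimum distance of a linear code: the least weight of a nonzero codeword
(the infimum is `⊤` for the zero code, which has no nonzero codeword). -/
def minDist [DecidableEq K] (C : Submodule K (ι → K)) : ℕ∞ :=
  ⨅ x : {x : ι → K // x ∈ C ∧ x ≠ 0}, (hammingNorm x.1 : ℕ∞)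

/-- The orthogonal complement of a code for the bilinear form `∑ i, x i * y i`. -/
def dual (C : Submodule K (ι → K)) : Submodule K (ι → K) where
  carrier := {x | ∀ v ∈ C, x ⬝ᵥ v = 0}
  zero_mem' := fun v _ => zero_dotProduct v
  add_mem' := fun {x y} hx hy v hv => by rw [add_dotProduct, hx v hv, hy v hv, add_zero]
  smul_mem' := fun c x hx v hv => by rw [smul_dotProduct, hx v hv, smul_zero]

/-- `(A, B)` is a `t`-error-correcting pair for the code `C` of length `n = Fintype.card ι`. The
product `a * b` of two words is the coordinatewise (star) product. -/
structure IsErrorCorrectingPair [DecidableEq K] (t : ℕ) (A B C : Submodule K (ι → K)) : Prop where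
  mul_mem_dual : ∀ a ∈ A, ∀ b ∈ B, a * b ∈ dual C
  lt_dim : t < Module.finrank K A
  length_lt : (Fintype.card ι : ℕ∞) < minDist A + minDist C
  lt_minDist_dual : (t : ℕ∞) < minDist (dual B)

end Code

/-! ## A random access machine over a field, with unit cost operations

The memory consists of two-dimensional arrays of field elements, numbered by `ℕ`, and of integer
registers. A program has no access to the field other than the arithmetic operations, the constants
`0` and `1` and the test for zero; the integer registers can be set to constants, copied,
incremented, compared, and used as array indices and as bounds of loops. A program is a finite
piece of syntax which does not mention a field. -/

namespace FieldRAM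

/-- The state of the machine: `mem k i j` is the entry `(i, j)` of array number `k`, and `reg r`
is the content of the integer register `r`. -/
structure State (K : Type*) where
  mem : ℕ → ℕ → ℕ → K
  reg : ℕ → ℕ

/-- A reference to a memory cell: an array, and the two registers that contain the row and the
column. -/
structure Cell where
  arr : ℕ
  row : ℕ
  col : ℕ

inductive Prog
  /-- `d := 0` -/
  | zero (d : Cell)
  /-- `d := 1` -/
  | one (d : Cell)
  /-- `d := x` -/
  | move (d x : Cell)
  /-- `d := x + y` -/
  | add (d x y : Cell)
  /-- `d := x - y` -/
  | sub (d x y : Cell)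
  /-- `d := x * y` -/
  | mul (d x y : Cell)
  /-- `d := x⁻¹` -/
  | inv (d x : Cell)
  /-- register `r := c` -/
  | const (r c : ℕ)
  /-- register `r := ` register `s` -/
  | copy (r s : ℕ)
  /-- register `r := ` register `r + 1` -/
  | succ (r : ℕ)
  /-- first `p`, then `q` -/
  | seq (p q : Prog)
  /-- if the field element `x` is zero then `p` else `q` -/
  | ifZero (x : Cell) (p q : Prog)
  /-- if register `r` is less than register `s` then `p` else `q` -/
  | ifLt (r s : ℕ) (p q : Prog)
  /-- for register `r` from `0` to `n - 1` do `p`, where `n` is the content of register `s` at the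
  start of the loop -/
  | loop (r s : ℕ) (p : Prog)

variable {K : Type*}

def State.get (σ : State K) (x : Cell) : K := σ.mem x.arr (σ.reg x.row) (σ.reg x.col)

def State.set (σ : State K) (d : Cell) (a : K) : State K where
  mem := fun k i j =>
    if k = d.arr ∧ i = σ.reg d.row ∧ j = σ.reg d.col then a else σ.mem k i j
  reg := σ.reg

def State.setReg (σ : State K) (r n : ℕ) : State K where
  mem := σ.mem
  reg := Function.update σ.reg r n

/-- Run a program: the final state, and the number of steps. Every operation, every test and every
round of a loop costs one step. -/
def Prog.run [Field K] [DecidableEq K] : Prog → State K → State K × ℕ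
  | zero d, σ => (σ.set d 0, 1)
  | one d, σ => (σ.set d 1, 1)
  | move d x, σ => (σ.set d (σ.get x), 1)
  | add d x y, σ => (σ.set d (σ.get x + σ.get y), 1)
  | sub d x y, σ => (σ.set d (σ.get x - σ.get y), 1)
  | mul d x y, σ => (σ.set d (σ.get x * σ.get y), 1)
  | inv d x, σ => (σ.set d (σ.get x)⁻¹, 1)
  | const r c, σ => (σ.setReg r c, 1)
  | copy r s, σ => (σ.setReg r (σ.reg s), 1)
  | succ r, σ => (σ.setReg r (σ.reg r + 1), 1)
  | seq p q, σ =>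
      let u := p.run σ
      let w := q.run u.1
      (w.1, u.2 + w.2)
  | ifZero x p q, σ =>
      let u := if σ.get x = 0 then p.run σ else q.run σ
      (u.1, u.2 + 1)
  | ifLt r s p q, σ =>
      let u := if σ.reg r < σ.reg s then p.run σ else q.run σ
      (u.1, u.2 + 1)
  | loop r s p, σ =>
      Nat.rec (motive := fun _ => State K × ℕ) (σ, 1)
        (fun j u =>
          let w := p.run (u.1.setReg r j)
          (w.1, u.2 + w.2 + 1))
        (σ.reg s)

/-- The matrix `G` as an array of the machine, padded by zeros; its columns are numbered by `e`. -/
def toArray [Field K] {ι : Type*} {n a : ℕ} (e : Fin n ≃ ι) (G : Fin a → ι → K) : ℕ → ℕ → K :=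
  fun i j => if h : i < a ∧ j < n then G ⟨i, h.1⟩ (e ⟨j, h.2⟩) else 0

/-- The input of a decoder: three matrices `GA`, `GB`, `GC` in the arrays 0, 1, 2, the received word
`y` in row 0 of array 3, the length and the numbers of rows of the matrices in the registers
0, 1, 2, 3. All the rest of the memory is zero. -/
def decoderInput [Field K] {ι : Type*} {n a b l : ℕ} (e : Fin n ≃ ι)
    (GA : Fin a → ι → K) (GB : Fin b → ι → K) (GC : Fin l → ι → K) (y : ι → K) : State K where
  mem
    | 0 => toArray e GA
    | 1 => toArray e GB
    | 2 => toArray e GC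
    | 3 => toArray e (fun _ : Fin 1 => y)
    | _ => fun _ _ => 0
  reg
    | 0 => n
    | 1 => a
    | 2 => b
    | 3 => l
    | _ => 0

/-- The program `p`, given generator matrices of `A`, `B`, `C` (for any numbering of the
coordinates) and a received word `y`, stops after at most `c * n ^ 3` steps, where `n` is the
length; and if `y` differs from a codeword `x ∈ C` in at most `t` places, then it leaves `x` in
row 0 of array 4. -/
def Prog.Decodes [Field K] [DecidableEq K] {ι : Type*} [Fintype ι] (p : Prog) (c t : ℕ)
    (A B C : Submodule K (ι → K)) : Prop :=
  ∀ (e : Fin (Fintype.card ι) ≃ ι) (a b l : ℕ)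
    (GA : Fin a → ι → K) (GB : Fin b → ι → K) (GC : Fin l → ι → K),
    Code.IsGeneratorMatrix GA A → Code.IsGeneratorMatrix GB B → Code.IsGeneratorMatrix GC C →
    ∀ y : ι → K,
      (p.run (decoderInput e GA GB GC y)).2 ≤ c * Fintype.card ι ^ 3 ∧
      ∀ x ∈ C, hammingDist y x ≤ t →
        ∀ j : Fin (Fintype.card ι), (p.run (decoderInput e GA GB GC y)).1.mem 4 0 j = x (e j)

end FieldRAM

/-! ## Places of a function field -/

/-- A place of a function field `F` over `K`: a discrete valuation ring of `F` that contains `K`.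
These are the closed points of the smooth projective curve over `K` with function field `F`. -/
structure Place (K F : Type*) [Field K] [Field F] [Algebra K F] where
  ring : ValuationSubring F
  algebraMap_mem : ∀ a : K, algebraMap K F a ∈ ring
  isDVR : IsDiscreteValuationRing ring

/-- The rational differentials: the Kähler differentials of the function field. -/
abbrev RatDiff (K F : Type*) [Field K] [Field F] [Algebra K F] := Ω[F⁄K]

namespace Place

variable {K F : Type*} [Field K] [Field F] [Algebra K F]

/-- `t` is a local parameter at `v`. -/
def IsUniformizer (v : Place K F) (t : F) : Prop :=
  ∃ π : v.ring, Irreducible π ∧ (π : F) = t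

theorem exists_isUniformizer (v : Place K F) : ∃ t, v.IsUniformizer t := by
  have := v.isDVR
  obtain ⟨π, hπ⟩ := IsDiscreteValuationRing.exists_irreducible v.ring
  exact ⟨π, π, hπ, rfl⟩

/-- `f` vanishes at `v`, i.e. `f` is in the maximal ideal. -/
def Vanishes (v : Place K F) (f : F) : Prop := v.ring.valuation f < 1

/-- `ord_v f ≥ n` (true for `f = 0`). -/
def OrdGE (v : Place K F) (n : ℤ) (f : F) : Prop :=
  ∀ t, v.IsUniformizer t → f / t ^ n ∈ v.ring

/-- `ord_v ω ≥ n` for a rational differential `ω`. The regular differentials at `v` are generated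
by the `dg` with `g` regular at `v`. -/
def diffOrdGE (v : Place K F) (n : ℤ) : Submodule K (RatDiff K F) :=
  Submodule.span K {ω | ∃ f g : F, v.OrdGE n f ∧ g ∈ v.ring ∧ ω = f • KaehlerDifferential.D K F g}

/-- At a place `v` with residue field `K`, the residue of `ω` is `c`: in an expansion
`ω = (a_m t⁻ᵐ + ⋯ + a_1 t⁻¹ + (regular)) dt`, with `t` a local parameter and `a_i ∈ K`, the
coefficient `a_1` is `c`. The polar part is written as `t⁻¹ p(t⁻¹)`. -/
def HasResidue (v : Place K F) (ω : RatDiff K F) (c : K) : Prop :=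
  ∀ t, v.IsUniformizer t → ∃ (p : Polynomial K) (h : F), h ∈ v.ring ∧
    ω = (t⁻¹ * Polynomial.aeval t⁻¹ p + h) • KaehlerDifferential.D K F t ∧ p.coeff 0 = c

end Place

/-! ## Codes from an elliptic curve -/

namespace WeierstrassCurve.Affine

open scoped Polynomial

variable {K : Type*} [Field K] (W : WeierstrassCurve.Affine K)

/-- The coordinate function `x`. -/
def xFun : W.FunctionField :=
  algebraMap W.CoordinateRing W.FunctionField
    (CoordinateRing.mk W (Polynomial.C (Polynomial.X : K[X])))

/-- The coordinate function `y`. -/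
def yFun : W.FunctionField :=
  algebraMap W.CoordinateRing W.FunctionField (CoordinateRing.mk W Polynomial.X)

variable {W}

/-- The place `v` is the `K`-rational point `P`: the functions `x - x(P)` and `y - y(P)` vanish at
`v` for an affine point `P`, and `x` has a pole at `v` for the point at infinity. -/
def IsPlaceOf (v : Place K W.FunctionField) : W.Point → Prop
  | .zero => W.xFun ∉ v.ring
  | .some a b _ => v.Vanishes (W.xFun - algebraMap K W.FunctionField a) ∧
      v.Vanishes (W.yFun - algebraMap K W.FunctionField b)

open Classical in
/-- The coefficient at a place `v` of a divisor `∑ n_P (P)` with `K`-rational points `P`. -/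
def divisorCoeff (D : W.Point →₀ ℤ) (v : Place K W.FunctionField) : ℤ :=
  D.sum fun P n => if IsPlaceOf v P then n else 0

/-- The divisor `(X)`, the sum of the points of the finite set `X`. -/
def divisorOf (X : Finset W.Point) : W.Point →₀ ℤ := ∑ P ∈ X, Finsupp.single P 1

/-- `f` takes the value `c` at the rational point `P` (in particular `f` is regular at `P`). -/
def HasValue (P : W.Point) (f : W.FunctionField) (c : K) : Prop :=
  ∀ v : Place K W.FunctionField, IsPlaceOf v P → v.Vanishes (f - algebraMap K W.FunctionField c)

/-- The differential `ω` has residue `c` at the rational point `P`. -/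
def HasResidue (P : W.Point) (ω : RatDiff K W.FunctionField) (c : K) : Prop :=
  ∀ v : Place K W.FunctionField, IsPlaceOf v P → v.HasResidue ω c

/-- The space `L(D) = {f | div f + D ≥ 0}`. -/
def rrSpace (D : W.Point →₀ ℤ) : Submodule K W.FunctionField where
  carrier := {f | ∀ v : Place K W.FunctionField, v.OrdGE (-divisorCoeff D v) f}
  zero_mem' := fun v t _ => by rw [zero_div]; exact zero_mem _
  add_mem' := fun {f g} hf hg v t ht => by
    rw [add_div]; exact add_mem (hf v t ht) (hg v t ht)
  smul_mem' := fun c f hf v t ht => by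
    rw [Algebra.smul_def, mul_div_assoc]; exact mul_mem (v.algebraMap_mem c) (hf v t ht)

/-- The space `L_0(D)` of the `f ∈ L(D)` with `f(P) = 0`. -/
def rrSpaceZero (D : W.Point →₀ ℤ) (P : W.Point) : Submodule K W.FunctionField where
  carrier := {f | f ∈ rrSpace D ∧ HasValue P f 0}
  zero_mem' := ⟨zero_mem _, fun v _ => by simp [Place.Vanishes]⟩
  add_mem' := fun {f g} hf hg => ⟨add_mem hf.1 hg.1, fun v hv => by
    have h1 := hf.2 v hv
    have h2 := hg.2 v hv
    simp only [Place.Vanishes, map_zero, sub_zero] at h1 h2 ⊢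
    exact Valuation.map_add_lt _ h1 h2⟩
  smul_mem' := fun c f hf => ⟨Submodule.smul_mem _ c hf.1, fun v hv => by
    have h1 := hf.2 v hv
    have h2 := (v.ring.valuation_le_one_iff _).2 (v.algebraMap_mem c)
    simp only [Place.Vanishes, map_zero, sub_zero] at h1 ⊢
    rw [Algebra.smul_def, map_mul]
    exact (mul_le_of_le_one_left' h2).trans_lt h1⟩

/-- The space `H⁰(Ω¹(G)) = {ω | div ω + G ≥ 0}`. -/
def diffSpace (G : W.Point →₀ ℤ) : Submodule K (RatDiff K W.FunctionField) :=
  ⨅ v : Place K W.FunctionField, v.diffOrdGE (-divisorCoeff G v)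

theorem HasValue.add {P : W.Point} {f g : W.FunctionField} {a b : K} (hf : HasValue P f a)
    (hg : HasValue P g b) : HasValue P (f + g) (a + b) := fun v hv => by
  have h := Valuation.map_add_lt _ (hf v hv) (hg v hv)
  rwa [Place.Vanishes, map_add, add_sub_add_comm]

theorem HasValue.smul {P : W.Point} {f : W.FunctionField} {a : K} (c : K)
    (hf : HasValue P f a) : HasValue P (c • f) (c * a) := fun v hv => by
  have h2 := (v.ring.valuation_le_one_iff _).2 (v.algebraMap_mem c)
  rw [Place.Vanishes, Algebra.smul_def, map_mul (algebraMap K W.FunctionField), ← mul_sub,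
    map_mul (ValuationSubring.valuation _)]
  exact (mul_le_of_le_one_left' h2).trans_lt (hf v hv)

theorem HasResidue.add {P : W.Point} {ω η : RatDiff K W.FunctionField} {a b : K}
    (hω : HasResidue P ω a) (hη : HasResidue P η b) : HasResidue P (ω + η) (a + b) := by
  intro v hv t ht
  obtain ⟨p, h, hh, rfl, rfl⟩ := hω v hv t ht
  obtain ⟨q, g, hg, rfl, rfl⟩ := hη v hv t ht
  refine ⟨p + q, h + g, add_mem hh hg, ?_, by simp⟩
  rw [← add_smul, map_add]
  congr 1
  ring

theorem HasResidue.smul {P : W.Point} {ω : RatDiff K W.FunctionField} {a : K} (c : K)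
    (hω : HasResidue P ω a) : HasResidue P (c • ω) (c * a) := by
  intro v hv t ht
  obtain ⟨p, h, hh, rfl, rfl⟩ := hω v hv t ht
  refine ⟨c • p, c • h, ?_, ?_, by simp⟩
  · rw [Algebra.smul_def]
    exact mul_mem (v.algebraMap_mem c) hh
  · rw [← smul_assoc, smul_add, map_smul, mul_smul_comm]

/-- The image of a space `V` of functions under evaluation at the points of `S`. -/
def evalCode (V : Submodule K W.FunctionField) (S : Finset W.Point) : Submodule K (S → K) where
  carrier := {c | ∃ f ∈ V, ∀ s : S, HasValue s.1 f (c s)}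
  zero_mem' := ⟨0, zero_mem _, fun s v _ => by simp [Place.Vanishes]⟩
  add_mem' := by
    rintro c d ⟨f, hf, hfc⟩ ⟨g, hg, hgd⟩
    exact ⟨f + g, add_mem hf hg, fun s => (hfc s).add (hgd s)⟩
  smul_mem' := by
    rintro a c ⟨f, hf, hfc⟩
    exact ⟨a • f, Submodule.smul_mem _ a hf, fun s => (hfc s).smul a⟩

/-- The functional Goppa code `C_L(D, S)`. -/
def codeL (D : W.Point →₀ ℤ) (S : Finset W.Point) : Submodule K (S → K) :=
  evalCode (rrSpace D) S

/-- The residue Goppa code `C_Ω(G, S)`, the image of `H⁰(Ω¹(G))` under the residues at the points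
of `S`. -/
def codeOmega (G : W.Point →₀ ℤ) (S : Finset W.Point) : Submodule K (S → K) where
  carrier := {c | ∃ ω ∈ diffSpace G, ∀ s : S, HasResidue s.1 ω (c s)}
  zero_mem' := ⟨0, zero_mem _, fun s v _ t _ => ⟨0, 0, zero_mem _, by simp, by simp⟩⟩
  add_mem' := by
    rintro c d ⟨f, hf, hfc⟩ ⟨g, hg, hgd⟩
    exact ⟨f + g, add_mem hf hg, fun s => (hfc s).add (hgd s)⟩
  smul_mem' := by
    rintro a c ⟨f, hf, hfc⟩
    exact ⟨a • f, Submodule.smul_mem _ a hf, fun s => (hfc s).smul a⟩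

/-- Over a finite field there are finitely many rational points. -/
instance instFinitePoint [Finite K] : Finite W.Point :=
  Finite.of_injective
    (fun P : W.Point => match P with
      | .zero => (none : Option (K × K))
      | .some a b _ => some (a, b))
    (by rintro (_ | _) (_ | _) h <;> simp_all)

/-! ### The divisors `D_m` -/

section Frobenius

variable {k : Type*} [Field k] [Fintype k] (E : WeierstrassCurve.Affine k)
variable (L : Type*) [Field L] [DecidableEq L] [Algebra k L]

/-- The Frobenius endomorphism `F` of an elliptic curve over the finite field `k`, on the points
over an extension `L` of `k`: it raises the coordinates to the power `q = |k|`. -/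
def frobenius : (E⁄L).Point →+ (E⁄L).Point :=
  Point.map (W' := E) (FiniteField.frobeniusAlgHom k L)

/-- The kernel `G_r` of the endomorphism `1 + F + ⋯ + F ^ (r - 1)`, on the points over `L`. When
`L` contains the extension of `k` of degree `r`, these are all geometric points of the kernel:
see `exists_of_mem_frobeniusKernel`. -/
def frobeniusKernel (r : ℕ) : Set (E⁄L).Point :=
  {Q | ∑ i ∈ Finset.range r, (frobenius E L)^[i] Q = 0}

theorem frobenius_iterate_eq {r : ℕ} {Q : (E⁄L).Point} (hQ : Q ∈ frobeniusKernel E L r) :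
    (frobenius E L)^[r] Q = Q := by
  have h0 : ∑ i ∈ Finset.range r, (frobenius E L)^[i] Q = 0 := hQ
  have h1 : ∑ i ∈ Finset.range r, (frobenius E L)^[i + 1] Q = 0 := by
    simp only [Function.iterate_succ', Function.comp_apply]
    rw [← map_sum, h0, map_zero]
  have h := Finset.sum_range_succ (fun i => (frobenius E L)^[i] Q) r
  rw [Finset.sum_range_succ', h0, h1] at h
  simpa using h.symm

theorem frobenius_iterate_some (r : ℕ) {x y : L} (h : (E⁄L).Nonsingular x y) :
    ∃ h', (frobenius E L)^[r] (.some x y h) =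
      .some (x ^ Fintype.card k ^ r) (y ^ Fintype.card k ^ r) h' := by
  induction r with
  | zero => exact ⟨by simpa using h, by simp⟩
  | succ r ih =>
    obtain ⟨h', e⟩ := ih
    rw [Function.iterate_succ', Function.comp_apply, e]
    have e2 : ∀ z : L, FiniteField.frobeniusAlgHom k L (z ^ Fintype.card k ^ r) =
        z ^ Fintype.card k ^ (r + 1) := fun z => by
      rw [FiniteField.coe_frobeniusAlgHom, pow_succ, pow_mul]
    rw [← e2 x, ← e2 y]
    exact ⟨_, rfl⟩

/-- All geometric points of the kernel `G_r` are rational over every finite extension `K` of `k`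
whose degree is divisible by `r`. -/
theorem exists_of_mem_frobeniusKernel (K : Type*) [Field K] [Finite K] [DecidableEq K] [Algebra k K]
    [Algebra K L] [IsScalarTower k K L] {r : ℕ} (hr : r ∣ Module.finrank k K) {Q : (E⁄L).Point}
    (hQ : Q ∈ frobeniusKernel E L r) :
    ∃ Q₀ ∈ frobeniusKernel E K r, Point.map (W' := E) (IsScalarTower.toAlgHom k K L) Q₀ = Q := by
  have : Fintype K := Fintype.ofFinite K
  have : Module.Finite k K := Module.Finite.of_finite
  have hdesc : ∀ x : L, x ^ Fintype.card k ^ r = x → ∃ a : K, algebraMap K L a = x := by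
    intro x hx
    obtain ⟨s, hs⟩ := hr
    have hx' : ∀ j, x ^ Fintype.card k ^ (r * j) = x := fun j => by
      induction j with
      | zero => simp
      | succ j ih => rw [Nat.mul_succ, pow_add, pow_mul, ih, hx]
    have hK : x ^ Fintype.card K = x := by
      rw [Module.card_eq_pow_finrank (K := k) (V := K), hs]
      exact hx' s
    have hspl : (Polynomial.X ^ Fintype.card K - Polynomial.X : Polynomial K).Splits :=
      by simpa [Nat.card_eq_fintype_card] using Polynomial.splits_X_pow_nat_card_sub_X (K := K)
    exact hspl.mem_range_of_isRoot
      (FiniteField.X_pow_card_sub_X_ne_zero K Fintype.one_lt_card) (by simp [hK])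
  set g : (E⁄K).Point →+ (E⁄L).Point := Point.map (W' := E) (IsScalarTower.toAlgHom k K L) with hg
  have hcomm1 : ∀ R : (E⁄K).Point, g (frobenius E K R) = frobenius E L (g R) := by
    intro R
    rw [hg, frobenius, frobenius]
    cases R with
    | zero => rfl
    | some a b h =>
      rw [Point.map_some, Point.map_some, Point.map_some, Point.map_some]
      simp
  have hcomm : ∀ (i : ℕ) (R : (E⁄K).Point),
      g ((frobenius E K)^[i] R) = (frobenius E L)^[i] (g R) := fun i R =>
    Function.Semiconj.iterate_right (f := g) hcomm1 i R
  have key : ∃ Q₀, g Q₀ = Q := by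
    cases Q with
    | zero => exact ⟨0, map_zero g⟩
    | some x y h =>
      obtain ⟨h', e⟩ := frobenius_iterate_some E L r h
      rw [frobenius_iterate_eq E L hQ] at e
      injection e with e1 e2
      obtain ⟨a, rfl⟩ := hdesc x e1.symm
      obtain ⟨b, rfl⟩ := hdesc y e2.symm
      exact ⟨.some a b ((E.baseChange_nonsingular
        (f := IsScalarTower.toAlgHom k K L) (RingHom.injective _) a b).1 h), rfl⟩
  obtain ⟨Q₀, rfl⟩ := key
  refine ⟨Q₀, ?_, rfl⟩
  have hinj : Function.Injective g := Point.map_injective _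
  apply hinj
  rw [map_zero, map_sum]
  simp only [hcomm]
  exact hQ

/-- The set `X_m`, the union of the `G_r` for the primes `r` dividing `m`. -/
def primeKernels [Finite L] (m : ℕ) : Finset (E⁄L).Point :=
  (Set.toFinite (⋃ r ∈ m.primeFactors, frobeniusKernel E L r)).toFinset

/-- The divisor `D_m = (X_m)`. -/
def kernelDivisor [Finite L] (m : ℕ) : (E⁄L).Point →₀ ℤ :=
  divisorOf (primeKernels E L m)

/-- The number `⌊(n - deg D_m) / 2⌋ - 1`. -/
def dStar [Finite L] (m n : ℕ) : ℤ :=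
  ⌊((n : ℚ) - ((kernelDivisor E L m).degree : ℤ)) / 2⌋ - 1

end Frobenius

end WeierstrassCurve.Affine

end

noncomputable section

open Polynomial Polynomial.Bivariate

/-! ### The coordinate ring is a Dedekind domain -/

namespace WeierstrassCurve.Affine
namespace CoordinateRing

variable {K : Type*} [Field K] {W : WeierstrassCurve.Affine K}

/-! Write n = |Σ*|, X = X_m, d = d* and Q = (d+1)P. All that is needed from the definition of
`dStar` is |X| + 2d + 2 ≤ n. The conditions on the pair then follow from three facts about the
curve. (1) A nonzero function in L(G) forces deg G ≥ 0 (`degree_nonneg_of_mem_rrSpace`). Hence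
nonzero words of A and of C have weights at least n - (d+1) and n - |X|, and these add up to more
than n. (2) If deg G ≥ 1, some function in L(G + (s)) has exactly the permitted pole at s
(`exists_mem_rrSpace_add`). Hence the spaces L(jP) grow at every step after L(P), and dim A ≥ d + 1.
The same fact yields, for a nonzero word of weight at most d, a differential of B with a pole at one
chosen point of the support and none at the others; so such a word is not orthogonal to B. (3) The
residues of a differential with simple poles at rational points add up to zero
(`sum_residues_eq_zero`). Applied to f g ω this says that products of words of A and B are
orthogonal to C. The subcode of functions vanishing at P inherits the pair
(`IsErrorCorrectingPair.mono`).

Genus one makes these facts explicit, without Riemann-Roch. The coordinate ring is a Dedekind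
domain, so places are its maximal ideals and one place at infinity. The chord and tangent
construction shows that divisors of degree 0 and sum 0 are principal (`exists_hasDivisor`), and a
function with at most a simple pole at infinity is constant (`eq_algebraMap_of_le_one`). The
invariant differential has neither zeros nor poles, so differentials are treated as functions
(`mem_diffSpace_iff`), and the residue theorem becomes a partial fraction argument with `poleFun`.

For decoding, let y = x + e with e of weight at most d. Some nonzero a in A vanishes at the errors
and is then orthogonal to all b * y. Conversely, any a in A with this orthogonality has a * e in the
dual of B, of weight at most d, so a * e = 0. Two codewords c with a * (y - c) = 0 differ by a
codeword killed by a, which is zero by the distance condition. So x comes from two linear systems,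
each solved by eliminating at most n + 1 rows against at most n functionals, in O(n^3) steps
(`decoder_runs`, `decoder_decodes`). -/

variable (W) in
theorem eval₂_negPolynomial : eval₂ (algebraMap K[X] W.CoordinateRing) (mk W W.negPolynomial)
    W.polynomial = 0 := by
  have : eval₂ (algebraMap K[X] W.CoordinateRing) (mk W W.negPolynomial) W.polynomial =
      mk W (W.polynomial.eval₂ C W.negPolynomial) := by
    rw [hom_eval₂]; rfl
  -- Replacing Y by its conjugate gives back the Weierstrass polynomial itself, so the cofactor is
  -- 1.
  refine this.trans (AdjoinRoot.mk_eq_zero.2 ⟨1, ?_⟩)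
  simp only [polynomial, negPolynomial, eval₂_add, eval₂_sub, eval₂_mul, eval₂_pow, eval₂_C,
    eval₂_X]
  ring

variable (W) in
/-- The conjugation `Y ↦ -Y - a₁ X - a₃` of the coordinate ring over `K[X]`. -/
def conj : W.CoordinateRing →ₐ[K[X]] W.CoordinateRing :=
  AdjoinRoot.liftAlgHom _ (Algebra.ofId _ _) (mk W W.negPolynomial)
    (eval₂_negPolynomial W)

theorem conj_smul_basis (p q : K[X]) :
    conj W (p • 1 + q • mk W Y) = p • 1 + q • mk W W.negPolynomial := by
  rw [map_add, map_smul, map_smul, map_one]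
  congr 2
  exact AdjoinRoot.lift_root (eval₂_negPolynomial W)

/-- The norm of a quadratic extension is the product of the two conjugates. It puts a nonzero
polynomial into every nonzero ideal and turns every denominator into a polynomial. -/
theorem mul_conj (g : W.CoordinateRing) :
    g * conj W g = algebraMap K[X] W.CoordinateRing (Algebra.norm K[X] g) := by
  obtain ⟨p, q, rfl⟩ := exists_smul_basis_eq g
  have := coe_norm_smul_basis (W' := W) p q
  refine Eq.trans ?_ this.symm
  rw [conj_smul_basis]
  simp only [smul, negPolynomial, map_mul, map_add, mul_one]

instance : Module.Finite K[X] W.CoordinateRing := Module.Finite.of_basis (CoordinateRing.basis W)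

theorem norm_ne_zero {g : W.CoordinateRing} (hg : g ≠ 0) : Algebra.norm K[X] g ≠ 0 := by
  intro h
  exact hg (Algebra.norm_eq_zero_iff.1 h)

theorem algebraMap_polynomial_injective :
    Function.Injective (algebraMap K[X] W.FunctionField) := by
  rw [IsScalarTower.algebraMap_eq K[X] W.CoordinateRing W.FunctionField]
  exact (IsFractionRing.injective W.CoordinateRing W.FunctionField).comp (FaithfulSMul.algebraMap_injective _ _)

/-- `K[X]` is integrally closed, and the quotient already lies in the image of its fraction field,
so integrality descends along that embedding. -/
theorem dvd_of_isIntegral_div {n d : K[X]} (hd : d ≠ 0)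
    (h : _root_.IsIntegral K[X] (algebraMap K[X] W.FunctionField n / algebraMap _ _ d)) : d ∣ n := by
  let φ : FractionRing K[X] →ₐ[K[X]] W.FunctionField :=
    IsFractionRing.liftAlgHom (g := Algebra.ofId K[X] W.FunctionField)
      algebraMap_polynomial_injective
  have hφ : Function.Injective φ := φ.injective
  have e : φ (algebraMap _ _ n / algebraMap _ _ d) =
      algebraMap K[X] W.FunctionField n / algebraMap _ _ d := by
    rw [map_div₀, AlgHom.commutes, AlgHom.commutes]
  rw [← e, isIntegral_algHom_iff φ hφ] at h
  obtain ⟨c, hc⟩ := IsIntegrallyClosed.isIntegral_iff.1 h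
  refine ⟨c, ?_⟩
  rw [eq_div_iff (by simpa using hd), ← map_mul] at hc
  rw [mul_comm]
  exact (IsFractionRing.injective K[X] (FractionRing K[X]) hc).symm

/-- Smoothness enters here. Modulo `π` the pair (X, b) is a point of the curve over the residue
field of `π`. Its y-partial vanishes by `h1`; a multiple of `π ^ 2` has a derivative divisible by
`π`, so the x-partial vanishes too. -/
theorem not_sq_dvd [W.IsElliptic] {π : K[X]} (hπ : Irreducible π) (b : K[X])
    (h2 : π ^ 2 ∣ b ^ 2 + b * (C W.a₁ * X + C W.a₃) -
      (X ^ 3 + C W.a₂ * X ^ 2 + C W.a₄ * X + C W.a₆))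
    (h1 : π ∣ 2 * b + (C W.a₁ * X + C W.a₃)) : False := by
  have := Fact.mk hπ
  let φ : K →+* AdjoinRoot π := AdjoinRoot.of π
  let V : WeierstrassCurve.Affine (AdjoinRoot π) := W.map φ
  have : V.IsElliptic := inferInstanceAs (WeierstrassCurve.IsElliptic (WeierstrassCurve.map W φ))
  have hC : ∀ a, AdjoinRoot.mk π (C a) = φ a := fun a => rfl
  have d2 := AdjoinRoot.mk_eq_zero.2 ((Dvd.intro _ (sq π).symm).trans h2)
  have d1 := AdjoinRoot.mk_eq_zero.2 h1
  have d3 : π ∣ derivative (b ^ 2 + b * (C W.a₁ * X + C W.a₃) -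
      (X ^ 3 + C W.a₂ * X ^ 2 + C W.a₄ * X + C W.a₆)) := by
    obtain ⟨u, hu⟩ := h2
    rw [hu, derivative_mul, derivative_pow]
    refine dvd_add (Dvd.dvd.mul_right ?_ _) (Dvd.dvd.mul_right (dvd_pow_self _ two_ne_zero) _)
    simp only [Nat.add_one_sub_one, pow_one]
    exact Dvd.dvd.mul_right (Dvd.intro_left _ rfl) _
  have d3 := AdjoinRoot.mk_eq_zero.2 d3
  simp only [map_add, map_sub, map_mul, map_pow, hC, derivative_pow, derivative_mul, derivative_C,
    derivative_X, zero_mul, zero_add, map_ofNat,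
    mul_one, add_zero, map_natCast] at d1 d2 d3
  have hE : V.Equation (AdjoinRoot.mk π X) (AdjoinRoot.mk π b) := by
    rw [equation_iff']
    simp only [V, map_a₁, map_a₂, map_a₃, map_a₄, map_a₆]
    linear_combination d2
  have hN := (nonsingular_iff' _ _).1 (equation_iff_nonsingular.1 hE)
  simp only [V, map_a₁, map_a₂, map_a₃, map_a₄] at hN
  rcases hN.2 with h | h
  -- `d3` is the total derivative along y = b(x); the part with the derivative of `b` is a multiple
  -- of the y-partial `d1`.
  · apply h
    push_cast at d3
    linear_combination d3 - (AdjoinRoot.mk π (derivative b)) * d1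
  · exact h (by linear_combination d1)

/-- The norm and the trace of g/π are integral over `K[X]`, hence polynomials: `π ^ 2` divides the
norm of `g` and `π` its trace. For g = p + qY this forces `π` to divide q, and then p. -/
theorem dvd_of_isIntegral [W.IsElliptic] {π : K[X]} (hπ : Irreducible π) {g : W.CoordinateRing}
    (h : _root_.IsIntegral K[X] (algebraMap _ W.FunctionField g / algebraMap K[X] _ π)) :
    ∃ g', g = π • g' := by
  let σ : W.FunctionField →ₐ[K[X]] W.FunctionField :=
    IsFractionRing.liftAlgHom (g := (IsScalarTower.toAlgHom K[X] W.CoordinateRing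
      W.FunctionField).comp (conj W)) (by
      rw [injective_iff_map_eq_zero]
      intro a ha
      have h0 : conj W a = 0 := IsFractionRing.injective W.CoordinateRing W.FunctionField
        (ha.trans (map_zero _).symm)
      by_contra hne
      have := mul_conj a
      rw [h0, mul_zero] at this
      exact norm_ne_zero hne
        (FaithfulSMul.algebraMap_injective K[X] W.CoordinateRing (this.symm.trans (map_zero _).symm)))
  have hσ : ∀ a : W.CoordinateRing, σ (algebraMap _ _ a) = algebraMap _ _ (conj W a) :=
    fun a => IsLocalization.lift_eq _ a
  have h' := h.map σ
  rw [map_div₀, hσ, AlgHom.commutes] at h'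
  have hπ0 : algebraMap K[X] W.FunctionField π ≠ 0 :=
    (map_ne_zero_iff _ algebraMap_polynomial_injective).2 hπ.ne_zero
  have htower : ∀ a : K[X], algebraMap W.CoordinateRing W.FunctionField (algebraMap _ _ a) =
    algebraMap K[X] W.FunctionField a := fun a => (IsScalarTower.algebraMap_apply ..).symm
  have hN : π ^ 2 ∣ Algebra.norm K[X] g := by
    apply dvd_of_isIntegral_div (W := W) (pow_ne_zero 2 hπ.ne_zero)
    have h2 := h.mul h'
    rw [div_mul_div_comm, ← map_mul, mul_conj, htower, ← sq, ← map_pow] at h2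
    exact h2
  obtain ⟨p, q, rfl⟩ := exists_smul_basis_eq g
  have hT : π ∣ 2 * p - q * (C W.a₁ * X + C W.a₃) := by
    apply dvd_of_isIntegral_div (W := W) hπ.ne_zero
    have h2 := h.add h'
    rw [← add_div, ← map_add, conj_smul_basis] at h2
    convert! h2 using 2
    rw [← htower]
    congr 1
    have : algebraMap K[X] W.CoordinateRing (2 * p - q * (C W.a₁ * X + C W.a₃)) =
      mk W (C (2 * p - q * (C W.a₁ * X + C W.a₃))) := rfl
    rw [this]
    simp only [smul, negPolynomial, map_mul, map_add, map_sub, map_neg, mul_one, map_ofNat]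
    ring
  rw [norm_smul_basis] at hN
  by_cases hq : π ∣ q
  · have hp : π ∣ p := by
      apply hπ.prime.dvd_of_dvd_pow (n := 2)
      have := (Dvd.intro _ (sq π).symm).trans hN
      have e : p ^ 2 = (p ^ 2 - p * q * (C W.a₁ * X + C W.a₃) -
          q ^ 2 * (X ^ 3 + C W.a₂ * X ^ 2 + C W.a₄ * X + C W.a₆)) + q * (p * (C W.a₁ * X + C W.a₃) +
          q * (X ^ 3 + C W.a₂ * X ^ 2 + C W.a₄ * X + C W.a₆)) := by ring
      rw [e]
      exact dvd_add this (hq.mul_right _)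
    obtain ⟨p', rfl⟩ := hp
    obtain ⟨q', rfl⟩ := hq
    exact ⟨p' • 1 + q' • mk W Y, by rw [smul_add, smul_smul, smul_smul]⟩
  · exfalso
    have hc : IsCoprime (π ^ 2) q := ((hπ.coprime_iff_not_dvd).2 hq).pow_left
    obtain ⟨s, r, hsr⟩ := hc
    -- `r` inverts `q` modulo `π ^ 2`, so Y = -pr is where p + qY vanishes modulo `π ^ 2`. There the
    -- norm and the trace become the Weierstrass equation and its y-partial, up to units.
    refine not_sq_dvd (W := W) hπ (-(p * r)) ?_ ?_
    · have e : (-(p * r)) ^ 2 + -(p * r) * (C W.a₁ * X + C W.a₃) -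
          (X ^ 3 + C W.a₂ * X ^ 2 + C W.a₄ * X + C W.a₆) =
        r ^ 2 * (p ^ 2 - p * q * (C W.a₁ * X + C W.a₃) -
          q ^ 2 * (X ^ 3 + C W.a₂ * X ^ 2 + C W.a₄ * X + C W.a₆)) +
        π ^ 2 * (- s * (p * r * (C W.a₁ * X + C W.a₃)) -
          s * (1 + r * q) * (X ^ 3 + C W.a₂ * X ^ 2 + C W.a₄ * X + C W.a₆)) := by
        linear_combination (p * r * (C W.a₁ * X + C W.a₃) +
          (1 + r * q) * (X ^ 3 + C W.a₂ * X ^ 2 + C W.a₄ * X + C W.a₆)) * hsr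
      rw [e]
      exact dvd_add (hN.mul_left _) (Dvd.intro _ rfl)
    · have e : 2 * (-(p * r)) + (C W.a₁ * X + C W.a₃) =
        -r * (2 * p - q * (C W.a₁ * X + C W.a₃)) + π * (s * π * (C W.a₁ * X + C W.a₃)) := by
        linear_combination -(C W.a₁ * X + C W.a₃) * hsr
      rw [e]
      exact dvd_add (hT.mul_left _) (Dvd.intro _ rfl)

/-- An integral element times some nonzero polynomial lies in the coordinate ring;
`dvd_of_isIntegral` cancels the irreducible factors of that polynomial one at a time. -/
instance [W.IsElliptic] : IsIntegrallyClosed W.CoordinateRing := by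
  rw [isIntegrallyClosed_iff W.FunctionField]
  intro f hf
  have hf : _root_.IsIntegral K[X] f := isIntegral_trans (R := K[X]) (A := W.CoordinateRing) _ hf
  have htower : ∀ a : K[X], algebraMap W.CoordinateRing W.FunctionField (algebraMap _ _ a) =
    algebraMap K[X] W.FunctionField a := fun a => (IsScalarTower.algebraMap_apply ..).symm
  have hred : ∀ r : K[X], r ≠ 0 → ∀ f : W.FunctionField, _root_.IsIntegral K[X] f →
      (∃ g, algebraMap W.CoordinateRing _ g = f * algebraMap K[X] _ r) →
      ∃ g, algebraMap W.CoordinateRing _ g = f := by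
    intro r
    induction r using WfDvdMonoid.induction_on_irreducible with
    | zero => exact fun h => (h rfl).elim
    | unit u hu =>
      rintro - f - ⟨g, hg⟩
      obtain ⟨u, rfl⟩ := hu
      refine ⟨algebraMap K[X] _ (↑u⁻¹ : K[X]) * g, ?_⟩
      rw [map_mul, hg, htower, mul_left_comm, ← map_mul, Units.inv_mul, map_one, mul_one]
    | mul a π ha hπ ih =>
      rintro hne f hf ⟨g, hg⟩
      have hπ0 : algebraMap K[X] W.FunctionField π ≠ 0 :=
        (map_ne_zero_iff _ algebraMap_polynomial_injective).2 hπ.ne_zero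
      have : _root_.IsIntegral K[X] (algebraMap _ W.FunctionField g / algebraMap K[X] _ π) := by
        rw [hg, map_mul, mul_left_comm, mul_div_cancel_left₀ _ hπ0]
        exact hf.mul isIntegral_algebraMap
      obtain ⟨g', rfl⟩ := dvd_of_isIntegral hπ this
      refine ih ha f hf ⟨g', ?_⟩
      rw [Algebra.smul_def, map_mul, htower, map_mul, mul_left_comm] at hg
      exact mul_left_cancel₀ hπ0 hg
  obtain ⟨a, s, hs, rfl⟩ := IsFractionRing.div_surjective (A := W.CoordinateRing) f
  have hs0 : s ≠ 0 := nonZeroDivisors.ne_zero hs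
  -- Expanding the fraction by the conjugate of its denominator makes the denominator a norm, hence
  -- a polynomial.
  refine hred _ (norm_ne_zero hs0) _ hf ⟨a * conj W s, ?_⟩
  have : algebraMap _ W.FunctionField s ≠ 0 :=
    (map_ne_zero_iff _ (IsFractionRing.injective _ _)).2 hs0
  rw [← htower, ← mul_conj, map_mul, map_mul, ← mul_assoc, div_mul_cancel₀ _ this]

instance : IsNoetherianRing W.CoordinateRing :=
  IsNoetherianRing.of_finite K[X] W.CoordinateRing

/-- A nonzero prime contains the norm of each of its elements, so it contracts to a nonzero, hence
maximal, prime of `K[X]`; integrality lifts maximality. -/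
instance : Ring.DimensionLEOne W.CoordinateRing where
  maximalOfPrime {p} hp0 hp := by
    have : (p.comap (algebraMap K[X] W.CoordinateRing)).IsMaximal := by
      refine Ideal.IsPrime.isMaximal inferInstance ?_
      obtain ⟨g, hg, hg0⟩ := (Submodule.ne_bot_iff _).1 hp0
      refine (Submodule.ne_bot_iff _).2 ⟨Algebra.norm K[X] g, ?_, norm_ne_zero hg0⟩
      rw [Ideal.mem_comap, ← mul_conj]
      exact Ideal.mul_mem_right _ _ hg
    exact Ideal.isMaximal_of_isIntegral_of_isMaximal_comap p this

instance [W.IsElliptic] : IsDedekindDomain W.CoordinateRing where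

end CoordinateRing
end WeierstrassCurve.Affine
end

noncomputable section

open WithZero IsDedekindDomain

/-! ### The valuation of a place -/

/-- A discrete valuation ring is a maximal proper subring of its field, so an inclusion of valuation
rings is enough. Since both valuations take the value `exp (-1)`, they are equal and not merely
equivalent. -/
theorem Valuation.eq_of_forall_le_one {F : Type*} [Field F] {v w : Valuation F ℤᵐ⁰}
    (h : ∀ u, w u ≤ 1 → v u ≤ 1) (hw : ∃ π, w π = exp (-1 : ℤ)) (hv : ∃ t, v t = exp (-1 : ℤ)) :
    v = w := by
  obtain ⟨π, hπ⟩ := hw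
  obtain ⟨t, ht⟩ := hv
  have h1 : ∀ u, w u = 1 → v u = 1 := fun u hu => by
    refine le_antisymm (h u hu.le) ?_
    have := h u⁻¹ (by rw [map_inv₀, hu, inv_one])
    rw [map_inv₀] at this
    have h0 : v u ≠ 0 := by
      rw [Valuation.ne_zero_iff]
      rintro rfl
      rw [map_zero] at hu
      exact zero_ne_one hu
    exact (inv_le_one₀ (zero_lt_iff.2 h0)).1 this
  have hπ0 : π ≠ 0 := fun h0 => by rw [h0, map_zero] at hπ; exact exp_ne_zero hπ.symm
  have h2 : ∀ u, u ≠ 0 → v u = v π ^ (-log (w u)) := fun u hu => by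
    have hwu : w u ≠ 0 := (Valuation.ne_zero_iff w).2 hu
    have : w (u * π ^ (log (w u))) = 1 := by
      rw [map_mul, map_zpow₀, hπ, ← exp_zsmul, smul_eq_mul, mul_neg_one, exp_neg, exp_log hwu,
        mul_inv_cancel₀ hwu]
    have := h1 _ this
    rw [map_mul, map_zpow₀] at this
    rw [zpow_neg, eq_inv_of_mul_eq_one_left this]
  have hvπ0 : v π ≠ 0 := (Valuation.ne_zero_iff v).2 hπ0
  have hvπ : v π = exp (-1 : ℤ) := by
    have ht0 : t ≠ 0 := fun h0 => by rw [h0, map_zero] at ht; exact exp_ne_zero ht.symm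
    have e := h2 t ht0
    have hle := h π (by rw [hπ, ← exp_zero, exp_le_exp]; norm_num)
    obtain ⟨n, hn⟩ : ∃ n : ℤ, v π = exp n := ⟨_, (exp_log hvπ0).symm⟩
    rw [hn, ← exp_zero, exp_le_exp] at hle
    rw [ht, hn, ← exp_zsmul, exp_inj, smul_eq_mul] at e
    rw [hn]
    congr 1
    -- `v` is normalized, so -1 is a multiple of the exponent of `v π`; together with `v π ≤ 1` this
    -- leaves the exponent -1.
    have : n ∣ -1 := ⟨_, e.trans (mul_comm _ _)⟩
    have := Int.isUnit_iff.1 (isUnit_of_dvd_unit this (by norm_num))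
    omega
  ext u
  by_cases hu : u = 0
  · simp [hu]
  · rw [h2 u hu, hvπ, ← exp_zsmul, smul_eq_mul, mul_neg_one, neg_neg,
      exp_log ((Valuation.ne_zero_iff w).2 hu)]

namespace Place

variable {K F : Type*} [Field K] [Field F] [Algebra K F]

/-- The normalized valuation of a place. -/
def val (v : Place K F) : Valuation F ℤᵐ⁰ :=
  haveI := v.isDVR
  (IsDiscreteValuationRing.maximalIdeal v.ring).valuation F

variable (v : Place K F)

theorem val_le_one_iff {f : F} : v.val f ≤ 1 ↔ f ∈ v.ring := by
  have := v.isDVR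
  refine ⟨fun h => ?_, fun h => ?_⟩
  · obtain ⟨a, rfl⟩ := IsDiscreteValuationRing.exists_lift_of_le_one h
    exact a.2
  · exact HeightOneSpectrum.valuation_le_one _ (⟨f, h⟩ : v.ring)

theorem val_lt_one_iff {f : F} (hf : f ∈ v.ring) :
    v.val f < 1 ↔ (⟨f, hf⟩ : v.ring) ∈ IsLocalRing.maximalIdeal v.ring := by
  have := v.isDVR
  exact HeightOneSpectrum.valuation_lt_one_iff_mem (K := F)
    (IsDiscreteValuationRing.maximalIdeal v.ring) (⟨f, hf⟩ : v.ring)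

theorem isUniformizer_iff {t : F} : v.IsUniformizer t ↔ v.val t = exp (-1 : ℤ) := by
  have := v.isDVR
  constructor
  · rintro ⟨π, hπ, rfl⟩
    refine (HeightOneSpectrum.valuation_of_algebraMap _ π).trans
      (HeightOneSpectrum.intValuation_singleton _ hπ.ne_zero ?_)
    exact (IsDiscreteValuationRing.irreducible_iff_uniformizer π).1 hπ
  · intro h
    have hle : v.val t ≤ 1 := by rw [h, ← exp_zero, exp_le_exp]; norm_num
    have ht := v.val_le_one_iff.1 hle
    refine ⟨⟨t, ht⟩, ?_, rfl⟩
    obtain ⟨π, hπ⟩ := IsDiscreteValuationRing.exists_irreducible v.ring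
    have hπv : v.val (π : F) = exp (-1 : ℤ) :=
      (HeightOneSpectrum.valuation_of_algebraMap _ π).trans
        (HeightOneSpectrum.intValuation_singleton _ hπ.ne_zero
          ((IsDiscreteValuationRing.irreducible_iff_uniformizer π).1 hπ))
    obtain ⟨u, hu⟩ := IsDiscreteValuationRing.associated_of_valuation_eq (A := v.ring)
      (π : F) t (hπv.trans h.symm)
    refine (Associated.irreducible_iff ⟨u, ?_⟩).1 hπ
    apply Subtype.ext
    rw [mul_comm]
    exact hu

theorem exists_val_eq : ∃ t, v.val t = exp (-1 : ℤ) :=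
  let ⟨t, ht⟩ := v.exists_isUniformizer
  ⟨t, v.isUniformizer_iff.1 ht⟩

theorem vanishes_iff {f : F} : v.Vanishes f ↔ v.val f < 1 := by
  rw [Vanishes]
  constructor
  · intro h
    have hf := (v.ring.valuation_le_one_iff _).1 h.le
    rw [v.val_lt_one_iff hf]
    exact (ValuationSubring.valuation_lt_one_iff v.ring ⟨f, hf⟩).2 h
  · intro h
    have hf := v.val_le_one_iff.1 h.le
    rw [v.val_lt_one_iff hf] at h
    exact (ValuationSubring.valuation_lt_one_iff v.ring ⟨f, hf⟩).1 h

theorem ordGE_iff {n : ℤ} {f : F} : v.OrdGE n f ↔ v.val f ≤ exp (-n) := by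
  have key : ∀ t, v.val t = exp (-1 : ℤ) → (f / t ^ n ∈ v.ring ↔ v.val f ≤ exp (-n)) := by
    intro t ht
    rw [← val_le_one_iff, map_div₀, map_zpow₀, ht, ← exp_zsmul, smul_eq_mul, mul_neg_one,
      div_le_one₀ (zero_lt_iff.2 exp_ne_zero)]
  constructor
  · intro h
    obtain ⟨t, ht⟩ := v.exists_isUniformizer
    exact (key t (v.isUniformizer_iff.1 ht)).1 (h t ht)
  · exact fun h t ht => (key t (v.isUniformizer_iff.1 ht)).2 h

theorem val_algebraMap {a : K} (ha : a ≠ 0) : v.val (algebraMap K F a) = 1 := by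
  refine le_antisymm (v.val_le_one_iff.2 (v.algebraMap_mem a)) ?_
  have h := v.val_le_one_iff.2 (v.algebraMap_mem a⁻¹)
  rw [map_inv₀, map_inv₀] at h
  have h0 : v.val (algebraMap K F a) ≠ 0 := by simpa using ha
  exact (inv_le_one₀ (zero_lt_iff.2 h0)).1 h

theorem val_algebraMap_le (a : K) : v.val (algebraMap K F a) ≤ 1 :=
  v.val_le_one_iff.2 (v.algebraMap_mem a)

theorem val_smul_le (a : K) (f : F) : v.val (a • f) ≤ v.val f := by
  rw [Algebra.smul_def, map_mul]
  exact mul_le_of_le_one_left' (v.val_algebraMap_le a)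

/-- A surjective discrete valuation of `F` that is trivial on `K` comes from a place. -/
theorem exists_of_valuation (w : Valuation F ℤᵐ⁰) (hK : ∀ a : K, w (algebraMap K F a) ≤ 1)
    (hw : ∃ π, w π = exp (-1 : ℤ)) : ∃ v : Place K F, v.val = w := by
  have hnt : w.IsNontrivial := by
    obtain ⟨π, hπ⟩ := hw
    refine ⟨π, ?_⟩
    rw [hπ]
    exact ⟨exp_ne_zero, fun h => by simp at h⟩
  have hdvr : IsDiscreteValuationRing w.valuationSubring := inferInstance
  refine ⟨⟨w.valuationSubring, fun a => (w.mem_valuationSubring_iff _).2 (hK a), hdvr⟩, ?_⟩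
  refine Valuation.eq_of_forall_le_one (fun u hu => ?_) hw (exists_val_eq _)
  exact (val_le_one_iff _).2 ((w.mem_valuationSubring_iff _).2 hu)

end Place
end

noncomputable section

open WithZero IsDedekindDomain Polynomial Polynomial.Bivariate

/-! ### The valuation at infinity -/

namespace WeierstrassCurve.Affine
variable {K : Type*} [Field K] {W : WeierstrassCurve.Affine K}
namespace CoordinateRing

/-- The contributions 2 deg p and 2 deg q + 3 have different parities and cannot cancel, so the
bound splits into conditions on single coefficients. The degree of the norm is the pole order at
infinity. -/
theorem degree_norm_le_iff (p q : K[X]) (n : ℕ) :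
    (Algebra.norm K[X] (p • (1 : W.CoordinateRing) + q • mk W Y)).degree ≤ n ↔
      (∀ m, n < 2 * m → p.coeff m = 0) ∧ (∀ m, n < 2 * m + 3 → q.coeff m = 0) := by
  rw [degree_norm_smul_basis, max_le_iff]
  refine and_congr ?_ ?_
  · by_cases hp : p = 0
    · simp [hp]
    rw [degree_eq_natDegree hp]
    constructor
    · intro h m hm
      apply coeff_eq_zero_of_natDegree_lt
      rw [nsmul_eq_mul] at h
      norm_cast at h
      omega
    · intro h
      rw [nsmul_eq_mul]
      norm_cast
      by_contra! hlt
      exact hp (leadingCoeff_eq_zero.1 (h _ (by simpa using hlt)))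
  · by_cases hq : q = 0
    · simp [hq]
    rw [degree_eq_natDegree hq]
    constructor
    · intro h m hm
      apply coeff_eq_zero_of_natDegree_lt
      rw [nsmul_eq_mul] at h
      norm_cast at h
      omega
    · intro h
      rw [nsmul_eq_mul]
      norm_cast
      by_contra! hlt
      exact hq (leadingCoeff_eq_zero.1 (h _ (by simpa using hlt)))

theorem degree_norm_add_le {g h : W.CoordinateRing} {n : ℕ}
    (hg : (Algebra.norm K[X] g).degree ≤ n) (hh : (Algebra.norm K[X] h).degree ≤ n) :
    (Algebra.norm K[X] (g + h)).degree ≤ n := by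
  obtain ⟨p, q, rfl⟩ := exists_smul_basis_eq g
  obtain ⟨p', q', rfl⟩ := exists_smul_basis_eq h
  rw [add_add_add_comm, ← add_smul, ← add_smul]
  rw [degree_norm_le_iff] at hg hh ⊢
  exact ⟨fun m hm => by rw [coeff_add, hg.1 m hm, hh.1 m hm, add_zero],
    fun m hm => by rw [coeff_add, hg.2 m hm, hh.2 m hm, add_zero]⟩

/-- Two elements of the same degree are proportional up to an element of smaller degree. -/
theorem exists_degree_norm_sub_lt {g h : W.CoordinateRing} {n : ℕ}
    (hg : (Algebra.norm K[X] g).degree ≤ n) (hh : (Algebra.norm K[X] h).degree = n) :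
    ∃ c : K, (Algebra.norm K[X] (g - c • h)).degree < n := by
  obtain ⟨p, q, rfl⟩ := exists_smul_basis_eq g
  obtain ⟨p', q', rfl⟩ := exists_smul_basis_eq h
  have key : ∀ c : K, p • (1 : W.CoordinateRing) + q • mk W Y - c • (p' • 1 + q' • mk W Y) =
      (p - c • p') • 1 + (q - c • q') • mk W Y := fun c => by
    rw [sub_smul, sub_smul, smul_add, smul_assoc, smul_assoc]
    abel
  simp only [key]
  -- The strict inequality is restated as a bound by n - 1, to which `degree_norm_le_iff` applies;
  -- for n = 0 it means that the element is zero.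
  have hlt : ∀ r : W.CoordinateRing, (Algebra.norm K[X] r).degree < n ↔
      n ≠ 0 ∧ (Algebra.norm K[X] r).degree ≤ (n - 1 : ℕ) ∨ n = 0 ∧ r = 0 := by
    intro r
    rcases n with _ | n
    · simp [Algebra.norm_eq_zero_iff]
    · rw [Nat.add_sub_cancel]
      simp only [ne_eq, Nat.add_eq_zero_iff, one_ne_zero, and_false, not_false_eq_true, true_and,
        false_and, or_false]
      by_cases hr : Algebra.norm K[X] r = 0
      · simp [hr]
      · rw [degree_eq_natDegree hr]
        norm_cast
        exact Nat.lt_succ_iff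
  have hh2 := not_lt.2 hh.ge
  rw [hlt] at hh2
  have hh1 := (degree_norm_le_iff _ _ _).1 hh.le
  rw [degree_norm_le_iff] at hg
  rcases Nat.eq_zero_or_pos n with rfl | hn
  · have hq : ∀ m, q.coeff m = 0 := fun m => hg.2 m (by omega)
    have hq' : ∀ m, q'.coeff m = 0 := fun m => hh1.2 m (by omega)
    have hp' : p'.coeff 0 ≠ 0 := by
      intro h0
      refine hh2 (Or.inr ⟨rfl, ?_⟩)
      have e1 : p' = 0 := by
        ext m
        rcases m with _ | m
        · exact h0
        · exact hh1.1 _ (by omega)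
      have e2 : q' = 0 := by ext m; exact hq' m
      rw [e1, e2]; simp
    refine ⟨p.coeff 0 / p'.coeff 0, (hlt _).2 (Or.inr ⟨rfl, ?_⟩)⟩
    have e1 : p - (p.coeff 0 / p'.coeff 0) • p' = 0 := by
      ext m
      rcases m with _ | m
      · simp [hp']
      · simp [hg.1 (m + 1) (by omega), hh1.1 (m + 1) (by omega)]
    have e2 : q - (p.coeff 0 / p'.coeff 0) • q' = 0 := by ext m; simp [hq, hq']
    rw [e1, e2]; simp
  · have hn0 : n ≠ 0 := hn.ne'
    simp only [hn0, ne_eq, not_false_eq_true, true_and, false_and, or_false] at hlt hh2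
    rw [degree_norm_le_iff] at hh2
    simp only [hlt, degree_norm_le_iff, coeff_sub, coeff_smul, smul_eq_mul]
    -- The leading coefficient sits in `p'` at X^k if n = 2k and in `q'` at X^(k-1) if n = 2k + 1.
    -- The degree 1 does not occur, whence `1 ≤ k` in the odd case.
    rcases Nat.even_or_odd' n with ⟨k, rfl | rfl⟩
    · have hk : p'.coeff k ≠ 0 := fun h0 => hh2 ⟨fun m hm => by
        rcases eq_or_ne m k with rfl | hmk
        · exact h0
        · exact hh1.1 m (by omega), fun m hm => hh1.2 m (by omega)⟩
      refine ⟨p.coeff k / p'.coeff k, fun m hm => ?_, fun m hm => ?_⟩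
      · rcases eq_or_ne m k with rfl | hmk
        · rw [div_mul_cancel₀ _ hk, sub_self]
        · rw [hg.1 m (by omega), hh1.1 m (by omega), mul_zero, sub_zero]
      · rw [hg.2 m (by omega), hh1.2 m (by omega), mul_zero, sub_zero]
    · have hk : 1 ≤ k ∧ q'.coeff (k - 1) ≠ 0 := by
        by_contra hcon
        refine hh2 ⟨fun m hm => hh1.1 m (by omega), fun m hm => ?_⟩
        rcases eq_or_ne (m + 1) k with hmk | hmk
        · by_contra hne
          exact hcon ⟨by omega, by rwa [show k - 1 = m by omega]⟩
        · exact hh1.2 m (by omega)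
      refine ⟨q.coeff (k - 1) / q'.coeff (k - 1), fun m hm => ?_, fun m hm => ?_⟩
      · rw [hg.1 m (by omega), hh1.1 m (by omega), mul_zero, sub_zero]
      · rcases eq_or_ne m (k - 1) with rfl | hmk
        · rw [div_mul_cancel₀ _ hk.2, sub_self]
        · rw [hg.2 m (by omega), hh1.2 m (by omega), mul_zero, sub_zero]

open Classical in
variable (W) in
/-- The valuation of the coordinate ring at infinity, minus the degree. -/
def degreeValuation : Valuation W.CoordinateRing ℤᵐ⁰ where
  toFun g := if g = 0 then 0 else exp ((Algebra.norm K[X] g).natDegree : ℤ)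
  map_zero' := if_pos rfl
  map_one' := by simp
  map_mul' g h := by
    by_cases hg : g = 0
    · simp [hg]
    by_cases hh : h = 0
    · simp [hh]
    rw [if_neg hg, if_neg hh, if_neg (mul_ne_zero hg hh), map_mul,
      natDegree_mul (norm_ne_zero hg) (norm_ne_zero hh), Nat.cast_add, exp_add]
  map_add_le_max' g h := by
    by_cases hg : g = 0
    · simp [hg]
    by_cases hh : h = 0
    · simp [hh]
    by_cases hgh : g + h = 0
    · simp [hgh]
    rw [if_neg hg, if_neg hh, if_neg hgh, le_max_iff, exp_le_exp, exp_le_exp, Nat.cast_le,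
      Nat.cast_le, ← le_max_iff]
    refine natDegree_le_iff_degree_le.2 (degree_norm_add_le ?_ ?_)
    · exact natDegree_le_iff_degree_le.1 (le_max_left _ _)
    · exact natDegree_le_iff_degree_le.1 (le_max_right _ _)

theorem degreeValuation_apply {g : W.CoordinateRing} (hg : g ≠ 0) :
    degreeValuation W g = exp ((Algebra.norm K[X] g).natDegree : ℤ) :=
  if_neg hg

theorem degreeValuation_le_iff {g : W.CoordinateRing} {n : ℕ} :
    degreeValuation W g ≤ exp (n : ℤ) ↔ (Algebra.norm K[X] g).degree ≤ n := by
  by_cases hg : g = 0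
  · simp [hg]
  rw [degreeValuation_apply hg, exp_le_exp, Nat.cast_le, natDegree_le_iff_degree_le]

theorem degreeValuation_lt_iff {g : W.CoordinateRing} {n : ℕ} :
    degreeValuation W g < exp (n : ℤ) ↔ (Algebra.norm K[X] g).degree < n := by
  by_cases hg : g = 0
  · simp [hg]
  rw [degreeValuation_apply hg, exp_lt_exp, Nat.cast_lt, natDegree_lt_iff_degree_lt
    (norm_ne_zero hg)]

end CoordinateRing

open CoordinateRing

variable (W) in
/-- The normalized valuation of the function field at the point at infinity. -/
def inftyValuation : Valuation W.FunctionField ℤᵐ⁰ :=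
  (degreeValuation W).extendToLocalization (S := nonZeroDivisors W.CoordinateRing)
    (fun g hg h0 => by
      have hg0 := nonZeroDivisors.ne_zero hg
      have : degreeValuation W g = 0 := h0
      rw [degreeValuation_apply hg0] at this
      exact exp_ne_zero this) _

theorem inftyValuation_algebraMap (g : W.CoordinateRing) :
    inftyValuation W (algebraMap _ _ g) = degreeValuation W g :=
  Valuation.extendToLocalization_apply_map_apply _ _ _ g

/-- The residue field at infinity is `K`: in a fraction g/h without a pole, the multiple of `h` that
cancels the term of top degree in `g` can be subtracted. -/
theorem exists_inftyValuation_sub_lt {f : W.FunctionField} (hf : inftyValuation W f ≤ 1) :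
    ∃ c : K, inftyValuation W (f - algebraMap K _ c) < 1 := by
  obtain ⟨g, h, hh, rfl⟩ := IsFractionRing.div_surjective (A := W.CoordinateRing) f
  have hh0 := nonZeroDivisors.ne_zero hh
  set n := (Algebra.norm K[X] h).natDegree with hn
  have hdh : (Algebra.norm K[X] h).degree = n := degree_eq_natDegree (norm_ne_zero hh0)
  have hvh : inftyValuation W (algebraMap _ _ h) = exp (n : ℤ) := by
    rw [inftyValuation_algebraMap, degreeValuation_apply hh0]
  have hpos : (0 : ℤᵐ⁰) < exp (n : ℤ) := zero_lt_iff.2 exp_ne_zero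
  rw [map_div₀, hvh, div_le_one₀ hpos, inftyValuation_algebraMap, degreeValuation_le_iff] at hf
  obtain ⟨c, hc⟩ := exists_degree_norm_sub_lt hf hdh
  refine ⟨c, ?_⟩
  have hne : algebraMap _ W.FunctionField h ≠ 0 :=
    (map_ne_zero_iff _ (IsFractionRing.injective _ _)).2 hh0
  have : algebraMap _ W.FunctionField g / algebraMap _ _ h - algebraMap K _ c =
      algebraMap _ _ (g - c • h) / algebraMap _ _ h := by
    rw [map_sub, sub_div, Algebra.smul_def, map_mul, mul_div_cancel_right₀ _ hne,
      ← IsScalarTower.algebraMap_apply]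
  rw [this, map_div₀, hvh, div_lt_one₀ hpos, inftyValuation_algebraMap, degreeValuation_lt_iff]
  exact hc

theorem xFun_eq : W.xFun = algebraMap K[X] W.FunctionField X :=
  (IsScalarTower.algebraMap_apply K[X] W.CoordinateRing W.FunctionField X).symm

theorem smul_basis_eq_fun (p q : K[X]) :
    algebraMap W.CoordinateRing W.FunctionField (p • 1 + q • CoordinateRing.mk W Y) =
      aeval W.xFun p + aeval W.xFun q * W.yFun := by
  have h : ∀ p : K[X], algebraMap K[X] W.FunctionField p = aeval W.xFun p := fun p => by
    rw [xFun_eq, aeval_algebraMap_apply, aeval_X_left_apply]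
  rw [map_add, Algebra.smul_def, Algebra.smul_def, map_mul, map_mul,
    ← IsScalarTower.algebraMap_apply, ← IsScalarTower.algebraMap_apply, h, h, map_one, mul_one]
  rfl

theorem yFun_sq : W.yFun ^ 2 = W.xFun ^ 3 + algebraMap K _ W.a₂ * W.xFun ^ 2 +
    algebraMap K _ W.a₄ * W.xFun + algebraMap K _ W.a₆ -
      (algebraMap K _ W.a₁ * W.xFun + algebraMap K _ W.a₃) * W.yFun := by
  have hC : ∀ a : K, algebraMap K W.FunctionField a =
    algebraMap W.CoordinateRing W.FunctionField (CoordinateRing.mk W (C (C a))) := fun a =>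
      IsScalarTower.algebraMap_apply K W.CoordinateRing W.FunctionField a
  have : CoordinateRing.mk W Y ^ 2 = CoordinateRing.mk W (C (X ^ 3 + C W.a₂ * X ^ 2 + C W.a₄ * X + C W.a₆) -
      C (C W.a₁ * X + C W.a₃) * Y) := AdjoinRoot.mk_eq_mk.mpr ⟨1, by rw [polynomial]; ring1⟩
  have := congrArg (algebraMap W.CoordinateRing W.FunctionField) this
  simp only [map_add, map_sub, map_mul, map_pow] at this
  rw [hC, hC, hC, hC, hC]
  exact this

end WeierstrassCurve.Affine
end

noncomputable section

open WithZero IsDedekindDomain Polynomial Polynomial.Bivariate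

/-! ### The places of the function field -/

namespace WeierstrassCurve.Affine
variable {K : Type*} [Field K] {W : WeierstrassCurve.Affine K}
open CoordinateRing

section Classification

variable (v : Place K W.FunctionField)

theorem val_xFun_sq_cubic_lt (hx : 1 < v.val W.xFun) :
    v.val (W.xFun ^ 3 + algebraMap K _ W.a₂ * W.xFun ^ 2 +
      algebraMap K _ W.a₄ * W.xFun + algebraMap K _ W.a₆) = v.val W.xFun ^ 3 := by
  have hx0 : 0 < v.val W.xFun := zero_lt_one.trans hx
  rw [add_assoc, add_assoc, Valuation.map_add_eq_of_lt_left, map_pow]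
  rw [map_pow]
  refine Valuation.map_add_lt _ ?_ (Valuation.map_add_lt _ ?_ ?_)
  · rw [map_mul, map_pow]
    exact (mul_le_of_le_one_left' (v.val_algebraMap_le _)).trans_lt
      (pow_lt_pow_right₀ hx (by norm_num))
  · rw [map_mul]
    exact (mul_le_of_le_one_left' (v.val_algebraMap_le _)).trans_lt
      (lt_self_pow₀ hx (by norm_num))
  · exact (v.val_algebraMap_le _).trans_lt (one_lt_pow₀ hx (by norm_num))

/-- In the Weierstrass equation x^3 dominates the right-hand side. If y did not exceed x in value,
the left-hand side would be at most v(x)^2; so it does, and y^2 dominates the left-hand side. -/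
theorem val_yFun_sq (hx : 1 < v.val W.xFun) : v.val W.yFun ^ 2 = v.val W.xFun ^ 3 := by
  have hx0 : 0 < v.val W.xFun := zero_lt_one.trans hx
  have h := val_xFun_sq_cubic_lt v hx
  have hlin : v.val (algebraMap K _ W.a₁ * W.xFun + algebraMap K _ W.a₃) ≤ v.val W.xFun := by
    refine Valuation.map_add_le _ ?_ ((v.val_algebraMap_le _).trans hx.le)
    rw [map_mul]
    exact mul_le_of_le_one_left' (v.val_algebraMap_le _)
  have hlt : v.val W.xFun < v.val W.yFun := by
    by_contra! hle
    have : v.val (W.yFun ^ 2 +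
        (algebraMap K _ W.a₁ * W.xFun + algebraMap K _ W.a₃) * W.yFun) ≤ v.val W.xFun ^ 2 := by
      refine Valuation.map_add_le _ ?_ ?_
      · rw [map_pow]
        exact pow_le_pow_left₀ zero_le hle 2
      · rw [map_mul, sq]
        exact mul_le_mul' hlin hle
    rw [yFun_sq, sub_add_cancel, h] at this
    exact absurd this (not_le.2 (pow_lt_pow_right₀ hx (by norm_num)))
  have hy0 : 0 < v.val W.yFun := hx0.trans hlt
  have e : v.val (W.yFun ^ 2 +
      (algebraMap K _ W.a₁ * W.xFun + algebraMap K _ W.a₃) * W.yFun) = v.val (W.yFun ^ 2) := by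
    refine Valuation.map_add_eq_of_lt_left _ ?_
    rw [map_mul, map_pow, sq]
    exact mul_lt_mul_of_pos_right (hlin.trans_lt hlt) hy0
  rw [← map_pow, ← e, yFun_sq, sub_add_cancel, h]

/-- The squares of the values of p(x) and q(x)y are v(x)^(2 deg p) and v(x)^(2 deg q + 3), never
equal, so the larger one decides. Squaring avoids half-integral powers of v(x). -/
theorem val_algebraMap_sq (hx : 1 < v.val W.xFun) {g : W.CoordinateRing} (hg : g ≠ 0) :
    v.val (algebraMap _ _ g) ^ 2 = v.val W.xFun ^ (Algebra.norm K[X] g).natDegree := by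
  have : v.val.IsTrivialOn K := ⟨fun a ha => v.val_algebraMap ha⟩
  have hp : ∀ p : K[X], p ≠ 0 → v.val (aeval W.xFun p) = v.val W.xFun ^ p.natDegree :=
    fun p hp => valuation_aeval_eq_valuation_X_pow_natDegree_of_one_lt_valuation_X _ hx hp
  obtain ⟨p, q, rfl⟩ := exists_smul_basis_eq g
  have hdeg := degree_norm_smul_basis (W' := W) p q
  rw [smul_basis_eq_fun]
  have hq2 : q ≠ 0 → v.val (aeval W.xFun q * W.yFun) ^ 2 = v.val W.xFun ^ (2 * q.natDegree + 3) :=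
    fun hq => by rw [map_mul, mul_pow, val_yFun_sq v hx, hp q hq, ← pow_mul, ← pow_add, mul_comm 2]
  have hp2 : p ≠ 0 → v.val (aeval W.xFun p) ^ 2 = v.val W.xFun ^ (2 * p.natDegree) :=
    fun h => by rw [hp p h, ← pow_mul, mul_comm 2]
  by_cases hp0 : p = 0
  · have hq0 : q ≠ 0 := by rintro rfl; simp [hp0] at hg
    have : (Algebra.norm K[X] (p • (1 : W.CoordinateRing) + q • CoordinateRing.mk W Y)).natDegree
        = 2 * q.natDegree + 3 := by
      apply natDegree_eq_of_degree_eq_some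
      rw [hdeg, hp0, degree_zero, degree_eq_natDegree hq0]
      simp
    rw [this, hp0, map_zero, zero_add, hq2 hq0]
  by_cases hq0 : q = 0
  · have : (Algebra.norm K[X] (p • (1 : W.CoordinateRing) + q • CoordinateRing.mk W Y)).natDegree
        = 2 * p.natDegree := by
      apply natDegree_eq_of_degree_eq_some
      rw [hdeg, hq0, degree_zero, degree_eq_natDegree hp0]
      simp
    rw [this, hq0, map_zero, zero_mul, add_zero, hp2 hp0]
  have hnat : (Algebra.norm K[X] (p • (1 : W.CoordinateRing) + q • CoordinateRing.mk W Y)).natDegree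
        = max (2 * p.natDegree) (2 * q.natDegree + 3) := by
    apply natDegree_eq_of_degree_eq_some
    rw [hdeg, degree_eq_natDegree hp0, degree_eq_natDegree hq0]
    norm_cast
  rw [hnat]
  rcases lt_or_gt_of_ne (show 2 * p.natDegree ≠ 2 * q.natDegree + 3 by omega) with h | h
  · rw [max_eq_right h.le, ← hq2 hq0, Valuation.map_add_eq_of_lt_right]
    refine lt_of_pow_lt_pow_left₀ 2 zero_le ?_
    rw [hq2 hq0, hp2 hp0]
    exact pow_lt_pow_right₀ hx h
  · rw [max_eq_left h.le, ← hp2 hp0, Valuation.map_add_eq_of_lt_left]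
    refine lt_of_pow_lt_pow_left₀ 2 zero_le ?_
    rw [hq2 hq0, hp2 hp0]
    exact pow_lt_pow_right₀ hx h

theorem inftyValuation_xFun : inftyValuation W W.xFun = exp (2 : ℤ) := by
  rw [xFun, inftyValuation_algebraMap, degreeValuation_apply]
  · congr 1
    have : CoordinateRing.mk W (C (X : K[X])) =
        (X : K[X]) • (1 : W.CoordinateRing) + (0 : K[X]) • CoordinateRing.mk W Y := by
      rw [CoordinateRing.smul, zero_smul, add_zero, mul_one]
    have hd := degree_norm_smul_basis (W' := W) X 0
    rw [this, natDegree_eq_of_degree_eq_some (n := 2) (hd.trans (by simp))]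
    rfl
  · have := XClass_ne_zero (W' := W) 0
    simpa [XClass] using this

theorem inftyValuation_yFun : inftyValuation W W.yFun = exp (3 : ℤ) := by
  rw [yFun, inftyValuation_algebraMap, degreeValuation_apply]
  · congr 1
    have : CoordinateRing.mk W Y =
        (0 : K[X]) • (1 : W.CoordinateRing) + (1 : K[X]) • CoordinateRing.mk W Y := by
      simp
    have hd := degree_norm_smul_basis (W' := W) 0 1
    rw [this, natDegree_eq_of_degree_eq_some (n := 3) (hd.trans (by simp))]
    rfl
  · have := YClass_ne_zero (W' := W) 0
    simpa [YClass] using this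

theorem inftyValuation_div : inftyValuation W (W.xFun / W.yFun) = exp (-1 : ℤ) := by
  rw [map_div₀, inftyValuation_xFun, inftyValuation_yFun, ← exp_sub]
  norm_num

/-- At a pole of x all values are governed by the degree of the norm (`val_algebraMap_sq`), so the
ring of the valuation at infinity lies in `v.ring`. Thus there is only one place at infinity. -/
theorem val_eq_inftyValuation (hx : W.xFun ∉ v.ring) : v.val = inftyValuation W := by
  rw [← v.val_le_one_iff, not_le] at hx
  refine Valuation.eq_of_forall_le_one (fun u hu => ?_) ⟨_, inftyValuation_div⟩ v.exists_val_eq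
  obtain ⟨g, h, hh, rfl⟩ := IsFractionRing.div_surjective (A := W.CoordinateRing) u
  have hh0 := nonZeroDivisors.ne_zero hh
  by_cases hg0 : g = 0
  · simp [hg0]
  rw [map_div₀, inftyValuation_algebraMap, inftyValuation_algebraMap, degreeValuation_apply hg0,
    degreeValuation_apply hh0, div_le_one₀ (zero_lt_iff.2 exp_ne_zero), exp_le_exp,
    Nat.cast_le] at hu
  have hvh : v.val (algebraMap _ _ h) ≠ 0 := by
    rw [Valuation.ne_zero_iff]
    exact (map_ne_zero_iff _ (IsFractionRing.injective _ _)).2 hh0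
  rw [map_div₀, div_le_one₀ (zero_lt_iff.2 hvh)]
  refine (pow_le_pow_iff_left₀ zero_le zero_le two_ne_zero).1 ?_
  rw [val_algebraMap_sq v hx hg0, val_algebraMap_sq v hx hh0]
  exact pow_le_pow_right₀ hx.le hu

variable (W) in
theorem exists_place_infty : ∃ v : Place K W.FunctionField, v.val = inftyValuation W := by
  refine Place.exists_of_valuation _ (fun a => ?_) ⟨_, inftyValuation_div⟩
  rw [IsScalarTower.algebraMap_apply K W.CoordinateRing, inftyValuation_algebraMap, ← exp_zero,
    ← Nat.cast_zero, degreeValuation_le_iff,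
    IsScalarTower.algebraMap_apply K K[X] W.CoordinateRing, Algebra.norm_algebraMap]
  rw [Polynomial.algebraMap_eq, ← C_pow]
  exact degree_C_le

/-- y satisfies a monic quadratic equation over K[x], so it is regular wherever x is. -/
theorem algebraMap_mem_of_xFun_mem (hx : W.xFun ∈ v.ring) (g : W.CoordinateRing) :
    algebraMap _ _ g ∈ v.ring := by
  have hC : ∀ a : K, algebraMap K _ a ∈ v.ring := v.algebraMap_mem
  have hp : ∀ p : K[X], aeval W.xFun p ∈ v.ring := fun p => by
    induction p using Polynomial.induction_on' with
    | add p q hp hq => rw [map_add]; exact add_mem hp hq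
    | monomial n a =>
      rw [aeval_monomial]
      exact mul_mem (hC a) (pow_mem hx n)
  have hy : W.yFun ∈ v.ring := by
    by_contra hy
    have hy1 := not_le.1 (mt v.val_le_one_iff.1 hy)
    have h1 : v.val (W.yFun ^ 2) ≤ v.val W.yFun := by
      rw [yFun_sq, sub_eq_add_neg]
      refine Valuation.map_add_le _ ((v.val_le_one_iff.2 ?_).trans hy1.le) ?_
      · exact add_mem (add_mem (add_mem (pow_mem hx 3) (mul_mem (hC _) (pow_mem hx 2)))
          (mul_mem (hC _) hx)) (hC _)
      · rw [Valuation.map_neg, map_mul]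
        exact mul_le_of_le_one_left' (v.val_le_one_iff.2 (add_mem (mul_mem (hC _) hx) (hC _)))
    rw [map_pow] at h1
    exact absurd h1 (not_le.2 (lt_self_pow₀ hy1 (by norm_num)))
  obtain ⟨p, q, rfl⟩ := exists_smul_basis_eq g
  rw [smul_basis_eq_fun]
  exact add_mem (hp p) (mul_mem (hp q) hy)

variable [W.IsElliptic]

/-- The localization at `w` lies in the ring of `v`, because denominators outside `w` are units
there; `Valuation.eq_of_forall_le_one` turns the inclusion into equality. -/
theorem val_eq_valuation_of_forall (hR : ∀ g : W.CoordinateRing, algebraMap _ _ g ∈ v.ring)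
    (w : HeightOneSpectrum W.CoordinateRing)
    (hw : ∀ g : W.CoordinateRing, g ∉ w.asIdeal → v.val (algebraMap _ _ g) = 1) :
    v.val = w.valuation W.FunctionField := by
  refine Valuation.eq_of_forall_le_one (fun u hu => ?_)
    (w.valuation_exists_uniformizer W.FunctionField) v.exists_val_eq
  obtain ⟨n, d, hnd⟩ := w.exists_primeCompl_mul_eq_of_integer u hu
  have := congrArg v.val hnd
  rw [map_mul, hw d d.2, mul_one] at this
  rw [this]
  exact v.val_le_one_iff.2 (hR n)

/-- A place at which the coordinates are regular is a closed point of the affine curve. -/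
theorem exists_val_eq_valuation (hx : W.xFun ∈ v.ring) :
    ∃ w : HeightOneSpectrum W.CoordinateRing, v.val = w.valuation W.FunctionField := by
  have hR := algebraMap_mem_of_xFun_mem v hx
  have hle : ∀ g : W.CoordinateRing, v.val (algebraMap _ _ g) ≤ 1 :=
    fun g => v.val_le_one_iff.2 (hR g)
  let I : Ideal W.CoordinateRing :=
    { carrier := {g | v.val (algebraMap _ _ g) < 1}
      zero_mem' := by simp
      add_mem' := fun {a b} ha hb => by
        rw [Set.mem_ofPred_eq, map_add]
        exact Valuation.map_add_lt _ ha hb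
      smul_mem' := fun c a ha => by
        rw [Set.mem_ofPred_eq, smul_eq_mul, map_mul, map_mul]
        exact (mul_le_of_le_one_left' (hle c)).trans_lt ha }
  have hI : ∀ g, g ∈ I ↔ v.val (algebraMap _ _ g) < 1 := fun g => Iff.rfl
  have hnI : ∀ g, g ∉ I → v.val (algebraMap _ _ g) = 1 := fun g hg =>
    le_antisymm (hle g) (not_lt.1 hg)
  have hprime : I.IsPrime := by
    refine Ideal.isPrime_iff.2 ⟨?_, fun {a b} hab => ?_⟩
    · rw [Ideal.ne_top_iff_one, hI, map_one, map_one]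
      exact lt_irrefl _
    · by_contra! hcon
      rw [hI, map_mul, map_mul, hnI a hcon.1, hnI b hcon.2, mul_one] at hab
      exact lt_irrefl _ hab
  refine ⟨⟨I, hprime, fun hbot => ?_⟩, val_eq_valuation_of_forall v hR _ hnI⟩
  -- If the center of `v` were the zero ideal, every nonzero function would have value 1 and `v`
  -- would have no uniformizer.
  have h1 : ∀ g : W.CoordinateRing, g ≠ 0 → v.val (algebraMap _ _ g) = 1 := fun g hg =>
    hnI g (by rw [hbot]; exact hg)
  obtain ⟨t, ht⟩ := v.exists_val_eq
  obtain ⟨g, h, hh, rfl⟩ := IsFractionRing.div_surjective (A := W.CoordinateRing) t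
  have hh0 := nonZeroDivisors.ne_zero hh
  by_cases hg0 : g = 0
  · rw [hg0, map_zero, zero_div, map_zero] at ht
    exact exp_ne_zero ht.symm
  · rw [map_div₀, h1 g hg0, h1 h hh0, div_one] at ht
    simp at ht

theorem exists_place_of_heightOneSpectrum (w : HeightOneSpectrum W.CoordinateRing) :
    ∃ v : Place K W.FunctionField, v.val = w.valuation W.FunctionField := by
  refine Place.exists_of_valuation _ (fun a => ?_)
    (w.valuation_exists_uniformizer W.FunctionField)
  rw [IsScalarTower.algebraMap_apply K W.CoordinateRing]
  exact w.valuation_le_one _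

end Classification
end WeierstrassCurve.Affine
end

noncomputable section

open WithZero IsDedekindDomain Polynomial Polynomial.Bivariate

/-! ### Rational points -/

namespace WeierstrassCurve.Affine
variable {K : Type*} [Field K] {W : WeierstrassCurve.Affine K}

/-- Evaluation of the coordinate ring at a point. -/
def evalEquiv {a b : K} (h : W.Nonsingular a b) :
    (W.CoordinateRing ⧸ CoordinateRing.XYIdeal W a (C b)) ≃ₐ[K] K :=
  CoordinateRing.quotientXYIdealEquiv (by
    have := h.1
    rwa [Equation, evalEval] at this)

theorem isMaximal_XYIdeal {a b : K} (h : W.Nonsingular a b) :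
    (CoordinateRing.XYIdeal W a (C b)).IsMaximal :=
  Ideal.Quotient.maximal_of_isField _
    (MulEquiv.isField (Field.toIsField K) (evalEquiv h).toMulEquiv)

theorem XClass_mem_XYIdeal (a : K) (p : K[X]) :
    CoordinateRing.XClass W a ∈ CoordinateRing.XYIdeal W a p :=
  Ideal.subset_span (Set.mem_insert _ _)

theorem YClass_mem_XYIdeal (a : K) (p : K[X]) :
    CoordinateRing.YClass W p ∈ CoordinateRing.XYIdeal W a p :=
  Ideal.subset_span (Set.mem_insert_of_mem _ rfl)

/-- A rational affine point as a height one prime of the coordinate ring. -/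
def heightOneOfPoint {a b : K} (h : W.Nonsingular a b) : HeightOneSpectrum W.CoordinateRing where
  asIdeal := CoordinateRing.XYIdeal W a (C b)
  isPrime := (isMaximal_XYIdeal h).isPrime
  ne_bot hbot := by
    have := XClass_mem_XYIdeal (W := W) a (C b)
    rw [hbot] at this
    exact CoordinateRing.XClass_ne_zero a this

theorem exists_sub_algebraMap_mem {a b : K} (h : W.Nonsingular a b) (g : W.CoordinateRing) :
    ∃ c : K, g - algebraMap K _ c ∈ CoordinateRing.XYIdeal W a (C b) := by
  refine ⟨evalEquiv h (Ideal.Quotient.mk _ g), ?_⟩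
  rw [← Ideal.Quotient.eq]
  apply (evalEquiv h).injective
  exact ((evalEquiv h).commutes _).symm

theorem algebraMap_XClass (a : K) :
    algebraMap _ W.FunctionField (CoordinateRing.XClass W a) = W.xFun - algebraMap K _ a := by
  rw [CoordinateRing.XClass, C_sub, map_sub, map_sub]
  rfl

theorem algebraMap_YClass (p : K[X]) :
    algebraMap _ W.FunctionField (CoordinateRing.YClass W p) = W.yFun - aeval W.xFun p := by
  rw [CoordinateRing.YClass, map_sub, map_sub]
  have := smul_basis_eq_fun (W := W) p 0
  rw [CoordinateRing.smul, zero_smul, map_zero, zero_mul, add_zero, add_zero, mul_one] at this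
  rw [← this]
  rfl

theorem algebraMap_YClass_C (b : K) :
    algebraMap _ W.FunctionField (CoordinateRing.YClass W (C b)) =
      W.yFun - algebraMap K _ b := by
  rw [algebraMap_YClass, aeval_C]

theorem mem_rrSpace_iff {D : W.Point →₀ ℤ} {f : W.FunctionField} :
    f ∈ rrSpace D ↔ ∀ v : Place K W.FunctionField, v.val f ≤ exp (divisorCoeff D v) := by
  refine forall_congr' fun v => ?_
  rw [v.ordGE_iff, neg_neg]

variable [W.IsElliptic]

/-- The normalized valuation of the function field at a rational point. -/
def pointVal : W.Point → Valuation W.FunctionField ℤᵐ⁰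
  | .zero => inftyValuation W
  | .some _ _ h => (heightOneOfPoint h).valuation W.FunctionField

theorem exists_place (P : W.Point) : ∃ v : Place K W.FunctionField, v.val = pointVal P := by
  cases P with
  | zero => exact exists_place_infty W
  | some a b h => exact exists_place_of_heightOneSpectrum _

theorem pointVal_zero_xFun : 1 < pointVal (0 : W.Point) W.xFun := by
  rw [show pointVal (0 : W.Point) = inftyValuation W from rfl, inftyValuation_xFun, ← exp_zero,
    exp_lt_exp]
  norm_num

theorem pointVal_some_algebraMap {a b : K} (h : W.Nonsingular a b) (g : W.CoordinateRing) :
    pointVal (.some a b h) (algebraMap _ _ g) ≤ 1 :=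
  (heightOneOfPoint h).valuation_le_one g

theorem pointVal_some_lt_one_iff {a b : K} (h : W.Nonsingular a b) (g : W.CoordinateRing) :
    pointVal (.some a b h) (algebraMap _ _ g) < 1 ↔ g ∈ CoordinateRing.XYIdeal W a (C b) :=
  (heightOneOfPoint h).valuation_lt_one_iff_mem g

/-- `IsPlaceOf` speaks only of the coordinates. For an affine point the prime below `v` contains the
maximal ideal of the point, hence equals it; at infinity there is only one place. This makes a
rational point interchangeable with its valuation. -/
theorem isPlaceOf_iff (v : Place K W.FunctionField) (P : W.Point) :
    IsPlaceOf v P ↔ v.val = pointVal P := by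
  cases P with
  | zero =>
    refine ⟨val_eq_inftyValuation v, fun h => ?_⟩
    change W.xFun ∉ v.ring
    rw [← v.val_le_one_iff, h, not_le]
    exact pointVal_zero_xFun
  | some a b h =>
    change v.Vanishes _ ∧ v.Vanishes _ ↔ _
    rw [v.vanishes_iff, v.vanishes_iff, ← algebraMap_XClass, ← algebraMap_YClass_C]
    constructor
    · rintro ⟨h1, h2⟩
      have hx : W.xFun ∈ v.ring := by
        have := add_mem (v.val_le_one_iff.1 h1.le) (v.algebraMap_mem a)
        rwa [algebraMap_XClass, sub_add_cancel] at this
      obtain ⟨w, hw⟩ := exists_val_eq_valuation v hx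
      rw [hw, HeightOneSpectrum.valuation_lt_one_iff_mem] at h1 h2
      rw [hw, pointVal]
      congr 1
      ext1
      refine ((isMaximal_XYIdeal h).eq_of_le w.isPrime.ne_top (Ideal.span_le.2 ?_)).symm
      rintro g (rfl | rfl)
      · exact h1
      · exact h2
    · intro hv
      rw [hv, pointVal_some_lt_one_iff, pointVal_some_lt_one_iff]
      exact ⟨XClass_mem_XYIdeal _ _, YClass_mem_XYIdeal _ _⟩

/-- The coordinates of an affine point are recovered as the values of x and y, and the point at
infinity is recognized by the pole of x. -/
theorem pointVal_injective : Function.Injective (pointVal (W := W)) := by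
  intro P Q hPQ
  obtain ⟨v, hv⟩ := exists_place P
  have h1 := (isPlaceOf_iff v P).2 hv
  have h2 := (isPlaceOf_iff v Q).2 (hv.trans hPQ)
  have hx : ∀ {a b : K} {h : W.Nonsingular a b}, IsPlaceOf v (.some a b h) → W.xFun ∈ v.ring := by
    intro a b h hv
    have := add_mem (v.val_le_one_iff.1 (v.vanishes_iff.1 hv.1).le) (v.algebraMap_mem a)
    rwa [sub_add_cancel] at this
  have hc : ∀ {f : W.FunctionField} {a a' : K}, v.Vanishes (f - algebraMap K _ a) →
      v.Vanishes (f - algebraMap K _ a') → a = a' := by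
    intro f a a' ha ha'
    rw [v.vanishes_iff] at ha ha'
    by_contra hne
    have := Valuation.map_sub_lt _ ha' ha
    rw [sub_sub_sub_cancel_left, ← map_sub, v.val_algebraMap (sub_ne_zero.2 hne)] at this
    exact lt_irrefl _ this
  rcases P with _ | ⟨a, b, h⟩ <;> rcases Q with _ | ⟨a', b', h'⟩
  · rfl
  · exact (h1 (hx h2)).elim
  · exact (h2 (hx h1)).elim
  · obtain rfl := hc h1.1 h2.1
    obtain rfl := hc h1.2 h2.2
    rfl

theorem pointVal_algebraMap (P : W.Point) {c : K} (hc : c ≠ 0) :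
    pointVal P (algebraMap K _ c) = 1 := by
  obtain ⟨v, hv⟩ := exists_place P
  rw [← hv, v.val_algebraMap hc]

theorem pointVal_algebraMap_le (P : W.Point) (c : K) : pointVal P (algebraMap K _ c) ≤ 1 := by
  obtain ⟨v, hv⟩ := exists_place P
  rw [← hv]
  exact v.val_algebraMap_le c

/-- The residue field at a rational point is the base field. -/
theorem exists_pointVal_sub_lt (P : W.Point) {f : W.FunctionField} (hf : pointVal P f ≤ 1) :
    ∃ c : K, pointVal P (f - algebraMap K _ c) < 1 := by
  cases P with
  | zero => exact exists_inftyValuation_sub_lt hf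
  | some a b h =>
    obtain ⟨g, hg⟩ := (heightOneOfPoint h).exists_valuation_sub_lt_of_integer hf 1
    obtain ⟨c, hc⟩ := exists_sub_algebraMap_mem h g
    refine ⟨c, ?_⟩
    have h1 := (pointVal_some_lt_one_iff h _).2 hc
    rw [map_sub, ← IsScalarTower.algebraMap_apply] at h1
    have h2 : pointVal (.some a b h) (algebraMap _ _ g - f) < 1 := hg
    have := Valuation.map_sub_lt _ h1 h2
    rwa [sub_sub_sub_cancel_left] at this

theorem eq_of_pointVal_sub_lt {P : W.Point} {f : W.FunctionField} {c d : K}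
    (hc : pointVal P (f - algebraMap K _ c) < 1) (hd : pointVal P (f - algebraMap K _ d) < 1) :
    c = d := by
  by_contra hne
  have := Valuation.map_sub_lt _ hd hc
  rw [sub_sub_sub_cancel_left, ← map_sub, pointVal_algebraMap P (sub_ne_zero.2 hne)] at this
  exact lt_irrefl _ this

theorem hasValue_iff {P : W.Point} {f : W.FunctionField} {c : K} :
    HasValue P f c ↔ pointVal P (f - algebraMap K _ c) < 1 := by
  constructor
  · intro h
    obtain ⟨v, hv⟩ := exists_place P
    rw [← hv, ← v.vanishes_iff]
    exact h v ((isPlaceOf_iff v P).2 hv)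
  · intro h v hv
    rw [v.vanishes_iff, (isPlaceOf_iff v P).1 hv]
    exact h

/-- A place belongs to at most one rational point, so the sum that defines the coefficient has at
most one nonzero term. -/
theorem divisorCoeff_of_val_eq {v : Place K W.FunctionField} {P : W.Point}
    (hv : v.val = pointVal P) (D : W.Point →₀ ℤ) : divisorCoeff D v = D P := by
  classical
  have : ∀ Q, IsPlaceOf v Q ↔ P = Q := fun Q => by
    rw [isPlaceOf_iff, hv]
    exact pointVal_injective.eq_iff
  simp only [divisorCoeff, this]
  rw [Finsupp.sum, Finset.sum_ite_eq]
  split_ifs with h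
  · rfl
  · exact (Finsupp.notMem_support_iff.1 h).symm

/-- Closed points of higher degree are also places; divisors with rational support do not see them.
-/
theorem divisorCoeff_of_forall_ne {v : Place K W.FunctionField}
    (hv : ∀ P, v.val ≠ pointVal P) (D : W.Point →₀ ℤ) : divisorCoeff D v = 0 := by
  have : ∀ Q, ¬ IsPlaceOf v Q := fun Q => by rw [isPlaceOf_iff]; exact hv Q
  simp [divisorCoeff, this]

theorem divisorCoeff_add (D D' : W.Point →₀ ℤ) (v : Place K W.FunctionField) :
    divisorCoeff (D + D') v = divisorCoeff D v + divisorCoeff D' v := by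
  by_cases h : ∃ P, v.val = pointVal P
  · obtain ⟨P, hP⟩ := h
    simp [divisorCoeff_of_val_eq hP]
  · push Not at h
    simp [divisorCoeff_of_forall_ne h]

theorem divisorCoeff_neg (D : W.Point →₀ ℤ) (v : Place K W.FunctionField) :
    divisorCoeff (-D) v = -divisorCoeff D v := by
  by_cases h : ∃ P, v.val = pointVal P
  · obtain ⟨P, hP⟩ := h
    simp [divisorCoeff_of_val_eq hP]
  · push Not at h
    simp [divisorCoeff_of_forall_ne h]

theorem divisorCoeff_mono {D D' : W.Point →₀ ℤ} (h : D ≤ D') (v : Place K W.FunctionField) :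
    divisorCoeff D v ≤ divisorCoeff D' v := by
  by_cases hv : ∃ P, v.val = pointVal P
  · obtain ⟨P, hP⟩ := hv
    rw [divisorCoeff_of_val_eq hP, divisorCoeff_of_val_eq hP]
    exact h P
  · push Not at hv
    simp [divisorCoeff_of_forall_ne hv]

theorem rrSpace_mono {D D' : W.Point →₀ ℤ} (h : D ≤ D') :
    (rrSpace D : Submodule K W.FunctionField) ≤ rrSpace D' := fun f hf => by
  rw [mem_rrSpace_iff] at hf ⊢
  exact fun v => (hf v).trans (exp_le_exp.2 (divisorCoeff_mono h v))

theorem pointVal_le_of_mem_rrSpace {D : W.Point →₀ ℤ} {f : W.FunctionField} (hf : f ∈ rrSpace D)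
    (P : W.Point) : pointVal P f ≤ exp (D P) := by
  obtain ⟨v, hv⟩ := exists_place P
  rw [← hv, ← divisorCoeff_of_val_eq hv D]
  exact mem_rrSpace_iff.1 hf v

/-- A function that is regular at all affine closed points lies in the coordinate ring. -/
theorem mem_range_of_forall_le_one {f : W.FunctionField}
    (h : ∀ v : Place K W.FunctionField, W.xFun ∈ v.ring → v.val f ≤ 1) :
    ∃ g : W.CoordinateRing, algebraMap _ _ g = f := by
  refine HeightOneSpectrum.mem_integers_of_valuation_le_one W.FunctionField f fun w => ?_
  obtain ⟨v, hv⟩ := exists_place_of_heightOneSpectrum w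
  rw [← hv]
  refine h v ?_
  rw [← v.val_le_one_iff, hv]
  exact w.valuation_le_one _

/-- A function without poles except possibly a simple one at infinity is constant. -/
theorem eq_algebraMap_of_le_one {f : W.FunctionField}
    (h : ∀ v : Place K W.FunctionField, W.xFun ∈ v.ring → v.val f ≤ 1)
    (hinf : pointVal 0 f ≤ exp (1 : ℤ)) : ∃ c : K, f = algebraMap K _ c := by
  obtain ⟨g, rfl⟩ := mem_range_of_forall_le_one h
  have h1 : inftyValuation W (algebraMap _ _ g) ≤ exp ((1 : ℕ) : ℤ) := hinf
  rw [inftyValuation_algebraMap, CoordinateRing.degreeValuation_le_iff] at h1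
  obtain ⟨p, q, rfl⟩ := CoordinateRing.exists_smul_basis_eq g
  rw [CoordinateRing.degree_norm_le_iff] at h1
  -- The possible pole orders at infinity are 2 deg p and 2 deg q + 3; a bound by 1 leaves only the
  -- constants.
  have hq : q = 0 := by ext m; exact h1.2 m (by omega)
  have hp : p = C (p.coeff 0) := by
    ext m
    rcases m with _ | m
    · simp
    · rw [h1.1 _ (by omega), coeff_C_succ]
  refine ⟨p.coeff 0, ?_⟩
  rw [smul_basis_eq_fun, hq, map_zero, zero_mul, add_zero, hp, aeval_C, coeff_C_zero]

end WeierstrassCurve.Affine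
end

noncomputable section

open WithZero IsDedekindDomain Polynomial Polynomial.Bivariate

/-! ### Divisors of functions -/

namespace WeierstrassCurve.Affine
variable {K : Type*} [Field K] {W : WeierstrassCurve.Affine K}

theorem ne_zero_XYIdeal (a : K) (p : K[X]) : CoordinateRing.XYIdeal W a p ≠ 0 := by
  intro hbot
  have := XClass_mem_XYIdeal (W := W) a p
  rw [hbot] at this
  exact CoordinateRing.XClass_ne_zero a this

/-- The divisor of `f` is `G`. -/
def HasDivisor (f : W.FunctionField) (G : W.Point →₀ ℤ) : Prop :=
  ∀ v : Place K W.FunctionField, v.val f = exp (-divisorCoeff G v)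

theorem hasDivisor_one : HasDivisor (1 : W.FunctionField) 0 := fun v => by
  simp [divisorCoeff]

variable [W.IsElliptic]

theorem HasDivisor.mul {f g : W.FunctionField} {G H : W.Point →₀ ℤ} (hf : HasDivisor f G)
    (hg : HasDivisor g H) : HasDivisor (f * g) (G + H) := fun v => by
  rw [map_mul, hf v, hg v, ← exp_add, divisorCoeff_add, neg_add]

theorem HasDivisor.inv {f : W.FunctionField} {G : W.Point →₀ ℤ} (hf : HasDivisor f G) :
    HasDivisor f⁻¹ (-G) := fun v => by
  rw [map_inv₀, hf v, ← exp_neg, divisorCoeff_neg]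

theorem HasDivisor.pointVal_eq {f : W.FunctionField} {G : W.Point →₀ ℤ} (hf : HasDivisor f G)
    (P : W.Point) : pointVal P f = exp (-G P) := by
  obtain ⟨v, hv⟩ := exists_place P
  rw [← hv, hf v, divisorCoeff_of_val_eq hv]

theorem HasDivisor.ne_zero {f : W.FunctionField} {G : W.Point →₀ ℤ} (hf : HasDivisor f G) :
    f ≠ 0 := by
  rintro rfl
  have := hf.pointVal_eq 0
  rw [map_zero] at this
  exact exp_ne_zero this.symm

theorem HasDivisor.mem_rrSpace {f : W.FunctionField} {G D : W.Point →₀ ℤ} (hf : HasDivisor f G)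
    (h : -D ≤ G) : f ∈ rrSpace D := by
  rw [mem_rrSpace_iff]
  intro v
  rw [hf v, exp_le_exp, ← divisorCoeff_neg]
  exact divisorCoeff_mono (by simpa using neg_le_neg h) v

section Affine

variable (w : HeightOneSpectrum W.CoordinateRing)

theorem valuation_algebraMap_eq_count {g : W.CoordinateRing} (hg : g ≠ 0) :
    w.valuation W.FunctionField (algebraMap _ _ g) =
      exp (-FractionalIdeal.count W.FunctionField w
        (Ideal.span {g} : FractionalIdeal (nonZeroDivisors W.CoordinateRing) W.FunctionField)) := by
  rw [HeightOneSpectrum.valuation_of_algebraMap, HeightOneSpectrum.intValuation_if_neg _ hg,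
    FractionalIdeal.count_coe _ _ (by simpa using hg)]

-- A maximal ideal has multiplicity one at itself and zero elsewhere. This lets factorizations of
-- ideals be read as divisors at affine places.
open Classical in
theorem count_XYIdeal {a b : K} (h : W.Nonsingular a b) {v : Place K W.FunctionField}
    (hv : v.val = w.valuation W.FunctionField) :
    FractionalIdeal.count W.FunctionField w (CoordinateRing.XYIdeal W a (C b) :
      FractionalIdeal (nonZeroDivisors W.CoordinateRing) W.FunctionField) =
    divisorCoeff (Finsupp.single (.some a b h) 1) v := by
  refine (FractionalIdeal.count_maximal W.FunctionField w (heightOneOfPoint h)).trans ?_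
  split_ifs with hw
  · have : v.val = pointVal (.some a b h) := by rw [hv, ← hw]; rfl
    rw [divisorCoeff_of_val_eq this, Finsupp.single_eq_same]
  · by_cases hP : ∃ P, v.val = pointVal P
    · obtain ⟨P, hP⟩ := hP
      rw [divisorCoeff_of_val_eq hP, Finsupp.single_eq_of_ne]
      rintro rfl
      refine hw (HeightOneSpectrum.ext (Ideal.ext fun g => ?_))
      rw [← HeightOneSpectrum.valuation_lt_one_iff_mem (K := W.FunctionField),
        ← HeightOneSpectrum.valuation_lt_one_iff_mem (K := W.FunctionField), ← hv, hP]
      rfl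
    · push Not at hP
      rw [divisorCoeff_of_forall_ne hP]

end Affine

theorem divisorCoeff_zero_of_affine {v : Place K W.FunctionField} (hx : W.xFun ∈ v.ring) (n : ℤ) :
    divisorCoeff (Finsupp.single 0 n) v = 0 := by
  have h0 : v.val ≠ pointVal 0 := fun h => by
    have := v.val_le_one_iff.2 hx
    rw [h] at this
    exact absurd this (not_le.2 pointVal_zero_xFun)
  by_cases hP : ∃ P, v.val = pointVal P
  · obtain ⟨P, hP⟩ := hP
    rw [divisorCoeff_of_val_eq hP, Finsupp.single_eq_of_ne]
    rintro rfl
    exact h0 hP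
  · push Not at hP
    rw [divisorCoeff_of_forall_ne hP]

theorem inftyValuation_XClass (a : K) :
    inftyValuation W (algebraMap _ _ (CoordinateRing.XClass W a)) = exp (2 : ℤ) := by
  rw [algebraMap_XClass, Valuation.map_sub_eq_of_lt_left, inftyValuation_xFun]
  refine (pointVal_algebraMap_le (W := W) 0 a).trans_lt ?_
  rw [inftyValuation_xFun, ← exp_zero, exp_lt_exp]
  norm_num

theorem inftyValuation_YClass (a b l : K) :
    inftyValuation W (algebraMap _ _ (CoordinateRing.YClass W (linePolynomial a b l))) =
      exp (3 : ℤ) := by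
  rw [algebraMap_YClass, Valuation.map_sub_eq_of_lt_left, inftyValuation_yFun]
  have hlt : exp (2 : ℤ) < (exp (3 : ℤ) : ℤᵐ⁰) := exp_lt_exp.2 (by norm_num)
  refine lt_of_le_of_lt ?_ (hlt.trans_eq inftyValuation_yFun.symm)
  have h1 : ∀ c : K, inftyValuation W (algebraMap K _ c) ≤ 1 := pointVal_algebraMap_le (W := W) 0
  have h2 : (1 : ℤᵐ⁰) ≤ exp (2 : ℤ) := by rw [← exp_zero, exp_le_exp]; norm_num
  have h3 : inftyValuation W W.xFun ≤ exp (2 : ℤ) := inftyValuation_xFun.le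
  simp only [linePolynomial, map_add, map_mul, map_sub, aeval_C, aeval_X]
  refine Valuation.map_add_le _ ?_ ((h1 b).trans h2)
  rw [map_mul]
  exact (mul_le_of_le_one_left' (h1 l)).trans (Valuation.map_sub_le _ h3 ((h1 a).trans h2))

/-- The ideal of a vertical line is the product of the ideals of P and -P, and x has a double pole
at infinity. -/
theorem hasDivisor_XClass {a b : K} (h : W.Nonsingular a b) :
    HasDivisor (algebraMap _ _ (CoordinateRing.XClass W a))
      (Finsupp.single (.some a b h) 1 + Finsupp.single (-.some a b h) 1 -
        Finsupp.single (0 : W.Point) 2) := by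
  intro v
  by_cases hx : W.xFun ∈ v.ring
  · obtain ⟨w, hv⟩ := exists_val_eq_valuation v hx
    rw [sub_eq_add_neg, ← Finsupp.single_neg, divisorCoeff_add, divisorCoeff_zero_of_affine hx,
      divisorCoeff_add, Point.neg_some, ← count_XYIdeal w _ hv, ← count_XYIdeal w _ hv, hv,
      valuation_algebraMap_eq_count w (CoordinateRing.XClass_ne_zero a), add_zero, add_comm,
      ← FractionalIdeal.count_mul, ← FractionalIdeal.coeIdeal_mul,
      CoordinateRing.XYIdeal_neg_mul h, CoordinateRing.XIdeal] <;>
    exact FractionalIdeal.coeIdeal_ne_zero.2 (ne_zero_XYIdeal _ _)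
  · have hv := val_eq_inftyValuation v hx
    rw [divisorCoeff_of_val_eq (P := 0) hv, hv, inftyValuation_XClass]
    simp [Point.neg_some, Point.zero_def]

variable [DecidableEq K]

/-- The chord and tangent construction as a statement on divisors. -/
theorem exists_hasDivisor_add (P Q : W.Point) : ∃ f, HasDivisor f
    (Finsupp.single P 1 + Finsupp.single Q 1 - Finsupp.single (P + Q) 1 -
      Finsupp.single (0 : W.Point) 1) := by
  by_cases hP : P = 0
  · refine ⟨1, ?_⟩
    rw [hP, zero_add Q, add_sub_cancel_right, sub_self]
    exact hasDivisor_one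
  by_cases hQ : Q = 0
  · refine ⟨1, ?_⟩
    rw [hQ, add_zero P, add_sub_cancel_left, sub_self]
    exact hasDivisor_one
  rcases P with _ | ⟨x₁, y₁, h₁⟩
  · exact (hP rfl).elim
  rcases Q with _ | ⟨x₂, y₂, h₂⟩
  · exact (hQ rfl).elim
  -- For opposite points the function is a vertical line. Otherwise it is the line through both
  -- points (the tangent if they coincide) divided by the vertical line through their sum.
  by_cases hxy : x₁ = x₂ ∧ y₁ = W.negY x₂ y₂
  · refine ⟨algebraMap _ _ (CoordinateRing.XClass W x₂), ?_⟩
    have e : Point.some x₁ y₁ h₁ = -Point.some x₂ y₂ h₂ := by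
      rw [Point.neg_some]
      simp [hxy]
    have e2 : Finsupp.single (0 : W.Point) (2 : ℤ) =
        Finsupp.single 0 1 + Finsupp.single 0 1 := by
      rw [← Finsupp.single_add]; rfl
    have h := hasDivisor_XClass h₂
    rw [e2, ← sub_sub, add_comm (Finsupp.single (Point.some x₂ y₂ h₂) (1 : ℤ))] at h
    rw [e, neg_add_cancel]
    exact h
  · rw [Point.add_some hxy]
    set x₃ := W.addX x₁ x₂ (W.slope x₁ x₂ y₁ y₂) with hx₃
    refine ⟨algebraMap _ _ (CoordinateRing.YClass W
      (linePolynomial x₁ y₁ (W.slope x₁ x₂ y₁ y₂))) /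
      algebraMap _ _ (CoordinateRing.XClass W x₃), fun v => ?_⟩
    rw [sub_eq_add_neg, sub_eq_add_neg, divisorCoeff_add, divisorCoeff_add, divisorCoeff_add,
      divisorCoeff_neg, divisorCoeff_neg, map_div₀]
    by_cases hx : W.xFun ∈ v.ring
    · obtain ⟨w, hv⟩ := exists_val_eq_valuation v hx
      -- The group law as an identity of ideals; its multiplicities at `w` are the affine part of
      -- the divisor.
      have hI := CoordinateRing.XYIdeal_mul_XYIdeal h₁.1 h₂.1 hxy
      have hne : ∀ {I : Ideal W.CoordinateRing}, I ≠ 0 → (I : FractionalIdeal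
        (nonZeroDivisors W.CoordinateRing) W.FunctionField) ≠ 0 :=
          fun h => FractionalIdeal.coeIdeal_ne_zero.2 h
      have hX : CoordinateRing.XIdeal W x₃ ≠ 0 := by
        simpa [CoordinateRing.XIdeal] using CoordinateRing.XClass_ne_zero x₃
      have hY : CoordinateRing.YIdeal W (linePolynomial x₁ y₁ (W.slope x₁ x₂ y₁ y₂)) ≠ 0 := by
        simpa [CoordinateRing.YIdeal] using CoordinateRing.YClass_ne_zero
          (linePolynomial x₁ y₁ (W.slope x₁ x₂ y₁ y₂))
      have hc := congrArg (fun I : Ideal W.CoordinateRing => FractionalIdeal.count W.FunctionField w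
        (I : FractionalIdeal (nonZeroDivisors W.CoordinateRing) W.FunctionField)) hI
      simp only [FractionalIdeal.coeIdeal_mul] at hc
      rw [FractionalIdeal.count_mul _ _ (hne hX)
          (mul_ne_zero (hne (ne_zero_XYIdeal _ _)) (hne (ne_zero_XYIdeal _ _))),
        FractionalIdeal.count_mul _ _ (hne (ne_zero_XYIdeal _ _)) (hne (ne_zero_XYIdeal _ _)),
        FractionalIdeal.count_mul _ _ (hne hY) (hne (ne_zero_XYIdeal _ _)),
        count_XYIdeal w h₁ hv, count_XYIdeal w h₂ hv,
        count_XYIdeal w (nonsingular_add h₁ h₂ hxy) hv] at hc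
      rw [divisorCoeff_zero_of_affine hx, hv,
        valuation_algebraMap_eq_count w (CoordinateRing.XClass_ne_zero _),
        valuation_algebraMap_eq_count w (CoordinateRing.YClass_ne_zero _), ← exp_sub, exp_inj]
      rw [CoordinateRing.XIdeal, CoordinateRing.YIdeal] at hc
      linarith
    · have hv := val_eq_inftyValuation v hx
      rw [hv, inftyValuation_XClass, inftyValuation_YClass, ← exp_sub, exp_inj]
      simp only [divisorCoeff_of_val_eq (P := 0) hv]
      simp [Point.zero_def]

/-! ### Divisor classes and the spaces L(G) -/

variable (W) in
/-- The group of divisors of functions. -/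
def principalDivisors : AddSubgroup (W.Point →₀ ℤ) where
  carrier := {G | ∃ f, HasDivisor f G}
  zero_mem' := ⟨1, hasDivisor_one⟩
  add_mem' := fun ⟨f, hf⟩ ⟨g, hg⟩ => ⟨f * g, hf.mul hg⟩
  neg_mem' := fun ⟨f, hf⟩ => ⟨f⁻¹, hf.inv⟩

variable (W) in
/-- The map `P ↦ (P) - (O)` to the divisor class group. -/
def pointClass : W.Point →+ (W.Point →₀ ℤ) ⧸ principalDivisors W where
  toFun P := QuotientAddGroup.mk (Finsupp.single P 1 - Finsupp.single 0 1)
  map_zero' := by rw [sub_self]; rfl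
  map_add' P Q := by
    rw [← QuotientAddGroup.mk_add, eq_comm, QuotientAddGroup.eq]
    refine (principalDivisors W).neg_mem_iff.1 ?_
    obtain ⟨f, hf⟩ := exists_hasDivisor_add P Q
    refine ⟨f, ?_⟩
    convert hf using 1
    abel

/-- The sum of a divisor in the group of points. -/
abbrev divisorSum (G : W.Point →₀ ℤ) : W.Point := Finsupp.linearCombination ℤ id G

/-- Since P ↦ (P) - (O) is additive, the class of a divisor depends only on its sum and its degree.
-/
theorem mk_eq_pointClass (G : W.Point →₀ ℤ) :
    (QuotientAddGroup.mk G : (W.Point →₀ ℤ) ⧸ principalDivisors W) =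
      pointClass W (divisorSum G) +
        (G.degree : ℤ) • (QuotientAddGroup.mk (Finsupp.single 0 1)) := by
  induction G using Finsupp.induction_linear with
  | zero => simp [divisorSum]
  | add G H hG hH =>
    rw [QuotientAddGroup.mk_add, hG, hH, divisorSum, divisorSum, divisorSum, map_add, map_add,
      map_add, add_zsmul]
    abel
  | single P n =>
    rw [divisorSum, Finsupp.linearCombination_single, map_zsmul, Finsupp.degree_single, id,
      ← zsmul_add]
    change _ = n • (QuotientAddGroup.mk (_ - _) + _)
    rw [← QuotientAddGroup.mk_add, sub_add_cancel, ← QuotientAddGroup.mk_zsmul]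
    congr 1
    simp

/-- Divisors of degree `0` and sum `0` are principal. -/
theorem exists_hasDivisor {G : W.Point →₀ ℤ} (hdeg : G.degree = 0) (hsum : divisorSum G = 0) :
    ∃ f, HasDivisor f G := by
  have := mk_eq_pointClass G
  rw [hdeg, hsum, map_zero, zero_zsmul, add_zero] at this
  exact (QuotientAddGroup.eq_zero_iff G).1 this

/-- If the degree k were negative, multiplying by a function with divisor G + (T) - (k+1)(O) would
give an element of L((k+1)(O) - (T)) with k + 1 ≤ 0. It is constant by `eq_algebraMap_of_le_one` and
nonzero, yet it vanishes at T. -/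
theorem degree_nonneg_of_mem_rrSpace {G : W.Point →₀ ℤ} {f : W.FunctionField}
    (hf : f ∈ rrSpace G) (hf0 : f ≠ 0) : 0 ≤ G.degree := by
  by_contra! hneg
  set k := G.degree with hk
  -- `T` makes the sum of the auxiliary divisor zero, and the multiple of (O) makes its degree zero.
  set T := -divisorSum G with hT
  obtain ⟨g, hg⟩ := exists_hasDivisor
    (G := G + Finsupp.single T 1 - Finsupp.single 0 (k + 1))
    (by simp [← hk]) (by simp [hT, divisorSum])
  have hval : ∀ v : Place K W.FunctionField,
      v.val (f * g) ≤ exp (divisorCoeff (Finsupp.single 0 (k + 1) - Finsupp.single T 1) v) := by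
    intro v
    rw [map_mul, hg v]
    refine (mul_le_mul_left (mem_rrSpace_iff.1 hf v) _).trans ?_
    rw [← exp_add, exp_le_exp]
    simp only [sub_eq_add_neg, divisorCoeff_add, divisorCoeff_neg]
    linarith
  have hpoint : ∀ P : W.Point, pointVal P (f * g) ≤
      exp ((Finsupp.single 0 (k + 1) - Finsupp.single T 1 : W.Point →₀ ℤ) P) := by
    intro P
    obtain ⟨v, hv⟩ := exists_place P
    rw [← hv, ← divisorCoeff_of_val_eq hv]
    exact hval v
  obtain ⟨c, hc⟩ := eq_algebraMap_of_le_one (f := f * g) (fun v hx => by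
    refine (hval v).trans ?_
    rw [← exp_zero, exp_le_exp, sub_eq_add_neg, divisorCoeff_add, divisorCoeff_neg,
      divisorCoeff_zero_of_affine hx, zero_add, neg_nonpos]
    have := divisorCoeff_mono (W := W) (D := 0) (D' := Finsupp.single T 1) (by simp) v
    simpa [divisorCoeff] using this) (by
    refine (hpoint 0).trans ?_
    rw [exp_le_exp, Finsupp.sub_apply, Finsupp.single_eq_same]
    have : (0 : ℤ) ≤ (Finsupp.single T 1 : W.Point →₀ ℤ) 0 := by
      have h0 : (0 : W.Point →₀ ℤ) ≤ Finsupp.single T 1 := by simp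
      exact h0 0
    omega)
  have hc0 : c ≠ 0 := by
    rintro rfl
    rw [map_zero] at hc
    exact mul_ne_zero hf0 hg.ne_zero hc
  have h1 := hpoint T
  rw [hc, pointVal_algebraMap T hc0, ← exp_zero, exp_le_exp, Finsupp.sub_apply,
    Finsupp.single_eq_same] at h1
  have h2 : (Finsupp.single 0 (k + 1) : W.Point →₀ ℤ) T ≤ 0 := by
    by_cases h : T = 0
    · rw [h, Finsupp.single_eq_same]; omega
    · rw [Finsupp.single_eq_of_ne h]
  omega

/-- If `deg G ≥ 1` then some function in `L(G + (s))` attains the allowed pole order at `s`. -/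
theorem exists_mem_rrSpace_add (h3 : ∀ P Q : W.Point, ∃ T, T ≠ P ∧ T ≠ Q) {G : W.Point →₀ ℤ}
    (hG : 1 ≤ G.degree) (s : W.Point) :
    ∃ f ∈ rrSpace (G + Finsupp.single s 1), pointVal s f = exp (G s + 1) := by
  obtain ⟨V, hV, -⟩ := h3 s s
  set n := G.degree with hn
  -- The divisor (T) + (A - T) + (n-1)(V) of zeros is effective and has the degree and the sum of G
  -- + (s). It avoids s because V ≠ s, T ≠ s and T ≠ A - s.
  set A := divisorSum (G + Finsupp.single s 1) - (n - 1) • V with hA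
  obtain ⟨T, hTs, hTA⟩ := h3 s (A - s)
  have hU : A - T ≠ s := fun h => hTA (by rw [← h]; abel)
  set Z : W.Point →₀ ℤ := Finsupp.single T 1 + Finsupp.single (A - T) 1 +
    Finsupp.single V (n - 1) with hZ
  have hZ0 : 0 ≤ Z := by
    refine add_nonneg (add_nonneg ?_ ?_) ?_ <;> simp only [Finsupp.single_nonneg]
    · norm_num
    · norm_num
    · omega
  obtain ⟨f, hf⟩ := exists_hasDivisor (G := Z - (G + Finsupp.single s 1))
    (by simp only [hZ, map_sub, map_add, Finsupp.degree_single, ← hn]; ring)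
    (by
      simp only [hZ, hA, divisorSum, map_sub, map_add, Finsupp.linearCombination_single, id]
      module)
  refine ⟨f, hf.mem_rrSpace ?_, ?_⟩
  · rw [neg_add_rev, sub_eq_add_neg, neg_add_rev]
    exact le_add_of_nonneg_left hZ0
  · rw [hf.pointVal_eq, exp_inj]
    simp [hZ, Finsupp.single_eq_of_ne hTs.symm, Finsupp.single_eq_of_ne hU.symm,
      Finsupp.single_eq_of_ne hV.symm]

end WeierstrassCurve.Affine
end

noncomputable section

open WithZero IsDedekindDomain Polynomial Polynomial.Bivariate

/-! ### The invariant derivation -/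

namespace WeierstrassCurve.Affine
variable {K : Type*} [Field K] (W : WeierstrassCurve.Affine K)

/-- The partial derivative of the Weierstrass equation with respect to `y`, as a function. -/
def diffX : W.FunctionField :=
  2 * W.yFun + algebraMap K _ W.a₁ * W.xFun + algebraMap K _ W.a₃

/-- Minus the partial derivative of the Weierstrass equation with respect to `x`, as a function. -/
def diffY : W.FunctionField :=
  3 * W.xFun ^ 2 + 2 * algebraMap K _ W.a₂ * W.xFun + algebraMap K _ W.a₄ -
    algebraMap K _ W.a₁ * W.yFun

-- The vector (F_y, -F_x) is tangent to the curve F = 0, so the point shifted by it satisfies the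
-- equation over the dual numbers. The resulting derivation needs no division by a partial
-- derivative and exists in every characteristic.
open TrivSqZeroExt in
theorem eval₂_tangent :
    W.polynomial.eval₂ (aeval (inl W.xFun + inr W.diffX :
      TrivSqZeroExt W.FunctionField W.FunctionField)).toRingHom (inl W.yFun + inr W.diffY) = 0 := by
  have hsq := yFun_sq (W := W)
  simp only [polynomial, eval₂_add, eval₂_sub, eval₂_mul, eval₂_pow, eval₂_C, eval₂_X,
    AlgHom.toRingHom_eq_coe, RingHom.coe_coe, map_add, map_mul, map_pow, aeval_X, aeval_C]
  have hC : ∀ c : K, algebraMap K (TrivSqZeroExt W.FunctionField W.FunctionField) c =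
    inl (algebraMap K _ c) := fun c => rfl
  simp only [hC]
  ext
  · simp only [fst_add, fst_sub, fst_mul, fst_pow, fst_inl, fst_inr, fst_zero, add_zero]
    linear_combination hsq
  · simp only [snd_add, snd_sub, snd_mul, snd_pow, snd_inl, snd_inr, snd_zero, fst_add, fst_mul,
      fst_pow, fst_inl, fst_inr, add_zero, zero_add, smul_eq_mul, MulOpposite.smul_eq_mul_unop,
      MulOpposite.unop_op, nsmul_eq_mul, diffX, diffY]
    push_cast
    simp
    ring

/-- The ring homomorphism `g ↦ g + ε δ(g)` on the coordinate ring. -/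
def tangentHom : W.CoordinateRing →+* TrivSqZeroExt W.FunctionField W.FunctionField :=
  AdjoinRoot.lift _ _ (eval₂_tangent W)

theorem tangentHom_apply (p q : K[X]) :
    tangentHom W (p • 1 + q • CoordinateRing.mk W Y) =
      aeval (TrivSqZeroExt.inl W.xFun + TrivSqZeroExt.inr W.diffX) p +
      aeval (TrivSqZeroExt.inl W.xFun + TrivSqZeroExt.inr W.diffX) q *
      (TrivSqZeroExt.inl W.yFun + TrivSqZeroExt.inr W.diffY) := by
  rw [map_add, CoordinateRing.smul, CoordinateRing.smul, map_mul, map_mul, map_one, mul_one]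
  have h1 : ∀ p : K[X], tangentHom W (CoordinateRing.mk W (C p)) =
    aeval (TrivSqZeroExt.inl W.xFun + TrivSqZeroExt.inr W.diffX) p := fun p =>
      AdjoinRoot.lift_of (eval₂_tangent W)
  have h2 : tangentHom W (CoordinateRing.mk W Y) =
    TrivSqZeroExt.inl W.yFun + TrivSqZeroExt.inr W.diffY :=
      AdjoinRoot.lift_root (eval₂_tangent W)
  rw [h1, h1, h2]

theorem fst_tangentHom (g : W.CoordinateRing) :
    (tangentHom W g).fst = algebraMap _ _ g := by
  obtain ⟨p, q, rfl⟩ := CoordinateRing.exists_smul_basis_eq g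
  rw [tangentHom_apply, smul_basis_eq_fun]
  have h : ∀ p : K[X], (aeval (TrivSqZeroExt.inl W.xFun + TrivSqZeroExt.inr W.diffX :
      TrivSqZeroExt W.FunctionField W.FunctionField) p).fst = aeval W.xFun p := fun p => by
    have := aeval_algHom_apply (TrivSqZeroExt.fstHom K W.FunctionField W.FunctionField)
      (TrivSqZeroExt.inl W.xFun + TrivSqZeroExt.inr W.diffX) p
    simpa using this.symm
  rw [TrivSqZeroExt.fst_add, TrivSqZeroExt.fst_mul, TrivSqZeroExt.fst_add, TrivSqZeroExt.fst_inl,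
    TrivSqZeroExt.fst_inr, add_zero, h, h]

/-- The extension of `tangentHom` to the function field. -/
def tangentFieldHom : W.FunctionField →+* TrivSqZeroExt W.FunctionField W.FunctionField :=
  IsLocalization.lift (M := nonZeroDivisors W.CoordinateRing) (g := tangentHom W) fun s => by
    rw [TrivSqZeroExt.isUnit_iff_isUnit_fst, fst_tangentHom]
    exact IsLocalization.map_units _ s

theorem tangentFieldHom_algebraMap (g : W.CoordinateRing) :
    tangentFieldHom W (algebraMap _ _ g) = tangentHom W g :=
  IsLocalization.lift_eq _ g

theorem fst_tangentFieldHom (f : W.FunctionField) : (tangentFieldHom W f).fst = f := by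
  have : (TrivSqZeroExt.fstHom K W.FunctionField W.FunctionField).toRingHom.comp
      (tangentFieldHom W) = RingHom.id _ := by
    apply IsLocalization.ringHom_ext (nonZeroDivisors W.CoordinateRing)
    refine RingHom.ext fun g => ?_
    change (tangentFieldHom W (algebraMap _ _ g)).fst = algebraMap _ _ g
    rw [tangentFieldHom_algebraMap, fst_tangentHom]
  exact congrArg (fun φ : W.FunctionField →+* W.FunctionField => φ f) this

theorem tangentFieldHom_algebraMap_field (c : K) :
    tangentFieldHom W (algebraMap K _ c) = TrivSqZeroExt.inl (algebraMap K _ c) := by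
  rw [IsScalarTower.algebraMap_apply K W.CoordinateRing W.FunctionField,
    tangentFieldHom_algebraMap]
  have := tangentHom_apply W (C c) 0
  rw [zero_smul, add_zero, map_zero, zero_mul, add_zero, aeval_C] at this
  rw [← IsScalarTower.algebraMap_apply K W.CoordinateRing W.FunctionField]
  refine Eq.trans (congrArg _ ?_) this
  rw [CoordinateRing.smul, mul_one]
  rfl

/-- The invariant derivation of the function field, with `x ↦ 2 y + a₁ x + a₃`. -/
def invDerivation : Derivation K W.FunctionField W.FunctionField :=
  Derivation.mk'
    { toFun := fun f => (tangentFieldHom W f).snd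
      map_add' := fun f g => by rw [map_add, TrivSqZeroExt.snd_add]
      map_smul' := fun c f => by
        rw [Algebra.smul_def, map_mul, TrivSqZeroExt.snd_mul, tangentFieldHom_algebraMap_field]
        simp [Algebra.smul_def] }
    fun f g => by
      change (tangentFieldHom W (f * g)).snd = _
      rw [map_mul, TrivSqZeroExt.snd_mul, fst_tangentFieldHom, fst_tangentFieldHom]
      simp [mul_comm]

theorem invDerivation_xFun : invDerivation W W.xFun = W.diffX := by
  change (tangentFieldHom W (algebraMap _ _ _)).snd = _
  rw [tangentFieldHom_algebraMap]
  have := tangentHom_apply W X 0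
  rw [zero_smul, add_zero, map_zero, zero_mul, add_zero, aeval_X, CoordinateRing.smul,
    mul_one] at this
  rw [this]
  simp

theorem invDerivation_yFun : invDerivation W W.yFun = W.diffY := by
  change (tangentFieldHom W (algebraMap _ _ _)).snd = _
  rw [tangentFieldHom_algebraMap]
  have := tangentHom_apply W 0 1
  rw [zero_smul, zero_add, map_zero, zero_add, map_one, one_mul, one_smul] at this
  rw [this]
  simp

/-- The partial derivatives of the Weierstrass equation generate the unit ideal. -/
theorem exists_bezout [W.IsElliptic] : ∃ A B : W.CoordinateRing,
    algebraMap _ _ A * W.diffX + algebraMap _ _ B * W.diffY = 1 := by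
  let x : W.CoordinateRing := CoordinateRing.mk W (C X)
  let y : W.CoordinateRing := CoordinateRing.mk W Y
  let u : W.CoordinateRing := 2 * y + algebraMap K _ W.a₁ * x + algebraMap K _ W.a₃
  let t : W.CoordinateRing :=
    3 * x ^ 2 + 2 * algebraMap K _ W.a₂ * x + algebraMap K _ W.a₄ - algebraMap K _ W.a₁ * y
  have hu : algebraMap _ _ u = W.diffX := by
    simp only [u, map_add, map_mul, map_ofNat, ← IsScalarTower.algebraMap_apply]
    rfl
  have ht : algebraMap _ _ t = W.diffY := by
    simp only [t, map_add, map_sub, map_mul, map_pow, map_ofNat, ← IsScalarTower.algebraMap_apply]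
    rfl
  have hsq : y ^ 2 + (algebraMap K _ W.a₁ * x * y + algebraMap K _ W.a₃ * y) -
      (x ^ 3 + algebraMap K _ W.a₂ * x ^ 2 + algebraMap K _ W.a₄ * x + algebraMap K _ W.a₆) = 0 := by
    apply IsFractionRing.injective W.CoordinateRing W.FunctionField
    simp only [map_add, map_sub, map_mul, map_pow, map_zero, ← IsScalarTower.algebraMap_apply]
    change W.yFun ^ 2 + (_ * W.xFun * W.yFun + _ * W.yFun) -
      (W.xFun ^ 3 + _ * W.xFun ^ 2 + _ * W.xFun + _) = 0
    linear_combination yFun_sq (W := W)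
  by_cases htop : Ideal.span {u, t} = (⊤ : Ideal W.CoordinateRing)
  · have := (Ideal.eq_top_iff_one _).1 htop
    obtain ⟨A, B, hAB⟩ := Ideal.mem_span_pair.1 this
    refine ⟨A, B, ?_⟩
    rw [← hu, ← ht, ← map_mul, ← map_mul, ← map_add, hAB, map_one]
  -- In the residue field of a maximal ideal that contains both partial derivatives, the image of
  -- (x, y) would be a singular point.
  · exfalso
    obtain ⟨m, hm, hle⟩ := Ideal.exists_le_maximal _ htop
    let := Ideal.Quotient.field m
    let φ : K →+* W.CoordinateRing ⧸ m := algebraMap K _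
    let V : WeierstrassCurve.Affine (W.CoordinateRing ⧸ m) := W.map φ
    have : V.IsElliptic := inferInstanceAs (WeierstrassCurve.IsElliptic (WeierstrassCurve.map W φ))
    have hφ : ∀ c : K, Ideal.Quotient.mk m (algebraMap K _ c) = φ c := fun c => rfl
    have h1 : Ideal.Quotient.mk m u = 0 :=
      Ideal.Quotient.eq_zero_iff_mem.2 (hle (Ideal.subset_span (Set.mem_insert _ _)))
    have h2 : Ideal.Quotient.mk m t = 0 :=
      Ideal.Quotient.eq_zero_iff_mem.2 (hle (Ideal.subset_span (Set.mem_insert_of_mem _ rfl)))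
    have h3 := congrArg (Ideal.Quotient.mk m) hsq
    simp only [u, t, map_add, map_sub, map_mul, map_pow, map_ofNat, map_zero, hφ] at h1 h2 h3
    have hE : V.Equation (Ideal.Quotient.mk m x) (Ideal.Quotient.mk m y) := by
      rw [equation_iff']
      simp only [V, map_a₁, map_a₂, map_a₃, map_a₄, map_a₆]
      linear_combination h3
    have hN := (nonsingular_iff' _ _).1 (equation_iff_nonsingular.1 hE)
    simp only [V, map_a₁, map_a₂, map_a₃, map_a₄] at hN
    rcases hN.2 with h | h
    · exact h (by linear_combination -h2)
    · exact h (by linear_combination h1)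

end WeierstrassCurve.Affine
end

noncomputable section

open WithZero IsDedekindDomain Polynomial Polynomial.Bivariate

/-! ### The invariant differential -/

/-- For the universal derivation this is the relation F_x dx + F_y dy = 0, with F the Weierstrass
polynomial. -/
theorem Derivation.smul_eq_smul_of_weierstrass {R F M : Type*} [CommRing R] [CommRing F]
    [Algebra R F] [AddCommGroup M] [Module F M] [Module R M] (d : Derivation R F M)
    {x y a₁ a₂ a₃ a₄ a₆ : F} (h₁ : d a₁ = 0) (h₂ : d a₂ = 0) (h₃ : d a₃ = 0) (h₄ : d a₄ = 0)
    (h₆ : d a₆ = 0) (h : y ^ 2 = x ^ 3 + a₂ * x ^ 2 + a₄ * x + a₆ - (a₁ * x + a₃) * y) :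
    (3 * x ^ 2 + 2 * a₂ * x + a₄ - a₁ * y) • d x = (2 * y + a₁ * x + a₃) • d y := by
  have h := congrArg d h
  simp only [pow_succ, pow_zero, one_mul, map_add, map_sub, Derivation.leibniz, h₁, h₂, h₃, h₄,
    h₆, smul_zero, add_zero] at h
  rw [← sub_eq_zero] at h ⊢
  rw [← neg_eq_zero, ← h]
  module

namespace WeierstrassCurve.Affine
variable {K : Type*} [Field K] {W : WeierstrassCurve.Affine K}

theorem exists_eq_div (f : W.FunctionField) : ∃ p q r s : K[X],
    f = (aeval W.xFun p + aeval W.xFun q * W.yFun) / (aeval W.xFun r + aeval W.xFun s * W.yFun) := by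
  obtain ⟨g, h, -, rfl⟩ := IsFractionRing.div_surjective (A := W.CoordinateRing) f
  obtain ⟨p, q, rfl⟩ := CoordinateRing.exists_smul_basis_eq g
  obtain ⟨r, s, rfl⟩ := CoordinateRing.exists_smul_basis_eq h
  exact ⟨p, q, r, s, by rw [smul_basis_eq_fun, smul_basis_eq_fun]⟩

/-- A derivation of the function field is determined by its values at the coordinates. -/
theorem derivation_eq_zero {M : Type*} [AddCommGroup M] [Module K M] [Module W.FunctionField M]
    [IsScalarTower K W.FunctionField M] (d : Derivation K W.FunctionField M)
    (hx : d W.xFun = 0) (hy : d W.yFun = 0) (f : W.FunctionField) : d f = 0 := by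
  have hp : ∀ p : K[X], d (aeval W.xFun p) = 0 := fun p => by
    rw [Derivation.map_aeval, hx, smul_zero]
  have h : ∀ p q : K[X], d (aeval W.xFun p + aeval W.xFun q * W.yFun) = 0 := fun p q => by
    rw [map_add, hp, Derivation.leibniz, hp, hy, smul_zero, smul_zero, add_zero, add_zero]
  obtain ⟨p, q, r, s, rfl⟩ := exists_eq_div f
  rw [Derivation.leibniz_div, h, h, smul_zero, smul_zero, sub_zero, smul_zero]

section InvariantDifferential

variable (W) in
/-- The quotient of a differential by the invariant differential. -/
def diffCoeff : RatDiff K W.FunctionField →ₗ[W.FunctionField] W.FunctionField :=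
  (invDerivation W).liftKaehlerDifferential

theorem diffCoeff_D (f : W.FunctionField) :
    diffCoeff W (KaehlerDifferential.D K _ f) = invDerivation W f :=
  (invDerivation W).liftKaehlerDifferential_comp_D f

theorem diffY_smul_D_xFun : W.diffY • KaehlerDifferential.D K W.FunctionField W.xFun =
    W.diffX • KaehlerDifferential.D K W.FunctionField W.yFun :=
  (KaehlerDifferential.D K W.FunctionField).smul_eq_smul_of_weierstrass
    (Derivation.map_algebraMap _ _) (Derivation.map_algebraMap _ _) (Derivation.map_algebraMap _ _)
    (Derivation.map_algebraMap _ _) (Derivation.map_algebraMap _ _) yFun_sq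

variable [W.IsElliptic]

variable (W) in
/-- The invariant differential `dx / (2 y + a₁ x + a₃)`. -/
def invDifferential : RatDiff K W.FunctionField :=
  algebraMap _ W.FunctionField (exists_bezout W).choose • KaehlerDifferential.D K _ W.xFun +
    algebraMap _ W.FunctionField (exists_bezout W).choose_spec.choose •
      KaehlerDifferential.D K _ W.yFun

theorem diffCoeff_invDifferential : diffCoeff W (invDifferential W) = 1 := by
  rw [invDifferential, map_add, map_smul, map_smul, diffCoeff_D, diffCoeff_D, invDerivation_xFun,
    invDerivation_yFun, smul_eq_mul, smul_eq_mul]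
  exact (exists_bezout W).choose_spec.choose_spec

/-- The difference of the two sides is a derivation in `f`, so only x and y have to be checked;
there the Bezout relation and `diffY_smul_D_xFun` give the claim. Hence the differentials are
spanned by the invariant one. -/
theorem D_eq_smul (f : W.FunctionField) : KaehlerDifferential.D K W.FunctionField f =
    invDerivation W f • invDifferential W := by
  obtain hAB := (exists_bezout W).choose_spec.choose_spec
  set A := algebraMap _ W.FunctionField (exists_bezout W).choose with hA
  set B := algebraMap _ W.FunctionField (exists_bezout W).choose_spec.choose with hB
  have hω : invDifferential W = A • KaehlerDifferential.D K _ W.xFun +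
    B • KaehlerDifferential.D K _ W.yFun := rfl
  have hxy := diffY_smul_D_xFun (W := W)
  let d : Derivation K W.FunctionField (RatDiff K W.FunctionField) := KaehlerDifferential.D K _ -
    (LinearMap.toSpanSingleton W.FunctionField _ (invDifferential W)).compDer (invDerivation W)
  have hd : ∀ f, d f = KaehlerDifferential.D K _ f - invDerivation W f • invDifferential W :=
    fun f => rfl
  rw [← sub_eq_zero, ← hd]
  refine derivation_eq_zero d ?_ ?_ f
  · rw [hd, invDerivation_xFun, hω, smul_add, smul_comm W.diffX B, ← hxy, ← smul_assoc,
      ← smul_assoc, ← add_smul, smul_eq_mul, smul_eq_mul, mul_comm W.diffX, hAB, one_smul,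
      sub_self]
  · rw [hd, invDerivation_yFun, hω, smul_add, smul_comm W.diffY A, hxy, ← smul_assoc,
      ← smul_assoc, ← add_smul, smul_eq_mul, smul_eq_mul, mul_comm W.diffY, hAB, one_smul,
      sub_self]

theorem diffCoeff_smul (ω : RatDiff K W.FunctionField) :
    diffCoeff W ω • invDifferential W = ω := by
  have h : (LinearMap.toSpanSingleton W.FunctionField _ (invDifferential W)).comp (diffCoeff W) =
      LinearMap.id := by
    apply LinearMap.ext_on_range (v := KaehlerDifferential.D K W.FunctionField)
      (KaehlerDifferential.span_range_derivation K W.FunctionField)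
    intro f
    rw [LinearMap.comp_apply, diffCoeff_D, LinearMap.toSpanSingleton_apply, ← D_eq_smul]
    rfl
  exact congrArg (fun φ => φ ω) h

end InvariantDifferential

/-! ### The invariant differential has neither zeros nor poles -/

section Regularity

theorem inftyValuation_algebraMap_le (c : K) : inftyValuation W (algebraMap K _ c) ≤ 1 := by
  obtain ⟨v, hv⟩ := exists_place_infty W
  rw [← hv]
  exact v.val_algebraMap_le c

theorem inftyValuation_aeval_le {p : K[X]} {n : ℤ} (h : ∀ m : ℕ, n < 2 * m → p.coeff m = 0) :
    inftyValuation W (aeval W.xFun p) ≤ exp n := by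
  rw [aeval_eq_sum_range]
  refine Valuation.map_sum_le _ fun m _ => ?_
  by_cases hm : n < 2 * m
  · rw [h m hm, zero_smul, map_zero]
    exact zero_le
  · rw [Algebra.smul_def, map_mul, map_pow, inftyValuation_xFun, ← exp_nsmul]
    refine (mul_le_of_le_one_left' (inftyValuation_algebraMap_le _)).trans (exp_le_exp.2 ?_)
    rw [nsmul_eq_mul]
    omega

theorem inftyValuation_mul_le {f g : W.FunctionField} {m n k : ℤ}
    (hf : inftyValuation W f ≤ exp m) (hg : inftyValuation W g ≤ exp n) (h : m + n ≤ k) :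
    inftyValuation W (f * g) ≤ exp k := by
  rw [map_mul]
  refine (mul_le_mul' hf hg).trans ?_
  rw [← exp_add]
  exact exp_le_exp.2 h

theorem inftyValuation_const_le (c : K) {k : ℤ} (hk : 0 ≤ k) :
    inftyValuation W (algebraMap K _ c) ≤ exp k :=
  (inftyValuation_algebraMap_le c).trans (by rw [← exp_zero, exp_le_exp]; exact hk)

theorem inftyValuation_natCast_le (n : ℕ) [n.AtLeastTwo] {k : ℤ} (hk : 0 ≤ k) :
    inftyValuation W (OfNat.ofNat n : W.FunctionField) ≤ exp k := by
  rw [← map_ofNat (algebraMap K W.FunctionField) n]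
  exact inftyValuation_const_le _ hk

theorem inftyValuation_diffX_le : inftyValuation W W.diffX ≤ exp (3 : ℤ) := by
  refine Valuation.map_add_le _ (Valuation.map_add_le _ ?_ ?_)
    (inftyValuation_const_le _ (by norm_num))
  · exact inftyValuation_mul_le (inftyValuation_natCast_le 2 le_rfl) inftyValuation_yFun.le
      (by norm_num)
  · exact inftyValuation_mul_le (inftyValuation_const_le _ le_rfl) inftyValuation_xFun.le
      (by norm_num)

theorem inftyValuation_xFun_pow (n : ℕ) : inftyValuation W (W.xFun ^ n) = exp (n * 2 : ℤ) := by
  rw [map_pow, inftyValuation_xFun, ← exp_nsmul, nsmul_eq_mul]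

theorem inftyValuation_diffY_le : inftyValuation W W.diffY ≤ exp (4 : ℤ) := by
  refine Valuation.map_sub_le _ (Valuation.map_add_le _ (Valuation.map_add_le _ ?_ ?_)
    (inftyValuation_const_le _ (by norm_num))) ?_
  · exact inftyValuation_mul_le (inftyValuation_natCast_le 3 le_rfl) (inftyValuation_xFun_pow 2).le
      (by norm_num)
  · exact inftyValuation_mul_le (inftyValuation_mul_le (inftyValuation_natCast_le 2 le_rfl)
      (inftyValuation_const_le _ le_rfl) le_rfl) inftyValuation_xFun.le (by norm_num)
  · exact inftyValuation_mul_le (inftyValuation_const_le _ le_rfl) inftyValuation_yFun.le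
      (by norm_num)

theorem invDerivation_basis (p q : K[X]) :
    invDerivation W (aeval W.xFun p + aeval W.xFun q * W.yFun) =
      aeval W.xFun (derivative p) * W.diffX + aeval W.xFun (derivative q) * (W.diffX * W.yFun) +
        aeval W.xFun q * W.diffY := by
  rw [map_add, Derivation.leibniz, Derivation.map_aeval, Derivation.map_aeval, invDerivation_xFun,
    invDerivation_yFun]
  simp only [smul_eq_mul]
  ring

/-- The derivation takes x from pole order 2 to at most 3 and y from 3 to at most 4: it costs at
most one order, term by term. -/
theorem inftyValuation_invDerivation_algebraMap_le (g : W.CoordinateRing) :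
    inftyValuation W (invDerivation W (algebraMap _ _ g)) ≤
      exp (1 : ℤ) * inftyValuation W (algebraMap _ _ g) := by
  by_cases hg : g = 0
  · simp [hg]
  rw [inftyValuation_algebraMap, CoordinateRing.degreeValuation_apply hg]
  set n := (Algebra.norm K[X] g).natDegree with hn
  have hdeg : (Algebra.norm K[X] g).degree ≤ n := degree_le_natDegree
  clear_value n
  obtain ⟨p, q, rfl⟩ := CoordinateRing.exists_smul_basis_eq g
  rw [CoordinateRing.degree_norm_le_iff] at hdeg
  rw [smul_basis_eq_fun, invDerivation_basis, ← exp_add]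
  have hp : inftyValuation W (aeval W.xFun (derivative p)) ≤ exp ((n : ℤ) - 2) :=
    inftyValuation_aeval_le fun m hm => by rw [coeff_derivative, hdeg.1 _ (by omega), zero_mul]
  have hq : inftyValuation W (aeval W.xFun q) ≤ exp ((n : ℤ) - 3) :=
    inftyValuation_aeval_le fun m hm => hdeg.2 _ (by omega)
  have hq' : inftyValuation W (aeval W.xFun (derivative q)) ≤ exp ((n : ℤ) - 5) :=
    inftyValuation_aeval_le fun m hm => by rw [coeff_derivative, hdeg.2 _ (by omega), zero_mul]
  refine Valuation.map_add_le _ (Valuation.map_add_le _ ?_ ?_) ?_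
  · exact inftyValuation_mul_le hp inftyValuation_diffX_le (by omega)
  · exact inftyValuation_mul_le hq' (inftyValuation_mul_le inftyValuation_diffX_le
      inftyValuation_yFun.le le_rfl) (by omega)
  · exact inftyValuation_mul_le hq inftyValuation_diffY_le (by omega)

theorem inftyValuation_invDerivation_le_mul (f : W.FunctionField) :
    inftyValuation W (invDerivation W f) ≤ exp (1 : ℤ) * inftyValuation W f := by
  obtain ⟨g, h, hh, rfl⟩ := IsFractionRing.div_surjective (A := W.CoordinateRing) f
  have hh0 : inftyValuation W (algebraMap _ _ h) ≠ 0 := by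
    rw [Valuation.ne_zero_iff]
    exact (map_ne_zero_iff _ (IsFractionRing.injective _ _)).2 (nonZeroDivisors.ne_zero hh)
  have h1 := inftyValuation_invDerivation_algebraMap_le g
  have h2 := inftyValuation_invDerivation_algebraMap_le h
  rw [Derivation.leibniz_div, smul_eq_mul, smul_eq_mul, smul_eq_mul, map_mul, map_pow, map_inv₀,
    map_div₀]
  set G := inftyValuation W (algebraMap _ _ g)
  set H := inftyValuation W (algebraMap _ _ h)
  have h3 : inftyValuation W (algebraMap _ _ h * invDerivation W (algebraMap _ _ g) -
      algebraMap _ _ g * invDerivation W (algebraMap _ _ h)) ≤ exp (1 : ℤ) * G * H := by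
    refine Valuation.map_sub_le _ ?_ ?_
    · rw [map_mul, mul_comm]
      exact mul_le_mul' h1 le_rfl
    · rw [map_mul, mul_assoc, mul_left_comm]
      exact mul_le_mul' le_rfl h2
  refine (mul_le_mul' (le_refl (H⁻¹ ^ 2)) h3).trans_eq ?_
  field_simp

/-- The general bound loses one order. Subtracting the value at infinity, a constant that the
derivation kills, gains it back. -/
theorem inftyValuation_invDerivation_le {f : W.FunctionField} (hf : inftyValuation W f ≤ 1) :
    inftyValuation W (invDerivation W f) ≤ 1 := by
  obtain ⟨c, hc⟩ := exists_inftyValuation_sub_lt hf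
  have h1 : invDerivation W f = invDerivation W (f - algebraMap K _ c) := by
    rw [map_sub, Derivation.map_algebraMap, sub_zero]
  rw [h1]
  refine (inftyValuation_invDerivation_le_mul _).trans ?_
  have h2 : inftyValuation W (f - algebraMap K _ c) ≤ exp (-1 : ℤ) := by
    by_cases h0 : inftyValuation W (f - algebraMap K _ c) = 0
    · rw [h0]; exact zero_le
    · rw [← exp_log h0, ← exp_zero, exp_lt_exp] at hc
      rw [← exp_log h0, exp_le_exp]
      omega
  refine (mul_le_mul' le_rfl h2).trans_eq ?_
  rw [← exp_add]
  rfl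

theorem invDerivation_algebraMap_mem (v : Place K W.FunctionField) (hx : W.xFun ∈ v.ring)
    (g : W.CoordinateRing) : invDerivation W (algebraMap _ _ g) ∈ v.ring := by
  have hp : ∀ p : K[X], aeval W.xFun p ∈ v.ring := fun p => by
    have := algebraMap_mem_of_xFun_mem v hx (p • 1 + (0 : K[X]) • CoordinateRing.mk W Y)
    rwa [smul_basis_eq_fun, map_zero, zero_mul, add_zero] at this
  have hy : W.yFun ∈ v.ring := algebraMap_mem_of_xFun_mem v hx _
  have hC : ∀ a : K, algebraMap K _ a ∈ v.ring := v.algebraMap_mem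
  have hX : W.diffX ∈ v.ring := add_mem (add_mem (mul_mem (ofNat_mem _ 2) hy)
    (mul_mem (hC _) hx)) (hC _)
  have hY : W.diffY ∈ v.ring := sub_mem (add_mem (add_mem (mul_mem (ofNat_mem _ 3) (pow_mem hx 2))
    (mul_mem (mul_mem (ofNat_mem _ 2) (hC _)) hx)) (hC _)) (mul_mem (hC _) hy)
  obtain ⟨p, q, rfl⟩ := CoordinateRing.exists_smul_basis_eq g
  rw [smul_basis_eq_fun, invDerivation_basis]
  exact add_mem (add_mem (mul_mem (hp _) hX) (mul_mem (hp _) (mul_mem hX hy)))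
    (mul_mem (hp _) hY)

/-- The uniformizer x/y has derivative -1 at infinity, in every characteristic: over the denominator
y^2, three times the Weierstrass equation cancels the terms of pole order 6. -/
theorem inftyValuation_invDerivation_div_add_one :
    inftyValuation W (invDerivation W (W.xFun / W.yFun) + 1) < 1 := by
  have hy0 : W.yFun ≠ 0 := by
    intro h0
    have := inftyValuation_yFun (W := W)
    rw [h0, map_zero] at this
    exact exp_ne_zero this.symm
  have e : invDerivation W (W.xFun / W.yFun) + 1 =
      (algebraMap K _ W.a₂ * W.xFun ^ 2 + algebraMap K _ (2 * W.a₄) * W.xFun +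
        algebraMap K _ (3 * W.a₆) - algebraMap K _ W.a₁ * (W.xFun * W.yFun) -
        algebraMap K _ (2 * W.a₃) * W.yFun) / W.yFun ^ 2 := by
    rw [Derivation.leibniz_div, invDerivation_xFun, invDerivation_yFun, diffX, diffY]
    simp only [smul_eq_mul, map_mul, map_ofNat]
    field_simp
    linear_combination 3 * yFun_sq (W := W)
  rw [e, map_div₀, map_pow, inftyValuation_yFun, ← exp_nsmul, div_lt_one₀ (zero_lt_iff.2 exp_ne_zero)]
  refine lt_of_le_of_lt ?_ (exp_lt_exp.2 (show (5 : ℤ) < 2 • 3 by norm_num))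
  have hC : ∀ c : K, inftyValuation W (algebraMap K _ c) ≤ exp (0 : ℤ) := fun c =>
    inftyValuation_const_le c le_rfl
  have hxx := inftyValuation_xFun (W := W).le
  have hyy := inftyValuation_yFun (W := W).le
  refine Valuation.map_sub_le _ (Valuation.map_sub_le _ (Valuation.map_add_le _
    (Valuation.map_add_le _ ?_ ?_) (inftyValuation_const_le _ (by norm_num))) ?_) ?_
  · exact inftyValuation_mul_le (hC _) (inftyValuation_xFun_pow 2).le (by norm_num)
  · exact inftyValuation_mul_le (hC _) hxx (by norm_num)
  · exact inftyValuation_mul_le (hC _) (inftyValuation_mul_le hxx hyy le_rfl) (by norm_num)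
  · exact inftyValuation_mul_le (hC _) hyy (by norm_num)

variable [W.IsElliptic]

/-- The invariant derivation preserves the local rings of the curve. -/
theorem val_invDerivation_le (v : Place K W.FunctionField) {f : W.FunctionField}
    (hf : v.val f ≤ 1) : v.val (invDerivation W f) ≤ 1 := by
  by_cases hx : W.xFun ∈ v.ring
  · obtain ⟨w, hw⟩ := exists_val_eq_valuation v hx
    rw [hw] at hf
    obtain ⟨n, d, hnd⟩ := w.exists_primeCompl_mul_eq_of_integer f hf
    have hd : v.val (algebraMap _ _ (d : W.CoordinateRing)) = 1 := by
      rw [hw, HeightOneSpectrum.valuation_eq_one_iff_notMem]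
      exact d.2
    have hR : ∀ g : W.CoordinateRing, v.val (algebraMap _ _ g) ≤ 1 := fun g =>
      v.val_le_one_iff.2 (algebraMap_mem_of_xFun_mem v hx g)
    have hδ : ∀ g : W.CoordinateRing, v.val (invDerivation W (algebraMap _ _ g)) ≤ 1 := fun g =>
      v.val_le_one_iff.2 (invDerivation_algebraMap_mem v hx g)
    have hd0 : algebraMap _ W.FunctionField (d : W.CoordinateRing) ≠ 0 := by
      intro h0
      rw [h0, map_zero] at hd
      exact zero_ne_one hd
    rw [eq_div_of_mul_eq hd0 hnd, Derivation.leibniz_div, smul_eq_mul, smul_eq_mul, smul_eq_mul,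
      map_mul, map_pow, map_inv₀, hd, inv_one, one_pow, one_mul]
    refine Valuation.map_sub_le _ ?_ ?_
    · rw [map_mul]
      exact mul_le_one' (hR _) (hδ _)
    · rw [map_mul]
      exact mul_le_one' (hR _) (hδ _)
  · rw [val_eq_inftyValuation v hx] at hf ⊢
    exact inftyValuation_invDerivation_le hf

/-- The invariant differential generates the regular differentials at every place. -/
theorem exists_val_invDerivation_eq_one (v : Place K W.FunctionField) :
    ∃ t, v.val t ≤ 1 ∧ v.val (invDerivation W t) = 1 := by
  by_cases hx : W.xFun ∈ v.ring
  · obtain ⟨A, B, hAB⟩ := exists_bezout W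
    have hR : ∀ g : W.CoordinateRing, v.val (algebraMap _ _ g) ≤ 1 := fun g =>
      v.val_le_one_iff.2 (algebraMap_mem_of_xFun_mem v hx g)
    have hx1 : v.val W.xFun ≤ 1 := v.val_le_one_iff.2 hx
    have hy1 : v.val W.yFun ≤ 1 := hR _
    have h1 := val_invDerivation_le v hx1
    have h2 := val_invDerivation_le v hy1
    by_cases hX : v.val (invDerivation W W.xFun) = 1
    · exact ⟨_, hx1, hX⟩
    by_cases hY : v.val (invDerivation W W.yFun) = 1
    · exact ⟨_, hy1, hY⟩
    exfalso
    rw [invDerivation_xFun] at h1 hX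
    rw [invDerivation_yFun] at h2 hY
    have : v.val (algebraMap _ _ A * W.diffX + algebraMap _ _ B * W.diffY) < 1 := by
      refine Valuation.map_add_lt _ ?_ ?_
      · rw [map_mul]
        exact (mul_le_of_le_one_left' (hR A)).trans_lt (lt_of_le_of_ne h1 hX)
      · rw [map_mul]
        exact (mul_le_of_le_one_left' (hR B)).trans_lt (lt_of_le_of_ne h2 hY)
    rw [hAB, map_one] at this
    exact lt_irrefl _ this
  · rw [val_eq_inftyValuation v hx]
    refine ⟨W.xFun / W.yFun, ?_, ?_⟩
    · rw [inftyValuation_div, ← exp_zero, exp_le_exp]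
      norm_num
    · have h := inftyValuation_invDerivation_div_add_one (W := W)
      have e : invDerivation W (W.xFun / W.yFun) =
        -1 + (invDerivation W (W.xFun / W.yFun) + 1) := by ring
      rw [e, Valuation.map_add_eq_of_lt_left] <;> rw [Valuation.map_neg, map_one]
      exact h

/-- The derivation preserves the local ring, and some regular t has a unit as its derivative. So dt
generates the regular differentials, and the order of a differential is that of its coefficient. -/
theorem mem_diffOrdGE_iff (v : Place K W.FunctionField) {n : ℤ} {ω : RatDiff K W.FunctionField} :
    ω ∈ v.diffOrdGE n ↔ v.val (diffCoeff W ω) ≤ exp (-n) := by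
  constructor
  · intro h
    induction h using Submodule.span_induction with
    | mem ω hω =>
      obtain ⟨f, g, hf, hg, rfl⟩ := hω
      rw [map_smul, diffCoeff_D, smul_eq_mul, map_mul]
      exact (mul_le_of_le_one_right' (val_invDerivation_le v (v.val_le_one_iff.2 hg))).trans
        (v.ordGE_iff.1 hf)
    | zero => rw [map_zero, map_zero]; exact zero_le
    | add ω η _ _ hω hη => rw [map_add]; exact Valuation.map_add_le _ hω hη
    | smul c ω _ hω =>
      have : diffCoeff W (c • ω) = c • diffCoeff W ω :=
        ((diffCoeff W).restrictScalars K).map_smul c ω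
      rw [this]
      exact (v.val_smul_le _ _).trans hω
  · intro h
    obtain ⟨t, ht, hδ⟩ := exists_val_invDerivation_eq_one v
    have hδ0 : invDerivation W t ≠ 0 := fun h0 => by
      rw [h0, map_zero] at hδ
      exact zero_ne_one hδ
    refine Submodule.subset_span ⟨diffCoeff W ω / invDerivation W t, t, ?_,
      v.val_le_one_iff.1 ht, ?_⟩
    · rw [v.ordGE_iff, map_div₀, hδ, div_one]
      exact h
    · rw [D_eq_smul t, smul_smul, div_mul_cancel₀ _ hδ0, diffCoeff_smul]

/-- The canonical divisor is zero, so questions about differentials become questions about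
functions. -/
theorem mem_diffSpace_iff {G : W.Point →₀ ℤ} {ω : RatDiff K W.FunctionField} :
    ω ∈ diffSpace G ↔ diffCoeff W ω ∈ rrSpace G := by
  rw [diffSpace, Submodule.mem_iInf, mem_rrSpace_iff]
  exact forall_congr' fun v => by rw [mem_diffOrdGE_iff, neg_neg]

end Regularity
end WeierstrassCurve.Affine
end

noncomputable section

open WithZero IsDedekindDomain Polynomial Polynomial.Bivariate

/-! ### Residues at simple poles -/

theorem WithZero.le_exp_neg_one {a : ℤᵐ⁰} (h : a < 1) : a ≤ exp (-1 : ℤ) := by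
  by_cases h0 : a = 0
  · rw [h0]; exact zero_le
  · rw [← exp_log h0, ← exp_zero, exp_lt_exp] at h
    rw [← exp_log h0, exp_le_exp]
    omega

theorem WithZero.exp_neg_one_lt_one : (exp (-1 : ℤ) : ℤᵐ⁰) < 1 := by
  rw [← exp_zero, exp_lt_exp]
  norm_num

namespace WeierstrassCurve.Affine
variable {K : Type*} [Field K] {W : WeierstrassCurve.Affine K} [W.IsElliptic] {P : W.Point}

theorem exists_pointVal_eq (P : W.Point) : ∃ t, pointVal P t = exp (-1 : ℤ) := by
  obtain ⟨v, hv⟩ := exists_place P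
  rw [← hv]
  exact v.exists_val_eq

theorem pointVal_invDerivation_le {f : W.FunctionField} (hf : pointVal P f ≤ 1) :
    pointVal P (invDerivation W f) ≤ 1 := by
  obtain ⟨v, hv⟩ := exists_place P
  rw [← hv] at hf ⊢
  exact val_invDerivation_le v hf

theorem ne_zero_of_pointVal_eq_exp {t : W.FunctionField} {n : ℤ} (ht : pointVal P t = exp n) :
    t ≠ 0 := by
  rintro rfl
  rw [map_zero] at ht
  exact exp_ne_zero ht.symm

theorem pointVal_mul_lt {f g : W.FunctionField} (hf : pointVal P f ≤ 1) (hg : pointVal P g < 1) :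
    pointVal P (f * g) < 1 := by
  rw [map_mul]
  exact (mul_le_of_le_one_left' hf).trans_lt hg

theorem pointVal_mul_le {f g : W.FunctionField} (hf : pointVal P f ≤ 1) (hg : pointVal P g ≤ 1) :
    pointVal P (f * g) ≤ 1 := by
  rw [map_mul]
  exact mul_le_one' hf hg

/-- Take a regular g whose derivative δg is a unit and write g - g(P) = u t. Then δg = u δt + t δu,
and the second term vanishes at P, so δt cannot vanish there. -/
theorem pointVal_invDerivation_eq_one {t : W.FunctionField} (ht : pointVal P t = exp (-1 : ℤ)) :
    pointVal P (invDerivation W t) = 1 := by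
  have ht0 := ne_zero_of_pointVal_eq_exp ht
  have ht1 : pointVal P t < 1 := ht ▸ exp_neg_one_lt_one
  obtain ⟨v, hv⟩ := exists_place P
  obtain ⟨g, hg, hδ⟩ := exists_val_invDerivation_eq_one v
  rw [hv] at hg hδ
  obtain ⟨c, hc⟩ := exists_pointVal_sub_lt P hg
  have hu : pointVal P ((g - algebraMap K _ c) / t) ≤ 1 := by
    rw [map_div₀, ht, div_le_one₀ (zero_lt_iff.2 exp_ne_zero)]
    exact le_exp_neg_one hc
  have e : invDerivation W g = (g - algebraMap K _ c) / t * invDerivation W t +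
      invDerivation W ((g - algebraMap K _ c) / t) * t := by
    have h1 : invDerivation W g = invDerivation W ((g - algebraMap K _ c) / t * t) := by
      rw [div_mul_cancel₀ _ ht0, map_sub, Derivation.map_algebraMap, sub_zero]
    rw [h1, Derivation.leibniz, smul_eq_mul, smul_eq_mul]
    ring
  refine le_antisymm (pointVal_invDerivation_le ht1.le) (not_lt.1 fun hlt => ?_)
  have : pointVal P (invDerivation W g) < 1 := by
    rw [e]
    exact Valuation.map_add_lt _ (pointVal_mul_lt hu hlt)
      (pointVal_mul_lt (pointVal_invDerivation_le hu) ht1)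
  exact this.ne hδ

/-- The differential `H ω`, with `ω` the invariant differential, has at most a simple pole at `P`,
with residue `c`. -/
def HasPoleResidue (P : W.Point) (H : W.FunctionField) (c : K) : Prop :=
  ∀ t, pointVal P t = exp (-1 : ℤ) →
    pointVal P (t * H - algebraMap K _ c * invDerivation W t) < 1

/-- For another uniformizer u t the correction term is c t δu, which vanishes at P; so one
uniformizer decides. -/
theorem hasPoleResidue_of_exists {H : W.FunctionField} {c : K} {t : W.FunctionField}
    (ht : pointVal P t = exp (-1 : ℤ))
    (h : pointVal P (t * H - algebraMap K _ c * invDerivation W t) < 1) :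
    HasPoleResidue P H c := by
  intro t' ht'
  have ht0 := ne_zero_of_pointVal_eq_exp ht
  have hu : pointVal P (t' / t) = 1 := by
    rw [map_div₀, ht, ht', div_self exp_ne_zero]
  have e : t' * H - algebraMap K _ c * invDerivation W t' =
      t' / t * (t * H - algebraMap K _ c * invDerivation W t) -
        algebraMap K _ c * invDerivation W (t' / t) * t := by
    have h1 : invDerivation W t' = invDerivation W (t' / t * t) := by
      rw [div_mul_cancel₀ _ ht0]
    rw [h1, Derivation.leibniz, smul_eq_mul, smul_eq_mul]
    field_simp
    ring
  rw [e]
  refine Valuation.map_sub_lt _ (pointVal_mul_lt hu.le h) (pointVal_mul_lt (pointVal_mul_le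
    (pointVal_algebraMap_le P c) (pointVal_invDerivation_le hu.le)) ?_)
  exact ht ▸ exp_neg_one_lt_one

theorem HasPoleResidue.add {H H' : W.FunctionField} {c c' : K} (h : HasPoleResidue P H c)
    (h' : HasPoleResidue P H' c') : HasPoleResidue P (H + H') (c + c') := by
  intro t ht
  have := Valuation.map_add_lt _ (h t ht) (h' t ht)
  convert this using 2
  rw [map_add]
  ring

theorem HasPoleResidue.pointVal_mul_le {H : W.FunctionField} {c : K} (h : HasPoleResidue P H c)
    {t : W.FunctionField} (ht : pointVal P t = exp (-1 : ℤ)) : pointVal P (t * H) ≤ 1 := by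
  have e : t * H = (t * H - algebraMap K _ c * invDerivation W t) +
    algebraMap K _ c * invDerivation W t := by ring
  rw [e]
  exact Valuation.map_add_le _ (h t ht).le (Affine.pointVal_mul_le (pointVal_algebraMap_le P c)
    (pointVal_invDerivation_eq_one ht).le)

theorem HasPoleResidue.mul {H f : W.FunctionField} {c a : K} (h : HasPoleResidue P H c)
    (hf : HasValue P f a) : HasPoleResidue P (f * H) (a * c) := by
  intro t ht
  have e : t * (f * H) - algebraMap K _ (a * c) * invDerivation W t =
      t * H * (f - algebraMap K _ a) +
        algebraMap K _ a * (t * H - algebraMap K _ c * invDerivation W t) := by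
    rw [map_mul]
    ring
  rw [e]
  exact Valuation.map_add_lt _ (pointVal_mul_lt (h.pointVal_mul_le ht) (hasValue_iff.1 hf))
    (pointVal_mul_lt (pointVal_algebraMap_le P a) (h t ht))

theorem hasValue_algebraMap (a : K) : HasValue P (algebraMap K _ a) a := by
  rw [hasValue_iff, sub_self, map_zero]
  exact zero_lt_one

theorem hasPoleResidue_zero_iff {H : W.FunctionField} :
    HasPoleResidue P H 0 ↔ pointVal P H ≤ 1 := by
  constructor
  · intro h
    obtain ⟨t, ht⟩ := exists_pointVal_eq P
    have := le_exp_neg_one (h t ht)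
    rw [map_zero, zero_mul, sub_zero, map_mul, ht] at this
    exact (mul_le_iff_le_one_right (zero_lt_iff.2 exp_ne_zero)).1 this
  · intro h t ht
    rw [map_zero, zero_mul, sub_zero, mul_comm]
    exact pointVal_mul_lt h (ht ▸ exp_neg_one_lt_one)

theorem HasPoleResidue.sum {ι : Type*} {S : Finset ι} {H : ι → W.FunctionField} {c : ι → K}
    (h : ∀ i ∈ S, HasPoleResidue P (H i) (c i)) :
    HasPoleResidue P (∑ i ∈ S, H i) (∑ i ∈ S, c i) := by
  classical
  induction S using Finset.induction_on with
  | empty =>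
    rw [Finset.sum_empty, Finset.sum_empty, hasPoleResidue_zero_iff, map_zero]
    exact zero_le_one
  | insert i S hi ih =>
    rw [Finset.sum_insert hi, Finset.sum_insert hi]
    exact (h i (Finset.mem_insert_self i S)).add
      (ih fun j hj => h j (Finset.mem_insert_of_mem hj))

theorem HasPoleResidue.unique {H : W.FunctionField} {c c' : K} (h : HasPoleResidue P H c)
    (h' : HasPoleResidue P H c') : c = c' := by
  obtain ⟨t, ht⟩ := exists_pointVal_eq P
  by_contra hne
  have := Valuation.map_sub_lt _ (h' t ht) (h t ht)
  rw [sub_sub_sub_cancel_left, ← sub_mul, ← map_sub, map_mul,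
    pointVal_algebraMap P (sub_ne_zero.2 hne), pointVal_invDerivation_eq_one ht, mul_one] at this
  exact lt_irrefl _ this

theorem exists_hasPoleResidue {H : W.FunctionField} (h : pointVal P H ≤ exp (1 : ℤ)) :
    ∃ c, HasPoleResidue P H c := by
  obtain ⟨t, ht⟩ := exists_pointVal_eq P
  have hδ := pointVal_invDerivation_eq_one ht
  have hδ0 : invDerivation W t ≠ 0 := fun h0 => by
    rw [h0, map_zero] at hδ
    exact zero_ne_one hδ
  have h1 : pointVal P (t * H / invDerivation W t) ≤ 1 := by
    rw [map_div₀, hδ, div_one, map_mul, ht]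
    exact (mul_le_mul' le_rfl h).trans_eq (by rw [← exp_add]; rfl)
  obtain ⟨c, hc⟩ := exists_pointVal_sub_lt P h1
  refine ⟨c, hasPoleResidue_of_exists ht ?_⟩
  have e : t * H - algebraMap K _ c * invDerivation W t =
      invDerivation W t * (t * H / invDerivation W t - algebraMap K _ c) := by
    field_simp
  rw [e]
  exact pointVal_mul_lt hδ.le hc

/-- For differentials with at most a simple pole the residue is determined by the leading
coefficient. -/
theorem hasResidue_iff {ω : RatDiff K W.FunctionField} {c : K}
    (h : pointVal P (diffCoeff W ω) ≤ exp (1 : ℤ)) :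
    HasResidue P ω c ↔ HasPoleResidue P (diffCoeff W ω) c := by
  constructor
  · intro hres
    obtain ⟨v, hv⟩ := exists_place P
    obtain ⟨t, ht⟩ := v.exists_isUniformizer
    obtain ⟨p, g, hg, rfl, rfl⟩ := hres v ((isPlaceOf_iff v P).2 hv) t ht
    rw [v.isUniformizer_iff, hv] at ht
    rw [← v.val_le_one_iff, hv] at hg
    have hδ := pointVal_invDerivation_eq_one ht
    have ht0 := ne_zero_of_pointVal_eq_exp ht
    have htinv : pointVal P t⁻¹ = exp (1 : ℤ) := by
      rw [map_inv₀, ht, ← exp_neg, neg_neg]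
    have hlt : (1 : ℤᵐ⁰) < exp (1 : ℤ) := by
      rw [← exp_zero, exp_lt_exp]
      norm_num
    rw [map_smul, diffCoeff_D, smul_eq_mul] at h ⊢
    rw [map_mul, hδ, mul_one] at h
    have h1 : pointVal P (t⁻¹ * aeval t⁻¹ p) ≤ exp (1 : ℤ) := by
      have := Valuation.map_sub_le _ h (hg.trans hlt.le)
      rwa [add_sub_cancel_right] at this
    have h2 : pointVal P (aeval t⁻¹ p) ≤ 1 := by
      rw [map_mul, htinv] at h1
      exact (mul_le_iff_le_one_right (zero_lt_iff.2 exp_ne_zero)).1 h1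
    -- p(t⁻¹) has pole order deg p, so a pole that is at most simple forces p to be constant.
    have h3 : p = C (p.coeff 0) := by
      rcases eq_or_ne p 0 with rfl | hp
      · simp
      · have htriv : (pointVal P).IsTrivialOn K := ⟨fun a ha => pointVal_algebraMap P ha⟩
        rw [valuation_aeval_eq_valuation_X_pow_natDegree_of_one_lt_valuation_X (v := pointVal P)
          t⁻¹ (htinv ▸ hlt) hp, htinv, ← exp_nsmul, ← exp_zero, exp_le_exp,
          nsmul_eq_mul] at h2
        exact eq_C_of_natDegree_eq_zero (by omega)
    refine hasPoleResidue_of_exists ht ?_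
    rw [h3, aeval_C, coeff_C_zero]
    have e : t * ((t⁻¹ * algebraMap K _ (p.coeff 0) + g) * invDerivation W t) -
        algebraMap K _ (p.coeff 0) * invDerivation W t = g * invDerivation W t * t := by
      field_simp
      ring
    rw [e]
    exact pointVal_mul_lt (pointVal_mul_le hg hδ.le) (ht ▸ exp_neg_one_lt_one)
  · intro hres v hvP t ht
    have hv := (isPlaceOf_iff v P).1 hvP
    rw [v.isUniformizer_iff, hv] at ht
    have hδ := pointVal_invDerivation_eq_one ht
    have ht0 := ne_zero_of_pointVal_eq_exp ht
    have hδ0 : invDerivation W t ≠ 0 := fun h0 => by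
      rw [h0, map_zero] at hδ
      exact zero_ne_one hδ
    refine ⟨C c, diffCoeff W ω / invDerivation W t - t⁻¹ * algebraMap K _ c, ?_, ?_, coeff_C_zero⟩
    · rw [← v.val_le_one_iff, hv]
      have e : diffCoeff W ω / invDerivation W t - t⁻¹ * algebraMap K _ c =
          (t * diffCoeff W ω - algebraMap K _ c * invDerivation W t) /
            (t * invDerivation W t) := by
        field_simp
      rw [e, map_div₀, map_mul, hδ, mul_one, ht, div_le_one₀ (zero_lt_iff.2 exp_ne_zero)]
      exact le_exp_neg_one (hres t ht)
    · rw [aeval_C, add_sub_cancel, D_eq_smul t, smul_smul, div_mul_cancel₀ _ hδ0, diffCoeff_smul]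

end WeierstrassCurve.Affine
end

noncomputable section

open WithZero IsDedekindDomain Polynomial Polynomial.Bivariate

/-! ### The residue theorem for simple poles -/

namespace WeierstrassCurve.Affine
variable {K : Type*} [Field K] {W : WeierstrassCurve.Affine K}

/-- A function `h` such that `h ω`, with `ω` the invariant differential, has simple poles at the
given affine point and at the point at infinity, and no other poles. -/
def poleFun : W.Point → W.FunctionField
  | .zero => 0
  | .some a b _ => (W.yFun - algebraMap K _ (W.negY a b)) / (W.xFun - algebraMap K _ a)

/-- The two factors on the left are those of the quadratic in y at x = a, so x - a divides their
product. The identity trades the denominator x - a for y - b. -/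
theorem yFun_sub_mul {a b : K} (h : W.Equation a b) :
    (W.yFun - algebraMap K _ b) * (W.yFun - algebraMap K _ (W.negY a b)) =
      (W.xFun - algebraMap K _ a) * (W.xFun ^ 2 + algebraMap K _ (a + W.a₂) * W.xFun +
        algebraMap K _ (a ^ 2 + W.a₂ * a + W.a₄) - algebraMap K _ W.a₁ * W.yFun) := by
  have h' := congrArg (algebraMap K W.FunctionField) ((W.equation_iff a b).1 h)
  rw [negY]
  simp only [map_add, map_mul, map_pow, map_sub, map_neg] at h' ⊢
  linear_combination yFun_sq (W := W) - h'

theorem xFun_sub_ne_zero (a : K) : W.xFun - algebraMap K _ a ≠ 0 := by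
  rw [← algebraMap_XClass]
  exact (map_ne_zero_iff _ (IsFractionRing.injective _ _)).2 (CoordinateRing.XClass_ne_zero a)

theorem divisorOf_apply [DecidableEq K] (S : Finset W.Point) (P : W.Point) :
    divisorOf S P = if P ∈ S then 1 else 0 := by
  simp [divisorOf, Finsupp.finsetSum_apply, Finsupp.single_apply]

variable [W.IsElliptic]

theorem inftyValuation_xFun_sub (a : K) :
    inftyValuation W (W.xFun - algebraMap K _ a) = exp (2 : ℤ) := by
  rw [← algebraMap_XClass, inftyValuation_XClass]

theorem yFun_ne_zero : W.yFun ≠ 0 :=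
  ne_zero_of_pointVal_eq_exp (P := 0) inftyValuation_yFun

/-- Away from P either x - a or y - b is a unit; in the second case `yFun_sub_mul` rewrites the
function with denominator y - b. -/
theorem poleFun_val_le {v : Place K W.FunctionField} (hx : W.xFun ∈ v.ring) {P : W.Point}
    (hv : v.val ≠ pointVal P) : v.val (poleFun P) ≤ 1 := by
  cases P with
  | zero => rw [poleFun, map_zero]; exact zero_le_one
  | some a b h =>
    have hy : W.yFun ∈ v.ring := algebraMap_mem_of_xFun_mem v hx _
    have hC := v.algebraMap_mem
    rw [Ne, ← isPlaceOf_iff] at hv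
    have hv' : v.val (W.xFun - algebraMap K _ a) = 1 ∨ v.val (W.yFun - algebraMap K _ b) = 1 := by
      by_contra! hne
      refine hv ⟨v.vanishes_iff.2 (lt_of_le_of_ne ?_ hne.1),
        v.vanishes_iff.2 (lt_of_le_of_ne ?_ hne.2)⟩
      · exact v.val_le_one_iff.2 (sub_mem hx (hC a))
      · exact v.val_le_one_iff.2 (sub_mem hy (hC b))
    have hx0 := xFun_sub_ne_zero (W := W) a
    rw [poleFun]
    rcases hv' with h1 | h1
    · rw [map_div₀, h1, div_one]
      exact v.val_le_one_iff.2 (sub_mem hy (hC _))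
    · have hy0 : W.yFun - algebraMap K _ b ≠ 0 := fun h0 => by
        rw [h0, map_zero] at h1
        exact zero_ne_one h1
      have e := yFun_sub_mul h.1
      rw [mul_comm, mul_comm (W.xFun - _), ← div_eq_div_iff hx0 hy0] at e
      rw [e, map_div₀, h1, div_one]
      exact v.val_le_one_iff.2 (sub_mem (add_mem (add_mem (pow_mem hx 2) (mul_mem (hC _) hx))
        (hC _)) (mul_mem (hC _) hy))

theorem hasPoleResidue_poleFun_self {P : W.Point} (hP : P ≠ 0) :
    HasPoleResidue P (poleFun P) 1 := by
  classical
  cases P with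
  | zero => exact absurd rfl hP
  | some a b h =>
    set P : W.Point := .some a b h with hPdef
    have hxv : pointVal P (W.xFun - algebraMap K _ a) =
        exp (-(1 + if b = W.negY a b then 1 else 0) : ℤ) := by
      rw [← algebraMap_XClass, (hasDivisor_XClass h).pointVal_eq P, Point.neg_some]
      congr 2
      have h1 : (Point.some a (W.negY a b) ((nonsingular_neg a b).2 h) = P) ↔ b = W.negY a b := by
        rw [hPdef, Point.some.injEq]
        exact ⟨fun h => h.2.symm, fun h => ⟨rfl, h.symm⟩⟩
      have h2 : (0 : W.Point) ≠ P := fun h => hP h.symm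
      simp only [Finsupp.coe_sub, Finsupp.coe_add, Pi.sub_apply, Pi.add_apply,
        Finsupp.single_apply, h1, if_neg h2, sub_zero]
      rw [if_pos hPdef.symm]
    have hx1 : pointVal P (W.xFun - algebraMap K _ a) < 1 := by
      rw [hxv, ← exp_zero, exp_lt_exp]
      split_ifs <;> norm_num
    have hy1 : pointVal P (W.yFun - algebraMap K _ b) < 1 := by
      rw [← algebraMap_YClass_C]
      exact (pointVal_some_lt_one_iff h _).2 (YClass_mem_XYIdeal a _)
    have hC := pointVal_algebraMap_le P
    have hx : pointVal P W.xFun ≤ 1 := pointVal_some_algebraMap h _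
    have hx0 := xFun_sub_ne_zero (W := W) a
    -- If P = -P, then x - a has a double zero at P and y - b is a uniformizer; otherwise x - a is
    -- one.
    by_cases hb : b = W.negY a b
    · have hq : W.xFun ^ 2 + algebraMap K _ (a + W.a₂) * W.xFun +
          algebraMap K _ (a ^ 2 + W.a₂ * a + W.a₄) - algebraMap K _ W.a₁ * W.yFun =
          algebraMap K _ (3 * a ^ 2 + 2 * W.a₂ * a + W.a₄ - W.a₁ * b) +
          ((W.xFun + algebraMap K _ (2 * a + W.a₂)) * (W.xFun - algebraMap K _ a) -
            algebraMap K _ W.a₁ * (W.yFun - algebraMap K _ b)) := by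
        simp only [map_add, map_mul, map_pow, map_sub, map_ofNat]
        ring
      have e := yFun_sub_mul h.1
      rw [← hb] at e
      set q := W.xFun ^ 2 + algebraMap K _ (a + W.a₂) * W.xFun +
          algebraMap K _ (a ^ 2 + W.a₂ * a + W.a₄) - algebraMap K _ W.a₁ * W.yFun with hqdef
      -- The y-partial vanishes at P, so nonsingularity makes the x-partial nonzero.
      have hns : 3 * a ^ 2 + 2 * W.a₂ * a + W.a₄ - W.a₁ * b ≠ 0 := by
        have := (W.nonsingular_iff a b).1 h
        rcases this.2 with h1 | h1
        · exact fun h0 => h1 (by linear_combination -h0)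
        · exact absurd hb h1
      have hq1 : pointVal P q = 1 := by
        rw [hq, Valuation.map_add_eq_of_lt_left, pointVal_algebraMap P hns]
        rw [pointVal_algebraMap P hns]
        exact Valuation.map_sub_lt _ (pointVal_mul_lt (Valuation.map_add_le _ hx (hC _)) hx1)
          (pointVal_mul_lt (hC _) hy1)
      have ht : pointVal P (W.yFun - algebraMap K _ b) = exp (-1 : ℤ) := by
        have := congrArg (pointVal P) e
        rw [map_mul, map_mul, hq1, mul_one, hxv, if_pos hb] at this
        have h0 : pointVal P (W.yFun - algebraMap K _ b) ≠ 0 := by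
          intro h0
          rw [h0, zero_mul] at this
          exact exp_ne_zero this.symm
        rw [← exp_log h0, ← exp_add, exp_inj] at this
        rw [← exp_log h0]
        congr 1
        omega
      refine hasPoleResidue_of_exists ht ?_
      have e2 : (W.yFun - algebraMap K _ b) * poleFun P - algebraMap K _ 1 *
          invDerivation W (W.yFun - algebraMap K _ b) =
          -((2 * W.xFun + algebraMap K _ (a + W.a₂)) * (W.xFun - algebraMap K _ a)) := by
        rw [hPdef, poleFun, ← hb, ← mul_div_assoc, e, mul_div_cancel_left₀ _ hx0, map_sub,
          Derivation.map_algebraMap, invDerivation_yFun, diffY, hqdef]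
        simp only [map_add, map_mul, map_pow, map_one]
        ring
      rw [e2, Valuation.map_neg]
      refine pointVal_mul_lt (Valuation.map_add_le _ (pointVal_mul_le ?_ hx) (hC _)) hx1
      rw [← map_ofNat (algebraMap K W.FunctionField) 2]
      exact hC _
    · rw [if_neg hb, add_zero] at hxv
      refine hasPoleResidue_of_exists hxv ?_
      have e2 : (W.xFun - algebraMap K _ a) * poleFun P - algebraMap K _ 1 *
          invDerivation W (W.xFun - algebraMap K _ a) =
          -((W.yFun - algebraMap K _ b) + algebraMap K _ W.a₁ * (W.xFun - algebraMap K _ a)) := by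
        rw [hPdef, poleFun, mul_div_cancel₀ _ hx0, map_sub,
          Derivation.map_algebraMap, invDerivation_xFun, diffX, negY]
        simp only [map_mul, map_sub, map_neg, map_one]
        ring
      rw [e2, Valuation.map_neg]
      exact Valuation.map_add_lt _ hy1 (pointVal_mul_lt (hC _) hx1)

theorem hasPoleResidue_poleFun_infty {P : W.Point} (hP : P ≠ 0) :
    HasPoleResidue 0 (poleFun P) (-1) := by
  cases P with
  | zero => exact absurd rfl hP
  | some a b h =>
    refine hasPoleResidue_of_exists (t := W.xFun / W.yFun) inftyValuation_div ?_
    have hy0 := yFun_ne_zero (W := W)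
    have hx0 := xFun_sub_ne_zero (W := W) a
    have e : W.xFun / W.yFun * poleFun (.some a b h) -
        algebraMap K _ (-1) * invDerivation W (W.xFun / W.yFun) =
        (algebraMap K _ a * W.yFun - algebraMap K _ (W.negY a b) * W.xFun) /
          (W.yFun * (W.xFun - algebraMap K _ a)) +
        (invDerivation W (W.xFun / W.yFun) + 1) := by
      rw [poleFun, map_neg, map_one]
      field_simp
      ring
    rw [e]
    refine Valuation.map_add_lt _ ?_ inftyValuation_invDerivation_div_add_one
    change inftyValuation W _ < 1
    rw [map_div₀, map_mul, inftyValuation_yFun, inftyValuation_xFun_sub, ← exp_add,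
      div_lt_one₀ (zero_lt_iff.2 exp_ne_zero)]
    refine lt_of_le_of_lt (Valuation.map_sub_le _ ?_ ?_)
      (exp_lt_exp.2 (show (3 : ℤ) < 3 + 2 by norm_num))
    · exact inftyValuation_mul_le (inftyValuation_const_le _ le_rfl) inftyValuation_yFun.le
        (by norm_num)
    · exact inftyValuation_mul_le (inftyValuation_const_le _ le_rfl) inftyValuation_xFun.le
        (by norm_num)

theorem xFun_mem_of_val_eq {v : Place K W.FunctionField} {P : W.Point} (hP : P ≠ 0)
    (hv : v.val = pointVal P) : W.xFun ∈ v.ring := by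
  cases P with
  | zero => exact absurd rfl hP
  | some a b h =>
    rw [← v.val_le_one_iff, hv]
    exact pointVal_some_algebraMap h _

theorem hasPoleResidue_poleFun_of_ne {P Q : W.Point} (hQ : Q ≠ 0) (hPQ : Q ≠ P) :
    HasPoleResidue Q (poleFun P) 0 := by
  obtain ⟨v, hv⟩ := exists_place Q
  rw [hasPoleResidue_zero_iff, ← hv]
  refine poleFun_val_le (xFun_mem_of_val_eq hQ hv) fun h => hPQ ?_
  exact pointVal_injective (hv.symm.trans h)

theorem HasPoleResidue.algebraMap_mul {P : W.Point} {H : W.FunctionField} {c : K}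
    (h : HasPoleResidue P H c) (a : K) : HasPoleResidue P (algebraMap K _ a * H) (a * c) :=
  h.mul (hasValue_algebraMap a)

/-- The residue theorem for differentials with simple poles at rational points. -/
theorem sum_residues_eq_zero [DecidableEq K] {S : Finset W.Point} {H : W.FunctionField}
    (hH : H ∈ rrSpace (divisorOf S)) {c : W.Point → K} (hc : ∀ s ∈ S, HasPoleResidue s H (c s)) :
    ∑ s ∈ S, c s = 0 := by
  set R := H + ∑ s ∈ S, algebraMap K _ (-c s) * poleFun s with hR
  have hle : ∀ P : W.Point, P ∉ S → pointVal P H ≤ 1 := fun P hP => by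
    have := pointVal_le_of_mem_rrSpace hH P
    rwa [divisorOf_apply, if_neg hP, exp_zero] at this
  have hres0 : HasPoleResidue 0 R ((if 0 ∈ S then c 0 else 0) +
      ∑ s ∈ S, -c s * (if s = 0 then 0 else -1)) := by
    refine HasPoleResidue.add ?_ (HasPoleResidue.sum fun s hs => HasPoleResidue.algebraMap_mul ?_ _)
    · split_ifs with h0
      · exact hc _ h0
      · exact hasPoleResidue_zero_iff.2 (hle _ h0)
    · split_ifs with h0
      · rw [h0, show poleFun (0 : W.Point) = 0 from rfl, hasPoleResidue_zero_iff, map_zero]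
        exact zero_le_one
      · exact hasPoleResidue_poleFun_infty h0
  obtain ⟨a, ha⟩ : ∃ a, R = algebraMap K _ a := by
    refine eq_algebraMap_of_le_one (fun v hx => ?_) ?_
    · by_cases hv : ∃ P ∈ S, v.val = pointVal P
      · obtain ⟨P, hP, hv⟩ := hv
        have hP0 : P ≠ 0 := by
          rintro rfl
          have := v.val_le_one_iff.2 hx
          rw [hv] at this
          exact absurd this (not_le.2 pointVal_zero_xFun)
        have : HasPoleResidue P R (c P + ∑ s ∈ S, -c s * (if s = P then 1 else 0)) := by
          refine (hc P hP).add (HasPoleResidue.sum fun s hs => HasPoleResidue.algebraMap_mul ?_ _)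
          split_ifs with h0
          · rw [h0]
            exact hasPoleResidue_poleFun_self hP0
          · exact hasPoleResidue_poleFun_of_ne hP0 fun h => h0 h.symm
        have h0 : c P + ∑ s ∈ S, -c s * (if s = P then 1 else 0) = 0 := by
          simp [hP]
        rw [h0, hasPoleResidue_zero_iff] at this
        rwa [hv]
      · push Not at hv
        refine Valuation.map_add_le _ ?_ (Valuation.map_sum_le _ fun s hs => ?_)
        · by_cases hP : ∃ P, v.val = pointVal P
          · obtain ⟨P, hP⟩ := hP
            rw [hP]
            exact hle P fun h => hv P h hP
          · push Not at hP
            have := mem_rrSpace_iff.1 hH v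
            rwa [divisorCoeff_of_forall_ne hP, exp_zero] at this
        · rw [map_mul]
          exact mul_le_one' (v.val_algebraMap_le _) (poleFun_val_le hx (hv s hs))
    · obtain ⟨t, ht⟩ := exists_pointVal_eq (0 : W.Point)
      have := hres0.pointVal_mul_le ht
      rw [map_mul, ht, exp_neg] at this
      exact (inv_mul_le_one₀ (zero_lt_iff.2 exp_ne_zero)).1 this
  have h0 : HasPoleResidue 0 R 0 := by
    rw [hasPoleResidue_zero_iff, ha]
    exact pointVal_algebraMap_le _ _
  have h1 := hres0.unique h0
  rw [← h1]
  have h2 : ∀ s, -c s * (if s = 0 then 0 else -1) = c s - (if s = 0 then c s else 0) := by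
    intro s
    split_ifs <;> simp
  simp only [h2, Finset.sum_sub_distrib]
  by_cases h : (0 : W.Point) ∈ S <;> simp [h]

end WeierstrassCurve.Affine
end

noncomputable section

open WithZero IsDedekindDomain Polynomial Polynomial.Bivariate

/-! ### The error correcting pair -/

namespace Code
variable {ι K : Type*} [Field K] [Fintype ι] [DecidableEq K]

theorem minDist_anti {C C' : Submodule K (ι → K)} (h : C ≤ C') : minDist C' ≤ minDist C :=
  le_iInf fun x => iInf_le_of_le ⟨x.1, h x.2.1, x.2.2⟩ le_rfl

theorem le_minDist {C : Submodule K (ι → K)} {n : ℕ}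
    (h : ∀ x ∈ C, x ≠ 0 → n ≤ hammingNorm x) : (n : ℕ∞) ≤ minDist C :=
  le_iInf fun x => Nat.cast_le.2 (h x.1 x.2.1 x.2.2)

/-- A subcode has a larger dual and at least the same minimum distance. This settles the code of the
functions that vanish at the deleted point. -/
theorem IsErrorCorrectingPair.mono {t : ℕ} {A B C C' : Submodule K (ι → K)}
    (h : IsErrorCorrectingPair t A B C) (hC : C' ≤ C) : IsErrorCorrectingPair t A B C' where
  mul_mem_dual a ha b hb v hv := h.mul_mem_dual a ha b hb v (hC hv)
  lt_dim := h.lt_dim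
  length_lt := h.length_lt.trans_le (add_le_add_right (minDist_anti hC) _)
  lt_minDist_dual := h.lt_minDist_dual

end Code

namespace WeierstrassCurve.Affine
variable {K : Type*} [Field K] {W : WeierstrassCurve.Affine K}

theorem degree_divisorOf (S : Finset W.Point) : (divisorOf S).degree = S.card := by
  rw [divisorOf, map_sum]
  simp

theorem HasValue.sub {P : W.Point} {f g : W.FunctionField} {a b : K} (hf : HasValue P f a)
    (hg : HasValue P g b) : HasValue P (f - g) (a - b) := by
  have := hf.add (hg.smul (-1))
  rwa [neg_one_smul, neg_one_mul, ← sub_eq_add_neg, ← sub_eq_add_neg] at this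

variable [W.IsElliptic]

theorem mul_mem_rrSpace {D D' : W.Point →₀ ℤ} {f g : W.FunctionField} (hf : f ∈ rrSpace D)
    (hg : g ∈ rrSpace D') : f * g ∈ rrSpace (D + D') := by
  rw [mem_rrSpace_iff] at hf hg ⊢
  intro v
  rw [map_mul, divisorCoeff_add, exp_add]
  exact mul_le_mul' (hf v) (hg v)

theorem exists_hasValue {P : W.Point} {f : W.FunctionField} (hf : pointVal P f ≤ 1) :
    ∃ c, HasValue P f c :=
  let ⟨c, hc⟩ := exists_pointVal_sub_lt P hf
  ⟨c, hasValue_iff.2 hc⟩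

theorem HasValue.unique {P : W.Point} {f : W.FunctionField} {c d : K} (hc : HasValue P f c)
    (hd : HasValue P f d) : c = d :=
  eq_of_pointVal_sub_lt (hasValue_iff.1 hc) (hasValue_iff.1 hd)

variable {S X : Finset W.Point} {D : W.Point →₀ ℤ}

theorem HasValue.mul {P : W.Point} {f g : W.FunctionField} {a b : K} (hf : HasValue P f a)
    (hg : HasValue P g b) : HasValue P (f * g) (a * b) := by
  rw [hasValue_iff] at hf hg ⊢
  have e : f * g - algebraMap K _ (a * b) = f * (g - algebraMap K _ b) +
      algebraMap K _ b * (f - algebraMap K _ a) := by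
    rw [map_mul]
    ring
  have h1 : pointVal P f ≤ 1 := by
    have := Valuation.map_add_le _ hf.le (pointVal_algebraMap_le P a)
    rwa [sub_add_cancel] at this
  rw [e]
  exact Valuation.map_add_lt _ (pointVal_mul_lt h1 hg)
    (pointVal_mul_lt (pointVal_algebraMap_le P b) hf)

theorem exists_word (hD : ∀ s ∈ S, D s = 0) {f : W.FunctionField} (hf : f ∈ rrSpace D) :
    ∃ x ∈ codeL D S, ∀ s : S, HasValue s.1 f (x s) := by
  have : ∀ s : S, ∃ c, HasValue s.1 f c := fun s => exists_hasValue (by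
    have := pointVal_le_of_mem_rrSpace hf s.1
    rwa [hD _ s.2, exp_zero] at this)
  choose x hx using this
  exact ⟨x, ⟨f, hf, hx⟩, hx⟩

theorem algebraMap_mem_rrSpace (hD : 0 ≤ D) (a : K) : algebraMap K _ a ∈ rrSpace D := by
  refine rrSpace_mono hD (mem_rrSpace_iff.2 fun v => ?_)
  rw [show divisorCoeff (0 : W.Point →₀ ℤ) v = 0 by simp [divisorCoeff], exp_zero]
  exact v.val_algebraMap_le a

variable [DecidableEq K]

/-- A zero at a point where the divisor has coefficient 0 improves the order there by one. -/
theorem mem_rrSpace_sub {G : W.Point →₀ ℤ} {f : W.FunctionField} (hf : f ∈ rrSpace G)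
    {J : Finset W.Point} (hJ : ∀ s ∈ J, G s = 0) (h : ∀ s ∈ J, HasValue s f 0) :
    f ∈ rrSpace (G - divisorOf J) := by
  rw [mem_rrSpace_iff] at hf ⊢
  intro v
  by_cases hv : ∃ P, v.val = pointVal P
  · obtain ⟨P, hP⟩ := hv
    rw [divisorCoeff_of_val_eq hP, Finsupp.sub_apply, divisorOf_apply]
    split_ifs with hPJ
    · have := hasValue_iff.1 (h P hPJ)
      rw [map_zero, sub_zero] at this
      rw [hP, hJ P hPJ]
      exact le_exp_neg_one this
    · rw [sub_zero, ← divisorCoeff_of_val_eq hP]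
      exact hf v
  · push Not at hv
    have := hf v
    rwa [divisorCoeff_of_forall_ne hv] at this ⊢

/-- The weight of a nonzero word of a functional Goppa code is at least `n - deg D`. -/
theorem card_le_hammingNorm_add (hD : ∀ s ∈ S, D s = 0) {x : S → K} (hx : x ∈ codeL D S)
    (hx0 : x ≠ 0) : (S.card : ℤ) ≤ hammingNorm x + D.degree := by
  obtain ⟨f, hf, hfx⟩ := hx
  have hf0 : f ≠ 0 := by
    rintro rfl
    refine hx0 (funext fun s => ?_)
    have h0 := hasValue_algebraMap (W := W) (P := s.1) (0 : K)
    rw [map_zero] at h0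
    exact (hfx s).unique h0
  set J : Finset S := {s | x s = 0} with hJ
  have hmem : f ∈ rrSpace (D - divisorOf (J.map (Function.Embedding.subtype _))) := by
    refine mem_rrSpace_sub hf (fun s hs => ?_) fun s hs => ?_
    · obtain ⟨s, -, rfl⟩ := Finset.mem_map.1 hs
      exact hD _ s.2
    · obtain ⟨s, hsJ, rfl⟩ := Finset.mem_map.1 hs
      have := hfx s
      rwa [show x s = 0 from (Finset.mem_filter.1 hsJ).2] at this
  have h := degree_nonneg_of_mem_rrSpace hmem hf0
  rw [map_sub, degree_divisorOf, Finset.card_map] at h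
  have hcard : J.card + hammingNorm x = S.card := by
    rw [← Fintype.card_coe S, ← Finset.card_univ]
    exact Finset.card_filter_add_card_filter_not _
  omega

theorem eq_zero_of_forall_hasValue (hD : ∀ s ∈ S, D s = 0) (hdeg : D.degree < S.card)
    {f : W.FunctionField} (hf : f ∈ rrSpace D) (h : ∀ s ∈ S, HasValue s f 0) : f = 0 := by
  by_contra hf0
  have := degree_nonneg_of_mem_rrSpace (mem_rrSpace_sub hf hD h) hf0
  rw [map_sub, degree_divisorOf] at this
  omega

/-- Each further pole order at `P` adds a dimension, and evaluation on `S` stays injective while the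
degree is below |S|. The induction starts from L(P), which contains the constants, because
`exists_mem_rrSpace_add` needs degree at least 1. -/
theorem le_finrank_codeL (h3 : ∀ P Q : W.Point, ∃ T, T ≠ P ∧ T ≠ Q) {P : W.Point} (hP : P ∉ S)
    (k : ℕ) (hk : k + 1 < S.card) :
    k + 1 ≤ Module.finrank K (codeL (Finsupp.single P ((k : ℤ) + 1)) S) := by
  have hzero : ∀ (n : ℤ), ∀ s ∈ S, Finsupp.single P n s = 0 := fun n s hs =>
    Finsupp.single_eq_of_ne (by rintro rfl; exact hP hs)
  induction k with
  | zero =>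
    have hmem : (1 : S → K) ∈ codeL (Finsupp.single P (((0 : ℕ) : ℤ) + 1)) S :=
      ⟨algebraMap K _ 1, algebraMap_mem_rrSpace (by simp) 1, fun s => hasValue_algebraMap 1⟩
    have : Nonempty S := (Finset.card_pos.1 (by omega)).to_subtype
    rw [zero_add, Nat.one_le_iff_ne_zero, Ne, Submodule.finrank_eq_zero]
    intro h0
    rw [h0, Submodule.mem_bot] at hmem
    exact one_ne_zero hmem
  | succ k ih =>
    refine (ih (by omega)).trans_lt (Submodule.finrank_lt_finrank_of_lt ?_)
    have hle : (Finsupp.single P ((k : ℤ) + 1)) ≤ Finsupp.single P (((k + 1 : ℕ) : ℤ) + 1) := by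
      rw [Finsupp.single_le_single]
      push_cast
      omega
    obtain ⟨f, hf, hfP⟩ := exists_mem_rrSpace_add h3
      (G := Finsupp.single P ((k : ℤ) + 1)) (by simp) P
    rw [← Finsupp.single_add] at hf
    refine lt_of_le_of_ne (fun x ⟨g, hg, hgx⟩ => ⟨g, rrSpace_mono hle hg, hgx⟩) fun heq => ?_
    have hf' : f ∈ rrSpace (Finsupp.single P (((k + 1 : ℕ) : ℤ) + 1)) := by
      push_cast
      exact hf
    obtain ⟨x, hx, hfx⟩ := exists_word (hzero _) hf'
    -- If the two codes were equal, the word of f would also come from some g with a smaller pole at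
    -- `P`. Then f - g vanishes on all of S, so f = g, against the exact pole order of f.
    rw [← heq] at hx
    obtain ⟨g, hg, hgx⟩ := hx
    have h0 := eq_zero_of_forall_hasValue (hzero _) (by
        rw [Finsupp.degree_single]
        push_cast
        exact_mod_cast hk)
      (sub_mem hf' (rrSpace_mono hle hg)) fun s hs => by
        have := (hfx ⟨s, hs⟩).sub (hgx ⟨s, hs⟩)
        rwa [sub_self] at this
    rw [sub_eq_zero] at h0
    have h1 := pointVal_le_of_mem_rrSpace hg P
    rw [← h0, hfP, exp_le_exp] at h1
    omega

/-- Products of words of functional codes and residue codes are orthogonal to each other. -/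
theorem sum_mul_eq_zero {Q : W.Point →₀ ℤ} (hD : ∀ s ∈ S, D s = 0) (hQ : ∀ s ∈ S, Q s = 0)
    {a b v : S → K} (ha : a ∈ codeL Q S) (hb : b ∈ codeOmega (divisorOf S - D - Q) S)
    (hv : v ∈ codeL D S) : ∑ s, a s * b s * v s = 0 := by
  obtain ⟨f, hf, hfa⟩ := ha
  obtain ⟨ω, hω, hωb⟩ := hb
  obtain ⟨g, hg, hgv⟩ := hv
  rw [mem_diffSpace_iff] at hω
  -- `D` and `Q` cancel, so f g ω has at most simple poles, all on S; its residues are the residues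
  -- of ω times the values of f and g.
  have hH : f * g * diffCoeff W ω ∈ rrSpace (divisorOf S) := by
    have := mul_mem_rrSpace (mul_mem_rrSpace hf hg) hω
    rwa [show Q + D + (divisorOf S - D - Q) = divisorOf S by abel] at this
  have := sum_residues_eq_zero hH
    (c := fun s => if hs : s ∈ S then a ⟨s, hs⟩ * v ⟨s, hs⟩ * b ⟨s, hs⟩ else 0) ?_
  · rw [← Finset.sum_coe_sort] at this
    rw [← this]
    refine Finset.sum_congr rfl fun s _ => ?_
    rw [dif_pos s.2]
    ring
  · intro s hs
    rw [dif_pos hs]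
    have h1 : pointVal s (diffCoeff W ω) ≤ exp (1 : ℤ) := by
      have := pointVal_le_of_mem_rrSpace hω s
      rwa [Finsupp.sub_apply, Finsupp.sub_apply, hD s hs, hQ s hs, divisorOf_apply, if_pos hs,
        sub_zero, sub_zero] at this
    exact ((hasResidue_iff h1).1 (hωb ⟨s, hs⟩)).mul ((hfa ⟨s, hs⟩).mul (hgv ⟨s, hs⟩))

/-- The dual of a residue code has no nonzero words of small weight. -/
theorem lt_hammingNorm_of_mem_dual (h3 : ∀ P Q : W.Point, ∃ T, T ≠ P ∧ T ≠ Q) {d : ℕ}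
    (hD : ∀ s ∈ S, D s = 0) (hdeg : D.degree + d + 1 ≤ S.card) {x : S → K}
    (hx : x ∈ Code.dual (codeOmega (divisorOf S - D) S)) (hx0 : x ≠ 0) : d < hammingNorm x := by
  by_contra! hle
  obtain ⟨s, hs⟩ := Function.ne_iff.1 hx0
  rw [Pi.zero_apply] at hs
  set J : Finset S := {s | ¬ x s = 0} with hJ
  have hJn : J.card ≤ d := hle
  have hcard : (S \ J.map (Function.Embedding.subtype _)).card + J.card = S.card := by
    rw [← Finset.card_map (s := J) (Function.Embedding.subtype _)]
    refine Finset.card_sdiff_add_card_eq_card fun s hs => ?_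
    obtain ⟨s, -, rfl⟩ := Finset.mem_map.1 hs
    exact s.2
  have hmemJ : ∀ s : S, s.1 ∈ S \ J.map (Function.Embedding.subtype _) ↔ x s = 0 := fun s => by
    simp [hJ]
  -- Simple poles are allowed only at the zeros of `x`. As `x` has at most d nonzero entries, the
  -- degree is still at least 1, and one extra pole at the support point `s` can be attained.
  set G₀ := divisorOf (S \ J.map (Function.Embedding.subtype _)) - D with hG₀
  have hG₀s : ∀ s : S, G₀ s = if x s = 0 then 1 else 0 := fun s => by
    rw [hG₀, Finsupp.sub_apply, hD _ s.2, divisorOf_apply, sub_zero]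
    simp only [hmemJ]
  obtain ⟨f, hf, hfs⟩ := exists_mem_rrSpace_add h3 (G := G₀) (by
    rw [map_sub, degree_divisorOf]
    omega) s.1
  have hle : G₀ + Finsupp.single s.1 1 ≤ divisorOf S - D := fun T => by
    rw [Finsupp.add_apply]
    by_cases hT : T ∈ S
    · have h1 := hG₀s ⟨T, hT⟩
      rw [h1, Finsupp.sub_apply, hD T hT, divisorOf_apply, if_pos hT, Finsupp.single_apply]
      split_ifs with h2 h3 h3
      · exact absurd h2 (by convert! hs; exact h3.symm)
      all_goals norm_num
    · rw [hG₀, Finsupp.sub_apply, Finsupp.sub_apply, divisorOf_apply, divisorOf_apply, if_neg hT,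
        if_neg (fun h => hT (Finset.sdiff_subset h)), Finsupp.single_eq_of_ne
        (by rintro rfl; exact hT s.2), add_zero]
  have hω : diffCoeff W (f • invDifferential W) = f := by
    rw [map_smul, diffCoeff_invDifferential, smul_eq_mul, mul_one]
  have hval : ∀ T : S, pointVal T.1 f ≤ exp (1 : ℤ) := fun T => by
    have := pointVal_le_of_mem_rrSpace (rrSpace_mono hle hf) T.1
    rwa [Finsupp.sub_apply, hD _ T.2, divisorOf_apply, if_pos T.2] at this
  choose b hb using fun T : S => exists_hasPoleResidue (hval T)
  have hbB : b ∈ codeOmega (divisorOf S - D) S := by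
    refine ⟨f • invDifferential W, ?_, fun T => ?_⟩
    · rw [mem_diffSpace_iff, hω]
      exact rrSpace_mono hle hf
    · rw [hasResidue_iff (by rw [hω]; exact hval T), hω]
      exact hb T
  have hsum := hx b hbB
  -- Where `x` is zero its factor kills the term, and at the other support points the differential
  -- is regular. Only the term at `s` is left, and its residue is nonzero.
  rw [dotProduct, Finset.sum_eq_single s] at hsum
  · have hbs := (mul_eq_zero.1 hsum).resolve_left hs
    have := hb s
    rw [hbs, hasPoleResidue_zero_iff, hfs, hG₀s, if_neg hs, ← exp_zero, exp_le_exp] at this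
    norm_num at this
  · intro T _ hT
    by_cases hxT : x T = 0
    · rw [hxT, zero_mul]
    · have h1 := pointVal_le_of_mem_rrSpace hf T.1
      rw [Finsupp.add_apply, hG₀s, if_neg hxT,
        Finsupp.single_eq_of_ne (fun h => hT (Subtype.ext h)), add_zero, exp_zero,
        ← hasPoleResidue_zero_iff] at h1
      rw [(hb T).unique h1, mul_zero]
  · exact fun h => absurd (Finset.mem_univ s) h

/-- All conditions come down to |X| + 2d + 2 ≤ n. The bound for the dual of the residue code uses it
exactly: the divisor of degree |X| + d + 1 and d support points must leave degree at least 1. The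
other conditions have slack. -/
theorem isErrorCorrectingPair {P : W.Point} {d : ℕ} (hP : P ∉ S) (hX : Disjoint S X)
    (hd : 0 < d) (hdeg : X.card + 2 * d + 2 ≤ S.card) :
    Code.IsErrorCorrectingPair d (codeL (Finsupp.single P ((d : ℤ) + 1)) S)
      (codeOmega (divisorOf S - divisorOf X - Finsupp.single P ((d : ℤ) + 1)) S)
      (codeL (divisorOf X) S) := by
  -- Auxiliary zeros must avoid two given points; 0 < d makes S contain at least four.
  have h3 : ∀ P Q : W.Point, ∃ T, T ≠ P ∧ T ≠ Q := fun P Q => by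
    have : ({P, Q} : Finset W.Point).card < S.card := Finset.card_le_two.trans_lt (by omega)
    obtain ⟨T, -, hT⟩ := Finset.exists_mem_notMem_of_card_lt_card this
    simp only [Finset.mem_insert, Finset.mem_singleton, not_or] at hT
    exact ⟨T, hT⟩
  have hQ : ∀ s ∈ S, Finsupp.single P ((d : ℤ) + 1) s = 0 := fun s hs =>
    Finsupp.single_eq_of_ne (by rintro rfl; exact hP hs)
  have hD : ∀ s ∈ S, divisorOf X s = 0 := fun s hs => by
    rw [divisorOf_apply, if_neg (Finset.disjoint_left.1 hX hs)]
  refine ⟨fun a ha b hb v hv => sum_mul_eq_zero hD hQ ha hb hv,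
    le_finrank_codeL h3 hP d (by omega), ?_, ?_⟩
  · have hA : ((S.card - (d + 1) : ℕ) : ℕ∞) ≤
        Code.minDist (codeL (Finsupp.single P ((d : ℤ) + 1)) S) :=
      Code.le_minDist fun x hx hx0 => by
        have := card_le_hammingNorm_add hQ hx hx0
        rw [Finsupp.degree_single] at this
        omega
    have hC : ((S.card - X.card : ℕ) : ℕ∞) ≤ Code.minDist (codeL (divisorOf X) S) :=
      Code.le_minDist fun x hx hx0 => by
        have := card_le_hammingNorm_add hD hx hx0
        rw [degree_divisorOf] at this
        omega
    refine lt_of_lt_of_le ?_ (add_le_add hA hC)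
    rw [Fintype.card_coe]
    norm_cast
    omega
  · rw [sub_sub]
    refine lt_of_lt_of_le (Nat.cast_lt.2 (Nat.lt_succ_self d))
      (Code.le_minDist fun x hx hx0 => lt_hammingNorm_of_mem_dual h3 (fun s hs => ?_) ?_ hx hx0)
    · rw [Finsupp.add_apply, hD s hs, hQ s hs, add_zero]
    · rw [map_add, degree_divisorOf, Finsupp.degree_single]
      omega

end WeierstrassCurve.Affine
end

noncomputable section

/-! ### A program for error correcting pairs -/

namespace FieldRAM

variable {K : Type*} [Field K] [DecidableEq K]

/-- Started in the state `σ`, the program stops after at most `T` steps in a state that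
satisfies `Q`. -/
def Prog.Runs (p : Prog) (σ : State K) (T : ℕ) (Q : State K → Prop) : Prop :=
  Q (p.run σ).1 ∧ (p.run σ).2 ≤ T

namespace Prog

theorem Runs.mono {p : Prog} {σ : State K} {T T' : ℕ} {Q Q' : State K → Prop}
    (h : p.Runs σ T Q) (hT : T ≤ T') (hQ : ∀ τ, Q τ → Q' τ) : p.Runs σ T' Q' :=
  ⟨hQ _ h.1, h.2.trans hT⟩

theorem Runs.seq {p q : Prog} {σ : State K} {T T' : ℕ} {Q R : State K → Prop}
    (hp : p.Runs σ T Q) (hq : ∀ τ, Q τ → q.Runs τ T' R) : (p.seq q).Runs σ (T + T') R :=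
  ⟨(hq _ hp.1).1, add_le_add hp.2 (hq _ hp.1).2⟩

/-- `I j` holds after j rounds. The number of rounds is fixed when the loop starts; the time is
stated with an upper bound `N` for it, so that all costs become polynomials in one variable. -/
theorem Runs.loop {r s N : ℕ} {p : Prog} {σ : State K} {T : ℕ} (I : ℕ → State K → Prop)
    (hN : σ.reg s ≤ N) (h0 : I 0 σ)
    (hI : ∀ j < σ.reg s, ∀ τ, I j τ → p.Runs (τ.setReg r j) T (I (j + 1))) :
    (Prog.loop r s p).Runs σ (1 + N * (T + 1)) (I (σ.reg s)) := by
  let u : ℕ → State K × ℕ := fun j => Nat.rec (motive := fun _ => State K × ℕ) (σ, 1)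
    (fun j u => ((p.run (u.1.setReg r j)).1, u.2 + (p.run (u.1.setReg r j)).2 + 1)) j
  have key : ∀ j ≤ σ.reg s, I j (u j).1 ∧ (u j).2 ≤ 1 + j * (T + 1) := by
    intro j hj
    induction j with
    | zero => exact ⟨h0, by simp [u]⟩
    | succ j ih =>
      obtain ⟨h1, h2⟩ := ih (by omega)
      obtain ⟨h3, h4⟩ := hI j (by omega) _ h1
      refine ⟨h3, ?_⟩
      rw [add_one_mul]
      change (u j).2 + (p.run ((u j).1.setReg r j)).2 + 1 ≤ _
      omega
  obtain ⟨h1, h2⟩ := key _ le_rfl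
  exact ⟨h1, h2.trans (by gcongr)⟩

/-- Do nothing. -/
def skip : Prog := .copy 9 9

/-- `s i := ∑ j, w m j * v i j`, in the row 0 of array 6. -/
def dot (v w : ℕ) : Prog :=
  .seq (.zero ⟨6, 9, 5⟩) (.loop 6 0 (.seq (.mul ⟨9, 9, 9⟩ ⟨w, 4, 6⟩ ⟨v, 5, 6⟩)
    (.add ⟨6, 9, 5⟩ ⟨6, 9, 5⟩ ⟨9, 9, 9⟩)))

/-- Register 9 always holds 0 and serves as the constant index 0; the cell (0, 0) of array 9 is
scratch, which is why `k ≠ 9` is excluded. -/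
theorem dot_runs {v w N : ℕ} (hv : v ≠ 6 ∧ v ≠ 9) (hw : w ≠ 6 ∧ w ≠ 9) {σ : State K}
    (hz : σ.reg 9 = 0) (hN : σ.reg 0 ≤ N) :
    (dot v w).Runs σ (2 + 3 * N) fun τ =>
      (∀ k i j, k ≠ 9 → τ.mem k i j = if k = 6 ∧ i = 0 ∧ j = σ.reg 5 then
        ∑ j ∈ Finset.range (σ.reg 0), σ.mem w (σ.reg 4) j * σ.mem v (σ.reg 5) j else
          σ.mem k i j) ∧ ∀ r, r ≠ 6 → τ.reg r = σ.reg r := by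
  have h1 : (Prog.zero ⟨6, 9, 5⟩).Runs σ 1 fun τ => τ = σ.set ⟨6, 9, 5⟩ 0 := ⟨rfl, le_rfl⟩
  refine (h1.seq (T' := 1 + N * (2 + 1)) ?_).mono (by omega) (fun _ h => h)
  rintro _ rfl
  refine Runs.loop (σ := σ.set ⟨6, 9, 5⟩ 0) (I := fun m τ =>
      (∀ k i j, k ≠ 9 → τ.mem k i j = if k = 6 ∧ i = 0 ∧ j = σ.reg 5 then
        ∑ j ∈ Finset.range m, σ.mem w (σ.reg 4) j * σ.mem v (σ.reg 5) j else
          σ.mem k i j) ∧ ∀ r, r ≠ 6 → τ.reg r = σ.reg r) hN ?_ ?_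
  · refine ⟨fun k i j _ => ?_, fun r _ => rfl⟩
    simp [State.set, hz]
  · rintro m - τ ⟨hm, hr⟩
    refine ⟨⟨fun k i j hk => ?_, fun r hr6 => ?_⟩, le_rfl⟩
    · simp [Prog.run, State.set, State.get, State.setReg, Function.update, hr, hz, hm, hv, hw, hk,
        Finset.sum_range_succ]
      split_ifs <;> rfl
    · simp [Prog.run, State.set, State.setReg, Function.update, hr, hr6]

/-- `s i := ∑ j, w m j * v i j` for the rows `i` of the array `v`. -/
def dots (v w : ℕ) : Prog := .loop 5 8 (dot v w)

theorem dots_runs {v w N : ℕ} (hv : v ≠ 6 ∧ v ≠ 9) (hw : w ≠ 6 ∧ w ≠ 9) {σ : State K}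
    (hz : σ.reg 9 = 0) (hN : σ.reg 0 ≤ N) (hN' : σ.reg 8 ≤ N) :
    (dots v w).Runs σ (1 + N * (3 + 3 * N)) fun τ =>
      (∀ k i j, k ≠ 9 → τ.mem k i j = if k = 6 ∧ i = 0 ∧ j < σ.reg 8 then
        ∑ t ∈ Finset.range (σ.reg 0), σ.mem w (σ.reg 4) t * σ.mem v j t else
          σ.mem k i j) ∧ ∀ r, r ≠ 5 → r ≠ 6 → τ.reg r = σ.reg r := by
  refine (Runs.loop (σ := σ) (T := 2 + 3 * N) (I := fun m τ =>
      (∀ k i j, k ≠ 9 → τ.mem k i j = if k = 6 ∧ i = 0 ∧ j < m then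
        ∑ t ∈ Finset.range (σ.reg 0), σ.mem w (σ.reg 4) t * σ.mem v j t else
          σ.mem k i j) ∧ ∀ r, r ≠ 5 → r ≠ 6 → τ.reg r = σ.reg r) hN' ?_ ?_).mono (by
            apply le_of_eq; ring) (fun _ h => h)
  · simp
  · rintro m - τ ⟨hm, hr⟩
    refine (dot_runs (N := N) hv hw ?_ ?_).mono le_rfl fun ρ ⟨h1, h2⟩ => ⟨fun k i j hk => ?_, ?_⟩
    · simpa [State.setReg, hr] using hz
    · simpa [State.setReg, hr] using hN
    · rw [h1 k i j hk]
      simp only [State.setReg, Function.update_self, ne_eq, Nat.reduceEqDiff, not_false_eq_true,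
        Function.update_of_ne, hr, hm, hv, hw, hk, false_and, if_false]
      grind
    · intro r hr5 hr6
      rw [h2 r hr6]
      simp [State.setReg, hr5, hr6, hr]

/-- Find a row `p` with `s p ≠ 0`, put it into the register 7, and put `(s p)⁻¹` or, if there is no
such row, `0` into the array 8. -/
def scan (R : ℕ) : Prog :=
  .seq (.zero ⟨8, 9, 9⟩) (.loop 5 R (.ifZero ⟨6, 9, 5⟩ skip (.seq (.inv ⟨8, 9, 9⟩ ⟨6, 9, 5⟩)
    (.copy 7 5))))

/-- The value 0 in array 8 records that there is no pivot; all multiples subtracted afterwards are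
then zero, so no further test is needed. The last nonzero row wins, which is as good as any. -/
theorem scan_runs {R N : ℕ} {σ : State K}
    (hz : σ.reg 9 = 0) (hN : σ.reg R ≤ N) :
    (scan R).Runs σ (2 + 4 * N) fun τ =>
      (∀ k, k ≠ 8 → τ.mem k = σ.mem k) ∧ (∀ r, r ≠ 5 → r ≠ 7 → τ.reg r = σ.reg r) ∧
      ((τ.mem 8 0 0 = 0 ∧ ∀ i < σ.reg R, σ.mem 6 0 i = 0) ∨
        (τ.reg 7 < σ.reg R ∧ σ.mem 6 0 (τ.reg 7) ≠ 0 ∧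
          τ.mem 8 0 0 = (σ.mem 6 0 (τ.reg 7))⁻¹)) := by
  have h1 : (Prog.zero ⟨8, 9, 9⟩).Runs σ 1 fun τ => τ = σ.set ⟨8, 9, 9⟩ 0 := ⟨rfl, le_rfl⟩
  refine (h1.seq (T' := 1 + N * (3 + 1)) ?_).mono (by omega) (fun _ h => h)
  rintro _ rfl
  refine Runs.loop (σ := σ.set ⟨8, 9, 9⟩ 0) (I := fun m τ =>
      (∀ k, k ≠ 8 → τ.mem k = σ.mem k) ∧ (∀ r, r ≠ 5 → r ≠ 7 → τ.reg r = σ.reg r) ∧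
      ((τ.mem 8 0 0 = 0 ∧ ∀ i < m, σ.mem 6 0 i = 0) ∨
        (τ.reg 7 < m ∧ σ.mem 6 0 (τ.reg 7) ≠ 0 ∧
          τ.mem 8 0 0 = (σ.mem 6 0 (τ.reg 7))⁻¹))) hN ?_ ?_
  · refine ⟨fun k hk => ?_, fun r _ _ => rfl, ?_⟩
    · simp [State.set, hk]
    · simp [State.set, hz]
  · rintro m - τ ⟨hm, hr, hp⟩
    have h9 : τ.reg 9 = 0 := by rw [hr 9 (by norm_num) (by norm_num), hz]
    have hget : (τ.setReg 5 m).get ⟨6, 9, 5⟩ = σ.mem 6 0 m := by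
      simp [State.setReg, State.get, h9, hm]
    by_cases h0 : σ.mem 6 0 m = 0
    · constructor
      · simp only [run, hget, h0, if_true, skip]
        refine ⟨hm, fun r h5 h7 => ?_, ?_⟩
        · by_cases hr9 : r = 9 <;> simp [State.setReg, hr9, h5, h7, hr]
        · rcases hp with ⟨hc, hp⟩ | ⟨hp1, hp2, hp3⟩
          · exact Or.inl ⟨hc, fun i hi => (Nat.lt_succ_iff_lt_or_eq.1 hi).elim (hp i)
              fun h => h ▸ h0⟩
          · refine Or.inr ?_
            simp only [State.setReg, ne_eq, Nat.reduceEqDiff, not_false_eq_true,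
              Function.update_of_ne]
            exact ⟨by omega, hp2, hp3⟩
      · simp [run, hget, h0, skip]
    · constructor
      · simp only [run, hget, h0, if_false]
        refine ⟨fun k hk => ?_, fun r h5 h7 => ?_, Or.inr ?_⟩
        · simp [State.setReg, State.set, hk, hm]
        · simp [State.setReg, State.set, h5, h7, hr]
        · simp [State.setReg, State.set, h0, h9]
      · simp [run, hget, h0]

/-- Copy the row of the array `v` with the number in the register 7 to the array 7. -/
def copyRow (v : ℕ) : Prog := .loop 6 0 (.move ⟨7, 9, 6⟩ ⟨v, 7, 6⟩)

/-- The pivot row is saved because the subtraction also treats the pivot row itself and would spoil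
it for later rows. -/
theorem copyRow_runs {v N : ℕ} (hv : v ≠ 7) {σ : State K} (hz : σ.reg 9 = 0) (hN : σ.reg 0 ≤ N) :
    (copyRow v).Runs σ (1 + N * 2) fun τ =>
      (∀ k i j, τ.mem k i j = if k = 7 ∧ i = 0 ∧ j < σ.reg 0 then σ.mem v (σ.reg 7) j else
        σ.mem k i j) ∧ ∀ r, r ≠ 6 → τ.reg r = σ.reg r := by
  refine Runs.loop (σ := σ) (I := fun m τ =>
      (∀ k i j, τ.mem k i j = if k = 7 ∧ i = 0 ∧ j < m then σ.mem v (σ.reg 7) j else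
        σ.mem k i j) ∧ ∀ r, r ≠ 6 → τ.reg r = σ.reg r) hN ?_ ?_
  · simp
  · rintro m - τ ⟨hm, hr⟩
    refine ⟨⟨fun k i j => ?_, fun r hr6 => ?_⟩, le_rfl⟩
    · simp only [run, State.set, State.get, State.setReg, hm, hv, Function.update_self, ne_eq,
        Nat.reduceEqDiff, not_false_eq_true, Function.update_of_ne, hr, false_and, if_false, hz]
      grind
    · simp [run, State.set, State.setReg, hr, hr6]

/-- Subtract from the row of the array `v` with the number in the register 5 a multiple of the row
in the array 7. -/
def subRow (v : ℕ) : Prog :=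
  .seq (.mul ⟨6, 9, 5⟩ ⟨6, 9, 5⟩ ⟨8, 9, 9⟩) (.loop 6 0 (.seq (.mul ⟨9, 9, 9⟩ ⟨6, 9, 5⟩ ⟨7, 9, 6⟩)
    (.sub ⟨v, 5, 6⟩ ⟨v, 5, 6⟩ ⟨9, 9, 9⟩)))

theorem subRow_runs {v N : ℕ} (hv : v ≠ 6 ∧ v ≠ 7 ∧ v ≠ 9) {σ : State K} (hz : σ.reg 9 = 0)
    (hN : σ.reg 0 ≤ N) :
    (subRow v).Runs σ (2 + 3 * N) fun τ =>
      (∀ k i j, k ≠ 9 → τ.mem k i j = if k = 6 ∧ i = 0 ∧ j = σ.reg 5 then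
        σ.mem 6 0 j * σ.mem 8 0 0 else if k = v ∧ i = σ.reg 5 ∧ j < σ.reg 0 then
          σ.mem v i j - σ.mem 6 0 i * σ.mem 8 0 0 * σ.mem 7 0 j else σ.mem k i j) ∧
      ∀ r, r ≠ 6 → τ.reg r = σ.reg r := by
  have h1 : (Prog.mul ⟨6, 9, 5⟩ ⟨6, 9, 5⟩ ⟨8, 9, 9⟩).Runs σ 1 fun τ =>
    τ = σ.set ⟨6, 9, 5⟩ (σ.get ⟨6, 9, 5⟩ * σ.get ⟨8, 9, 9⟩) := ⟨rfl, le_rfl⟩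
  refine (h1.seq (T' := 1 + N * (2 + 1)) ?_).mono (by omega) (fun _ h => h)
  rintro _ rfl
  refine Runs.loop (σ := σ.set ⟨6, 9, 5⟩ (σ.get ⟨6, 9, 5⟩ * σ.get ⟨8, 9, 9⟩)) (I := fun m τ =>
      (∀ k i j, k ≠ 9 → τ.mem k i j = if k = 6 ∧ i = 0 ∧ j = σ.reg 5 then
        σ.mem 6 0 j * σ.mem 8 0 0 else if k = v ∧ i = σ.reg 5 ∧ j < m then
          σ.mem v i j - σ.mem 6 0 i * σ.mem 8 0 0 * σ.mem 7 0 j else σ.mem k i j) ∧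
      ∀ r, r ≠ 6 → τ.reg r = σ.reg r) hN ?_ ?_
  · refine ⟨fun k i j hk => ?_, fun r _ => rfl⟩
    simp only [State.set, State.get, hz]
    grind
  · rintro m - τ ⟨hm, hr⟩
    refine ⟨⟨fun k i j hk => ?_, fun r hr6 => ?_⟩, le_rfl⟩
    · simp only [run, State.set, State.get, State.setReg, hm, hv, Function.update_self, ne_eq,
        Nat.reduceEqDiff, not_false_eq_true, Function.update_of_ne, hr, false_and, if_false, hz,
        hk, true_and, and_true, if_true]
      grind
    · simp [run, State.set, State.setReg, hr, hr6]

/-- Subtract from each row of the array `v` its multiple of the row in the array 7. -/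
def subRows (v : ℕ) : Prog := .loop 5 8 (subRow v)

theorem subRows_runs {v N : ℕ} (hv : v ≠ 6 ∧ v ≠ 7 ∧ v ≠ 8 ∧ v ≠ 9) {σ : State K}
    (hz : σ.reg 9 = 0) (hN : σ.reg 0 ≤ N) (hN' : σ.reg 8 ≤ N) :
    (subRows v).Runs σ (1 + N * (3 + 3 * N)) fun τ =>
      (∀ k i j, k ≠ 6 → k ≠ 9 → τ.mem k i j = if k = v ∧ i < σ.reg 8 ∧ j < σ.reg 0 then
          σ.mem v i j - σ.mem 6 0 i * σ.mem 8 0 0 * σ.mem 7 0 j else σ.mem k i j) ∧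
      ∀ r, r ≠ 5 → r ≠ 6 → τ.reg r = σ.reg r := by
  -- `subRow` overwrites `s i` by its multiple, so the invariant must also record that the values
  -- for untreated rows are intact.
  refine (Runs.loop (σ := σ) (T := 2 + 3 * N) (I := fun m τ =>
      ((∀ k i j, k ≠ 6 → k ≠ 9 → τ.mem k i j = if k = v ∧ i < m ∧ j < σ.reg 0 then
          σ.mem v i j - σ.mem 6 0 i * σ.mem 8 0 0 * σ.mem 7 0 j else σ.mem k i j) ∧
        ∀ i ≥ m, τ.mem 6 0 i = σ.mem 6 0 i) ∧
      ∀ r, r ≠ 5 → r ≠ 6 → τ.reg r = σ.reg r) hN' ?_ ?_).mono (by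
            apply le_of_eq; ring) (fun _ h => ⟨h.1.1, h.2⟩)
  · simp
  · rintro m - τ ⟨⟨hm, hm6⟩, hr⟩
    refine (subRow_runs (N := N) ⟨hv.1, hv.2.1, hv.2.2.2⟩ ?_ ?_).mono le_rfl fun ρ ⟨h1, h2⟩ =>
      ⟨⟨fun k i j hk6 hk9 => ?_, fun i hi => ?_⟩, ?_⟩
    · simpa [State.setReg, hr] using hz
    · simpa [State.setReg, hr] using hN
    · rw [h1 k i j hk9]
      simp only [State.setReg, Function.update_self, ne_eq, Nat.reduceEqDiff, not_false_eq_true,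
        Function.update_of_ne, hr, hm, hv, hv.2.2.1.symm, hv.2.1.symm, hk6, hk9, false_and,
        if_false]
      grind
    · rw [h1 6 0 i (by norm_num)]
      simp only [State.setReg, Function.update_self]
      grind
    · intro r hr5 hr6
      rw [h2 r hr6]
      simp [State.setReg, hr5, hr6, hr]

/-- The result `V'` of an elimination step for the rows `V 0, …, V r`, on which a linear functional
takes the values `s i`; the pivot row is one of `V 0, …, V (r - 1)`. -/
def IsElimStep (n r : ℕ) (s : ℕ → K) (V V' : ℕ → ℕ → K) : Prop :=
  ∃ (c : K) (p : ℕ), ((c = 0 ∧ ∀ i < r, s i = 0) ∨ (p < r ∧ s p ≠ 0 ∧ c = (s p)⁻¹)) ∧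
    ∀ i ≤ r, ∀ j < n, V' i j = V i j - s i * c * V p j

/-- One step of `elim`. -/
def elimStep (v R w : ℕ) : Prog := .seq (dots v w) (.seq (scan R) (.seq (copyRow v) (subRows v)))

/-- One more row is reduced than is scanned for a pivot: the row with the number in register `R` is
reduced by the others but never enters their span. -/
theorem elimStep_runs {v R w N : ℕ} (hv : v < 6) (hw : w < 6) (hR : R < 4) {σ : State K}
    (hz : σ.reg 9 = 0) (h8 : σ.reg 8 = σ.reg R + 1) (hN : σ.reg 0 ≤ N) (hN' : σ.reg R + 1 ≤ N) :
    (elimStep v R w).Runs σ (5 + 12 * N + 6 * N ^ 2) fun τ =>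
      IsElimStep (σ.reg 0) (σ.reg R)
        (fun i => ∑ t ∈ Finset.range (σ.reg 0), σ.mem w (σ.reg 4) t * σ.mem v i t)
        (σ.mem v) (τ.mem v) ∧
      (∀ k < 6, k ≠ v → τ.mem k = σ.mem k) ∧ ∀ r, r < 5 ∨ 7 < r → τ.reg r = σ.reg r := by
  refine ((dots_runs (N := N) ⟨by omega, by omega⟩ ⟨by omega, by omega⟩ hz hN
    (by omega)).seq (T' := 4 + 9 * N + 3 * N ^ 2) fun τ₁ ⟨h1, hr1⟩ => ?_).mono
    (by apply le_of_eq; ring) fun _ h => h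
  have hz1 : τ₁.reg 9 = 0 := by rw [hr1 _ (by norm_num) (by norm_num), hz]
  have hR1 : τ₁.reg R = σ.reg R := hr1 _ (by omega) (by omega)
  refine ((scan_runs (R := R) (N := N) hz1 (by omega)).seq (T' := 2 + 5 * N + 3 * N ^ 2)
    fun τ₂ ⟨h2, hr2, hp⟩ => ?_).mono (by apply le_of_eq; ring) fun _ h => h
  have hz2 : τ₂.reg 9 = 0 := by rw [hr2 _ (by norm_num) (by norm_num), hz1]
  have h02 : τ₂.reg 0 = σ.reg 0 := by
    rw [hr2 _ (by norm_num) (by norm_num), hr1 _ (by norm_num) (by norm_num)]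
  refine ((copyRow_runs (v := v) (N := N) (by omega) hz2 (by omega)).seq
    (T' := 1 + 3 * N + 3 * N ^ 2) fun τ₃ ⟨h3, hr3⟩ => ?_).mono (by apply le_of_eq; ring)
    fun _ h => h
  have hz3 : τ₃.reg 9 = 0 := by rw [hr3 _ (by norm_num), hz2]
  have h03 : τ₃.reg 0 = σ.reg 0 := by rw [hr3 _ (by norm_num), h02]
  have h83 : τ₃.reg 8 = σ.reg R + 1 := by
    rw [hr3 _ (by norm_num), hr2 _ (by norm_num) (by norm_num), hr1 _ (by norm_num) (by norm_num),
      h8]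
  refine (subRows_runs (v := v) (N := N) ⟨by omega, by omega, by omega, by omega⟩ hz3 (by omega)
    (by omega)).mono (by apply le_of_eq; ring) fun τ₄ ⟨h4, hr4⟩ => ⟨?_, ?_, ?_⟩
  · have hs : ∀ i ≤ σ.reg R, τ₁.mem 6 0 i =
        ∑ t ∈ Finset.range (σ.reg 0), σ.mem w (σ.reg 4) t * σ.mem v i t := fun i hi => by
      rw [h1 _ _ _ (by norm_num), if_pos ⟨rfl, rfl, by omega⟩]
    have hv3 : ∀ k < 6, ∀ i j, τ₃.mem k i j = σ.mem k i j := fun k hk i j => by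
      rw [h3, if_neg (by omega), h2 _ (by omega), h1 _ _ _ (by omega), if_neg (by omega)]
    refine ⟨τ₂.mem 8 0 0, τ₂.reg 7, ?_, fun i hi j hj => ?_⟩
    · rw [hR1] at hp
      refine hp.imp (fun ⟨hc, h⟩ => ⟨hc, fun i hi => ?_⟩) fun ⟨hlt, hne, hc⟩ => ?_
      · dsimp only
        rw [← hs i hi.le]
        exact h i hi
      · dsimp only
        rw [← hs _ hlt.le]
        exact ⟨hlt, hne, hc⟩
    · rw [h4 _ _ _ (by omega) (by omega), if_pos ⟨rfl, by omega, by omega⟩, hv3 v hv]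
      dsimp only
      have h6 : τ₃.mem 6 0 i = τ₁.mem 6 0 i := by
        rw [h3 6 0 i, if_neg (by omega), h2 6 (by norm_num)]
      have h7 : τ₃.mem 7 0 j = σ.mem v (τ₂.reg 7) j := by
        rw [h3 7 0 j, if_pos ⟨rfl, rfl, by omega⟩, h2 v (by omega), h1 v _ _ (by omega),
          if_neg (by omega)]
      have h8 : τ₃.mem 8 0 0 = τ₂.mem 8 0 0 := by rw [h3 8 0 0, if_neg (by omega)]
      rw [← hs i hi, h6, h7, h8]
  · intro k hk hkv
    funext i j
    rw [h4 _ _ _ (by omega) (by omega), if_neg (by omega), h3, if_neg (by omega),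
      h2 _ (by omega), h1 _ _ _ (by omega), if_neg (by omega)]
  · intro r hr
    rw [hr4 _ (by omega) (by omega), hr3 _ (by omega), hr2 _ (by omega) (by omega),
      hr1 _ (by omega) (by omega)]

/-- Replace the rows of the array `v` by generators of the subspace of their span on which all
rows of `w` vanish. The numbers of rows are in the registers `R` and `M`. -/
def elim (v R w M : ℕ) : Prog :=
  .seq (.copy 8 R) (.seq (.succ 8) (.loop 4 M (elimStep v R w)))

/-- The invariant `I` is left abstract, which separates the bookkeeping of the machine from the
linear algebra of `elim_spec`. At most N rounds of cost O(N^2) give the cubic bound. -/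
theorem elim_runs {v R w M N : ℕ} (hv : v < 6) (hw : w < 6) (hvw : v ≠ w) (hR : R < 4) (hM : M < 4)
    {σ : State K} (hz : σ.reg 9 = 0) (hN : σ.reg 0 ≤ N) (hRN : σ.reg R + 1 ≤ N)
    (hMN : σ.reg M ≤ N) {I : ℕ → (ℕ → ℕ → K) → Prop} (h0 : I 0 (σ.mem v))
    (hI : ∀ m < σ.reg M, ∀ V V', I m V → IsElimStep (σ.reg 0) (σ.reg R)
      (fun i => ∑ t ∈ Finset.range (σ.reg 0), σ.mem w m t * V i t) V V' → I (m + 1) V') :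
    (elim v R w M).Runs σ (3 + 6 * N + 12 * N ^ 2 + 6 * N ^ 3) fun τ =>
      I (σ.reg M) (τ.mem v) ∧ (∀ k < 6, k ≠ v → τ.mem k = σ.mem k) ∧
        ∀ r, r < 4 ∨ 8 < r → τ.reg r = σ.reg r := by
  have h1 : (Prog.copy 8 R).Runs σ 1 fun τ => τ = σ.setReg 8 (σ.reg R) := ⟨rfl, le_rfl⟩
  refine (h1.seq (T' := 2 + 6 * N + 12 * N ^ 2 + 6 * N ^ 3) ?_).mono (by omega) (fun _ h => h)
  rintro _ rfl
  have h2 : (Prog.succ 8).Runs (σ.setReg 8 (σ.reg R)) 1 fun τ =>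
    τ = (σ.setReg 8 (σ.reg R)).setReg 8 ((σ.setReg 8 (σ.reg R)).reg 8 + 1) := ⟨rfl, le_rfl⟩
  refine (h2.seq (T' := 1 + N * (5 + 12 * N + 6 * N ^ 2 + 1)) ?_).mono (by apply le_of_eq; ring)
    (fun _ h => h)
  rintro _ rfl
  set σ' := (σ.setReg 8 (σ.reg R)).setReg 8 ((σ.setReg 8 (σ.reg R)).reg 8 + 1) with hσ'
  have hreg : ∀ r, r ≠ 8 → σ'.reg r = σ.reg r := fun r hr => by simp [hσ', State.setReg, hr]
  have hmem : σ'.mem = σ.mem := rfl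
  have h8 : σ'.reg 8 = σ.reg R + 1 := by simp [hσ', State.setReg]
  rw [← hreg M (by omega)] at hMN hI ⊢
  refine Runs.loop (fun m τ => I m (τ.mem v) ∧ (∀ k < 6, k ≠ v → τ.mem k = σ.mem k) ∧
        (τ.reg 8 = σ.reg R + 1) ∧ ∀ r, r < 4 ∨ 8 < r → τ.reg r = σ.reg r) hMN ?_ ?_ |>.mono le_rfl
        fun τ h => ⟨h.1, h.2.1, h.2.2.2⟩
  · exact ⟨h0, fun _ _ _ => rfl, h8, fun r hr => hreg r (by omega)⟩
  · rintro m hm τ ⟨hIm, hk, h8, hr⟩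
    have hr' : ∀ r, r ≠ 4 → (τ.setReg 4 m).reg r = τ.reg r := fun r hr => by
      simp [State.setReg, hr]
    have h4 : (τ.setReg 4 m).reg 4 = m := by simp [State.setReg]
    have hmem' : (τ.setReg 4 m).mem = τ.mem := rfl
    refine (elimStep_runs (N := N) hv hw hR ?_ ?_ ?_ ?_).mono le_rfl fun ρ ⟨h1, h2, h3⟩ =>
      ⟨?_, fun k hk6 hkv => ?_, ?_, fun r hr8 => ?_⟩
    · rw [hr' _ (by norm_num), hr _ (by norm_num), hz]
    · rw [hr' 8 (by norm_num), hr' R (by omega), hr R (by omega), h8]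
    · rwa [hr' _ (by norm_num), hr _ (by norm_num)]
    · rwa [hr' R (by omega), hr R (by omega)]
    · rw [hr' 0 (by norm_num), hr' R (by omega), hr 0 (by norm_num), hr R (by omega), h4, hmem',
        hk w hw hvw.symm] at h1
      exact hI m hm _ _ hIm h1
    · rw [h2 k hk6 hkv, hmem', hk k hk6 hkv]
    · rw [h3 _ (by norm_num), hr' _ (by norm_num), h8]
    · rw [h3 _ (by omega), hr' _ (by omega), hr _ hr8]

/-- Multiply the rows of the array 1 coordinatewise with the received word. -/
def scaleRows : Prog := .loop 4 2 (.loop 6 0 (.mul ⟨1, 4, 6⟩ ⟨1, 4, 6⟩ ⟨3, 9, 6⟩))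

theorem scaleRows_runs {N : ℕ} {σ : State K} (hz : σ.reg 9 = 0) (hN : σ.reg 0 ≤ N)
    (hN' : σ.reg 2 ≤ N) :
    scaleRows.Runs σ (1 + 2 * N + 2 * N ^ 2) fun τ =>
      (∀ k i j, τ.mem k i j = if k = 1 ∧ i < σ.reg 2 ∧ j < σ.reg 0 then
        σ.mem 1 i j * σ.mem 3 0 j else σ.mem k i j) ∧
      ∀ r, r ≠ 4 → r ≠ 6 → τ.reg r = σ.reg r := by
  refine (Runs.loop (σ := σ) (T := 1 + N * (1 + 1)) (I := fun m τ =>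
      (∀ k i j, τ.mem k i j = if k = 1 ∧ i < m ∧ j < σ.reg 0 then
        σ.mem 1 i j * σ.mem 3 0 j else σ.mem k i j) ∧
      ∀ r, r ≠ 4 → r ≠ 6 → τ.reg r = σ.reg r) hN' ?_ ?_).mono (by apply le_of_eq; ring)
      (fun _ h => h)
  · simp
  · rintro m - τ ⟨hm, hr⟩
    have h0 : (τ.setReg 4 m).reg 0 = σ.reg 0 := by simp [State.setReg, hr]
    refine (Runs.loop (σ := τ.setReg 4 m) (I := fun q ρ =>
      (∀ k i j, ρ.mem k i j = if k = 1 ∧ (i < m ∧ j < σ.reg 0 ∨ i = m ∧ j < q) then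
        σ.mem 1 i j * σ.mem 3 0 j else σ.mem k i j) ∧
      (∀ r, r ≠ 4 → r ≠ 6 → ρ.reg r = σ.reg r) ∧ ρ.reg 4 = m) (h0 ▸ hN) ?_ ?_).mono le_rfl
      fun ρ ⟨h1, h2, h3⟩ => ⟨fun k i j => ?_, h2⟩
    · refine ⟨fun k i j => ?_, fun r h4 h6 => ?_, ?_⟩
      · rw [show (τ.setReg 4 m).mem = τ.mem from rfl, hm]
        simp
      · simp [State.setReg, h4, h6, hr]
      · simp [State.setReg]
    · rintro q - ρ ⟨h1, h2, h3⟩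
      refine ⟨⟨fun k i j => ?_, fun r h4 h6 => ?_, ?_⟩, le_rfl⟩
      · simp only [run, State.set, State.get, State.setReg, h1, Function.update_self, ne_eq,
          Nat.reduceEqDiff, not_false_eq_true, Function.update_of_ne, h2, h3, hz, false_and,
          if_false]
        grind
      · simp [run, State.set, State.setReg, h4, h6, h2]
      · simp [run, State.set, State.setReg, h3]
    · rw [h1, h0]
      grind

/-- Put the number of a nonzero row of the array 0 into the register 7. -/
def findRow : Prog := .loop 5 1 (.loop 6 0 (.ifZero ⟨0, 5, 6⟩ skip (.copy 7 5)))

theorem findRow_runs {N : ℕ} {σ : State K} (hN : σ.reg 0 ≤ N) (hN' : σ.reg 1 ≤ N) :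
    findRow.Runs σ (1 + 2 * N + 3 * N ^ 2) fun τ =>
      τ.mem = σ.mem ∧ (∀ r, r ≠ 5 → r ≠ 6 → r ≠ 7 → τ.reg r = σ.reg r) ∧
      ((∀ i < σ.reg 1, ∀ j < σ.reg 0, σ.mem 0 i j = 0) ∨
        τ.reg 7 < σ.reg 1 ∧ ∃ j < σ.reg 0, σ.mem 0 (τ.reg 7) j ≠ 0) := by
  refine (Runs.loop (σ := σ) (T := 1 + N * (2 + 1)) (I := fun m τ =>
      τ.mem = σ.mem ∧ (∀ r, r ≠ 5 → r ≠ 6 → r ≠ 7 → τ.reg r = σ.reg r) ∧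
      ((∀ i < m, ∀ j < σ.reg 0, σ.mem 0 i j = 0) ∨
        τ.reg 7 < m ∧ ∃ j < σ.reg 0, σ.mem 0 (τ.reg 7) j ≠ 0)) hN' ?_ ?_).mono
      (by apply le_of_eq; ring) (fun _ h => h)
  · exact ⟨rfl, fun _ _ _ _ => rfl, Or.inl fun i hi => absurd hi (by omega)⟩
  · rintro m - τ ⟨hm, hr, hp⟩
    have h0 : (τ.setReg 5 m).reg 0 = σ.reg 0 := by simp [State.setReg, hr]
    refine (Runs.loop (σ := τ.setReg 5 m) (I := fun q ρ =>
      ρ.mem = σ.mem ∧ (∀ r, r ≠ 5 → r ≠ 6 → r ≠ 7 → ρ.reg r = σ.reg r) ∧ ρ.reg 5 = m ∧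
      ((∀ i j, (i < m ∧ j < σ.reg 0) ∨ (i = m ∧ j < q) → σ.mem 0 i j = 0) ∨
        ρ.reg 7 < m + 1 ∧ ∃ j < σ.reg 0, σ.mem 0 (ρ.reg 7) j ≠ 0)) (h0 ▸ hN) ?_ ?_).mono le_rfl
      fun ρ ⟨h1, h2, h3, h4⟩ => ⟨h1, h2, h4.imp (fun h i hi j hj => h i j ?_) id⟩
    · refine ⟨hm, fun r h5 h6 h7 => ?_, ?_, hp.imp (fun h i j hij => ?_) fun h => ?_⟩
      · simp [State.setReg, h5, h6, h7, hr]
      · simp [State.setReg]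
      · exact h i (by omega) j (by omega)
      · simp only [State.setReg, ne_eq, Nat.reduceEqDiff, not_false_eq_true, Function.update_of_ne]
        exact ⟨by omega, h.2⟩
    · rintro q hq ρ ⟨h1, h2, h3, h4⟩
      rw [h0] at hq
      have hget : (ρ.setReg 6 q).get ⟨0, 5, 6⟩ = σ.mem 0 m q := by
        simp [State.setReg, State.get, h1, h3]
      by_cases hzero : σ.mem 0 m q = 0
      · constructor
        · simp only [run, hget, hzero, if_true, skip]
          refine ⟨h1, fun r h5 h6 h7 => ?_, ?_, h4.imp (fun h i j hij => ?_) fun h => ?_⟩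
          · by_cases hr9 : r = 9 <;> simp [State.setReg, hr9, h5, h6, h7, h2]
          · simp [State.setReg, h3]
          · by_cases hij' : i = m ∧ j = q
            · rw [hij'.1, hij'.2, hzero]
            · exact h i j (by omega)
          · simpa [State.setReg] using h
        · simp [run, hget, hzero, skip]
      · constructor
        · simp only [run, hget, hzero, if_false]
          refine ⟨h1, fun r h5 h6 h7 => ?_, ?_, Or.inr ?_⟩
          · simp [State.setReg, h5, h6, h7, h2]
          · simp [State.setReg, h3]
          · simp only [State.setReg, ne_eq, Nat.reduceEqDiff, not_false_eq_true,
              Function.update_of_ne, Function.update_self, h3]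
            exact ⟨by omega, q, hq, hzero⟩
        · simp [run, hget, hzero]
    · rw [h0]
      omega

/-- Make the array 5 the diagonal matrix with the row of the array 0 with the number in the
register 7. -/
def diag : Prog := .loop 6 0 (.move ⟨5, 6, 6⟩ ⟨0, 7, 6⟩)

/-- Orthogonality to the rows of a diagonal matrix means that a product of words is zero, so the
second linear system is again one for `elim`. Only the diagonal is written; the other entries of
array 5 are zero from the input. -/
theorem diag_runs {N : ℕ} {σ : State K} (hN : σ.reg 0 ≤ N) :
    diag.Runs σ (1 + N * 2) fun τ =>
      (∀ k i j, τ.mem k i j = if k = 5 ∧ i = j ∧ j < σ.reg 0 then σ.mem 0 (σ.reg 7) j else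
        σ.mem k i j) ∧ ∀ r, r ≠ 6 → τ.reg r = σ.reg r := by
  refine Runs.loop (σ := σ) (I := fun m τ =>
      (∀ k i j, τ.mem k i j = if k = 5 ∧ i = j ∧ j < m then σ.mem 0 (σ.reg 7) j else
        σ.mem k i j) ∧ ∀ r, r ≠ 6 → τ.reg r = σ.reg r) hN ?_ ?_
  · simp
  · rintro m - τ ⟨hm, hr⟩
    refine ⟨⟨fun k i j => ?_, fun r hr6 => ?_⟩, le_rfl⟩
    · simp only [run, State.set, State.get, State.setReg, hm, Function.update_self, ne_eq,
        Nat.reduceEqDiff, not_false_eq_true, Function.update_of_ne, hr, false_and, if_false]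
      grind
    · simp [run, State.set, State.setReg, hr, hr6]

/-- Append the received word to the rows of the array 2. -/
def appendWord : Prog := .loop 6 0 (.move ⟨2, 3, 6⟩ ⟨3, 9, 6⟩)

/-- The received word becomes the extra row that `elim` reduces without using it as a pivot. -/
theorem appendWord_runs {N : ℕ} {σ : State K} (hz : σ.reg 9 = 0) (hN : σ.reg 0 ≤ N) :
    appendWord.Runs σ (1 + N * 2) fun τ =>
      (∀ k i j, τ.mem k i j = if k = 2 ∧ i = σ.reg 3 ∧ j < σ.reg 0 then σ.mem 3 0 j else
        σ.mem k i j) ∧ ∀ r, r ≠ 6 → τ.reg r = σ.reg r := by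
  refine Runs.loop (σ := σ) (I := fun m τ =>
      (∀ k i j, τ.mem k i j = if k = 2 ∧ i = σ.reg 3 ∧ j < m then σ.mem 3 0 j else
        σ.mem k i j) ∧ ∀ r, r ≠ 6 → τ.reg r = σ.reg r) hN ?_ ?_
  · simp
  · rintro m - τ ⟨hm, hr⟩
    refine ⟨⟨fun k i j => ?_, fun r hr6 => ?_⟩, le_rfl⟩
    · simp only [run, State.set, State.get, State.setReg, hm, Function.update_self, ne_eq,
        Nat.reduceEqDiff, not_false_eq_true, Function.update_of_ne, hr, false_and, if_false, hz]
      grind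
    · simp [run, State.set, State.setReg, hr, hr6]

/-- Output the difference of the received word and the last row of the array 2. -/
def output : Prog := .loop 6 0 (.sub ⟨4, 9, 6⟩ ⟨3, 9, 6⟩ ⟨2, 3, 6⟩)

theorem output_runs {N : ℕ} {σ : State K} (hz : σ.reg 9 = 0) (hN : σ.reg 0 ≤ N) :
    output.Runs σ (1 + N * 2) fun τ =>
      ∀ j < σ.reg 0, τ.mem 4 0 j = σ.mem 3 0 j - σ.mem 2 (σ.reg 3) j := by
  refine (Runs.loop (σ := σ) (I := fun m τ =>
      (∀ k i j, τ.mem k i j = if k = 4 ∧ i = 0 ∧ j < m then σ.mem 3 0 j - σ.mem 2 (σ.reg 3) j else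
        σ.mem k i j) ∧ ∀ r, r ≠ 6 → τ.reg r = σ.reg r) hN ?_ ?_).mono le_rfl
        fun τ h j hj => by rw [h.1, if_pos ⟨rfl, rfl, hj⟩]
  · simp
  · rintro m - τ ⟨hm, hr⟩
    refine ⟨⟨fun k i j => ?_, fun r hr6 => ?_⟩, le_rfl⟩
    · simp only [run, State.set, State.get, State.setReg, hm, Function.update_self, ne_eq,
        Nat.reduceEqDiff, not_false_eq_true, Function.update_of_ne, hr, false_and, if_false, hz]
      grind
    · simp [run, State.set, State.setReg, hr, hr6]

/-- The decoder of an error correcting pair `(A, B)` for a code `C`. It determines a nonzero word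
`a ∈ A` with `⟨a * b, y⟩ = 0` for all `b ∈ B`, and then the word `z ∈ y + C` with `a * z = 0`. -/
def decoder : Prog :=
  .seq scaleRows (.seq (elim 0 1 1 2) (.seq findRow (.seq diag (.seq appendWord
    (.seq (elim 2 3 5 0) output)))))

end Prog
end FieldRAM
end

noncomputable section

/-! ### Correctness of the decoder -/

namespace Code

variable {ι K : Type*} [Field K] [Fintype ι]

theorem dotProduct_mul_comm (u v w : ι → K) : (u * v) ⬝ᵥ w = (w * v) ⬝ᵥ u :=
  Finset.sum_congr rfl fun i _ => by simp only [Pi.mul_apply]; ring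

variable [DecidableEq K] {t : ℕ} {A B C : Submodule K (ι → K)}

theorem minDist_le {x : ι → K} (hx : x ∈ C) (hx0 : x ≠ 0) : minDist C ≤ hammingNorm x :=
  iInf_le (fun x : {x : ι → K // x ∈ C ∧ x ≠ 0} => (hammingNorm x.1 : ℕ∞)) ⟨x, hx, hx0⟩

/-- Products of `v` with words of `B` are orthogonal to `x` by the pair condition, so `v * (y - x)`
lies in the dual of `B`. Its weight is at most t, below the minimum distance there. -/
theorem IsErrorCorrectingPair.mul_eq_zero (h : IsErrorCorrectingPair t A B C) {x y v : ι → K}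
    (hx : x ∈ C) (hxy : hammingNorm (y - x) ≤ t) (hv : v ∈ A)
    (hvB : ∀ b ∈ B, (b * y) ⬝ᵥ v = 0) : v * (y - x) = 0 := by
  have hdual : v * (y - x) ∈ dual B := fun b hb => by
    have h1 := h.mul_mem_dual v hv b hb x hx
    have h2 := hvB b hb
    rw [dotProduct_mul_comm] at h2
    rw [mul_sub, sub_dotProduct, h2, zero_sub, neg_eq_zero, ← h1]
    exact Finset.sum_congr rfl fun i _ => by simp only [Pi.mul_apply]; ring
  by_contra h0
  have h1 := h.lt_minDist_dual.trans_le (minDist_le hdual h0)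
  have h2 : hammingNorm (v * (y - x)) ≤ hammingNorm (y - x) :=
    Finset.card_le_card fun i hi => by
      simp only [Finset.mem_filter, Finset.mem_univ, true_and, Pi.mul_apply] at hi ⊢
      exact right_ne_zero_of_mul hi
  rw [Nat.cast_lt] at h1
  omega

/-- Vanishing at the errors is at most t linear conditions, fewer than the dimension of `A`. -/
theorem IsErrorCorrectingPair.exists_mul_eq_zero (h : IsErrorCorrectingPair t A B C) {e : ι → K}
    (he : hammingNorm e ≤ t) : ∃ v ∈ A, v ≠ 0 ∧ v * e = 0 := by
  let J : Finset ι := {i | e i ≠ 0}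
  let f : A →ₗ[K] (J → K) := (LinearMap.funLeft K K (Subtype.val : J → ι)).comp A.subtype
  have hlt : Module.finrank K (J → K) < Module.finrank K A := by
    rw [Module.finrank_fintype_fun_eq_card, Fintype.card_coe]
    exact he.trans_lt h.lt_dim
  obtain ⟨v, hv, hv0⟩ := f.ker.ne_bot_iff.1 (LinearMap.ker_ne_bot_of_finrank_lt hlt)
  refine ⟨v, v.2, fun h0 => hv0 (Subtype.ext h0), funext fun i => ?_⟩
  by_cases hi : e i = 0
  · simp [hi]
  · have := congrFun hv ⟨i, by simpa [J] using hi⟩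
    rw [Pi.mul_apply, Pi.zero_apply, show v.1 i = 0 from this, zero_mul]

/-- A word of `A` that vanishes at the errors satisfies v * y = v * x, and the pair condition
applies to `x`. -/
theorem IsErrorCorrectingPair.exists_locator (h : IsErrorCorrectingPair t A B C) {x y : ι → K}
    (hx : x ∈ C) (hxy : hammingNorm (y - x) ≤ t) :
    ∃ v ∈ A, v ≠ 0 ∧ ∀ b ∈ B, (b * y) ⬝ᵥ v = 0 := by
  obtain ⟨v, hv, hv0, hve⟩ := h.exists_mul_eq_zero hxy
  refine ⟨v, hv, hv0, fun b hb => ?_⟩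
  rw [dotProduct_mul_comm]
  have h1 := h.mul_mem_dual v hv b hb x hx
  rw [mul_sub, sub_eq_zero] at hve
  rw [hve, ← h1]
  exact Finset.sum_congr rfl fun i _ => by simp only [Pi.mul_apply]; ring

/-- Nonzero words with product zero have disjoint supports, so their weights add up to at most the
length. -/
theorem IsErrorCorrectingPair.eq_zero (h : IsErrorCorrectingPair t A B C) {v c : ι → K}
    (hv : v ∈ A) (hv0 : v ≠ 0) (hc : c ∈ C) (hvc : v * c = 0) : c = 0 := by
  by_contra hc0
  have h1 := h.length_lt.trans_le (add_le_add (minDist_le hv hv0) (minDist_le hc hc0))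
  have h2 : hammingNorm v + hammingNorm c ≤ Fintype.card ι := by
    classical
    rw [hammingNorm, hammingNorm, ← Finset.card_union_of_disjoint]
    · exact Finset.card_le_univ _
    · rw [Finset.disjoint_filter]
      intro i _ h1 h2
      have := congrFun hvc i
      rw [Pi.mul_apply, Pi.zero_apply] at this
      exact (mul_ne_zero h1 h2) this
  rw [← Nat.cast_add, Nat.cast_lt] at h1
  omega

end Code

namespace FieldRAM

/-! ### Linear algebra of one elimination step -/

section ElimStep

variable {K M : Type*} [Field K] [AddCommGroup M] [Module K M] {r p : ℕ} {U U' : ℕ → M}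
  {φ : M →ₗ[K] K} {c : K}

/-- The reduction is linear in `v` and takes the old generators to the new ones. -/
theorem sub_smul_mem_span (hU : ∀ i ≤ r, U' i = U i - (φ (U i) * c) • U p) {v : M}
    (hv : v ∈ Submodule.span K (U '' Set.Iio r)) :
    v - (φ v * c) • U p ∈ Submodule.span K (U' '' Set.Iio r) := by
  induction hv using Submodule.span_induction with
  | mem v hv =>
    obtain ⟨i, hi, rfl⟩ := hv
    rw [← hU i (le_of_lt hi)]
    exact Submodule.subset_span ⟨i, hi, rfl⟩
  | zero => simp
  | add v w _ _ hv hw =>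
    rw [map_add, add_mul, add_smul, add_sub_add_comm]
    exact add_mem hv hw
  | smul a v _ hv =>
    rw [map_smul, smul_eq_mul, mul_assoc, mul_smul, ← smul_sub]
    exact Submodule.smul_mem _ a hv

/-- With a pivot, the reduction is the projection onto the kernel of `φ` along `U p` and fixes that
kernel. With c = 0 nothing is changed, and `φ` already vanishes on the span. -/
theorem mem_span_elimStep_iff (hU : ∀ i ≤ r, U' i = U i - (φ (U i) * c) • U p)
    (hp : (c = 0 ∧ ∀ i < r, φ (U i) = 0) ∨ (p < r ∧ φ (U p) ≠ 0 ∧ c = (φ (U p))⁻¹)) {v : M} :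
    v ∈ Submodule.span K (U' '' Set.Iio r) ↔
      v ∈ Submodule.span K (U '' Set.Iio r) ∧ φ v = 0 := by
  constructor
  · intro hv
    have hle : Submodule.span K (U' '' Set.Iio r) ≤
        Submodule.span K (U '' Set.Iio r) ⊓ LinearMap.ker φ := by
      rw [Submodule.span_le]
      rintro _ ⟨i, hi, rfl⟩
      have hi' : i < r := hi
      have hUi : U i ∈ Submodule.span K (U '' Set.Iio r) := Submodule.subset_span ⟨i, hi, rfl⟩
      rw [SetLike.mem_coe, Submodule.mem_inf, LinearMap.mem_ker, hU i hi'.le]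
      rcases hp with ⟨rfl, h0⟩ | ⟨hpr, hp0, rfl⟩
      · simpa using ⟨hUi, h0 i hi'⟩
      · refine ⟨sub_mem hUi (Submodule.smul_mem _ _ (Submodule.subset_span ⟨p, hpr, rfl⟩)), ?_⟩
        rw [map_sub, map_smul, smul_eq_mul, mul_assoc, inv_mul_cancel₀ hp0, mul_one, sub_self]
    exact hle hv
  · rintro ⟨hv, h0⟩
    have := sub_smul_mem_span hU hv
    rwa [h0, zero_mul, zero_smul, sub_zero] at this

/-- The extra row undergoes the same reduction, which fixes `e`; so it stays congruent to `e` modulo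
the current span. -/
theorem sub_mem_span_elimStep (hU : ∀ i ≤ r, U' i = U i - (φ (U i) * c) • U p) {e : M}
    (he : φ e = 0) (h : U r - e ∈ Submodule.span K (U '' Set.Iio r)) :
    U' r - e ∈ Submodule.span K (U' '' Set.Iio r) := by
  have := sub_smul_mem_span hU h
  rwa [map_sub, he, sub_zero, sub_right_comm, ← hU r le_rfl] at this

end ElimStep

variable {ι K : Type*} {n : ℕ} (e : Fin n ≃ ι)

/-- The row `i` of an array, as a word. -/
def rowVec (V : ℕ → ℕ → K) (i : ℕ) : ι → K := fun x => V i (e.symm x)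

theorem rowVec_eq_iff {V : ℕ → ℕ → K} {i : ℕ} {u : ι → K} :
    rowVec e V i = u ↔ ∀ j : Fin n, V i j = u (e j) := by
  rw [funext_iff, ← e.forall_congr_right]
  simp [rowVec]

variable [Field K]

/-- The span of the first `r` rows of an array. -/
def rowSpan (V : ℕ → ℕ → K) (r : ℕ) : Submodule K (ι → K) :=
  Submodule.span K (rowVec e V '' Set.Iio r)

theorem rowVec_toArray {a : ℕ} (G : Fin a → ι → K) (i : Fin a) :
    rowVec e (toArray e G) i = G i := by
  funext x
  simp [rowVec, toArray]

theorem rowSpan_toArray {a : ℕ} (G : Fin a → ι → K) :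
    rowSpan e (toArray e G) a = Submodule.span K (Set.range G) := by
  rw [rowSpan]
  congr 1
  ext v
  constructor
  · rintro ⟨i, hi, rfl⟩
    exact ⟨⟨i, hi⟩, (rowVec_toArray e G ⟨i, hi⟩).symm⟩
  · rintro ⟨i, rfl⟩
    exact ⟨i, i.2, rowVec_toArray e G i⟩

theorem rowSpan_congr {V V' : ℕ → ℕ → K} {r : ℕ} (h : ∀ i < r, rowVec e V i = rowVec e V' i) :
    rowSpan e V r = rowSpan e V' r :=
  congrArg _ (Set.image_congr fun i hi => h i hi)

variable [Fintype ι]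

theorem sum_range_eq_dotProduct (w V : ℕ → ℕ → K) (m i : ℕ) :
    ∑ t ∈ Finset.range n, w m t * V i t = rowVec e w m ⬝ᵥ rowVec e V i := by
  rw [Finset.sum_range (fun t => w m t * V i t)]
  exact (e.symm.sum_comp (fun t : Fin n => w m t * V i t)).symm

variable [DecidableEq K]

/-- After m rounds the rows span the part of the original span orthogonal to the first m test rows,
and the extra row is still congruent, modulo that smaller span, to every `u` that all test rows
annihilate and to which it was congruent at the start. -/
theorem Prog.elim_spec {v R w M N : ℕ} (hv : v < 6) (hw : w < 6) (hvw : v ≠ w) (hR : R < 4)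
    (hM : M < 4) {σ : State K} (hz : σ.reg 9 = 0) (hn : σ.reg 0 = n) (hN : n ≤ N)
    (hRN : σ.reg R + 1 ≤ N) (hMN : σ.reg M ≤ N) :
    (elim v R w M).Runs σ (3 + 6 * N + 12 * N ^ 2 + 6 * N ^ 3) fun τ =>
      ((∀ u, u ∈ rowSpan e (τ.mem v) (σ.reg R) ↔ u ∈ rowSpan e (σ.mem v) (σ.reg R) ∧
          ∀ m < σ.reg M, rowVec e (σ.mem w) m ⬝ᵥ u = 0) ∧
        ∀ u, (∀ m < σ.reg M, rowVec e (σ.mem w) m ⬝ᵥ u = 0) →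
          rowVec e (σ.mem v) (σ.reg R) - u ∈ rowSpan e (σ.mem v) (σ.reg R) →
          rowVec e (τ.mem v) (σ.reg R) - u ∈ rowSpan e (τ.mem v) (σ.reg R)) ∧
      (∀ k < 6, k ≠ v → τ.mem k = σ.mem k) ∧ ∀ r, r < 4 ∨ 8 < r → τ.reg r = σ.reg r := by
  refine elim_runs hv hw hvw hR hM hz (hn ▸ hN) hRN hMN (I := fun m V =>
    (∀ u, u ∈ rowSpan e V (σ.reg R) ↔ u ∈ rowSpan e (σ.mem v) (σ.reg R) ∧
          ∀ m' < m, rowVec e (σ.mem w) m' ⬝ᵥ u = 0) ∧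
        ∀ u, (∀ m < σ.reg M, rowVec e (σ.mem w) m ⬝ᵥ u = 0) →
          rowVec e (σ.mem v) (σ.reg R) - u ∈ rowSpan e (σ.mem v) (σ.reg R) →
          rowVec e V (σ.reg R) - u ∈ rowSpan e V (σ.reg R)) ?_ ?_
  · simp
  · rintro m hm V V' ⟨h1, h2⟩ ⟨c, p, hp, hV⟩
    set φ : (ι → K) →ₗ[K] K := dotProductBilin K K (rowVec e (σ.mem w) m) with hφ
    have hφ' : ∀ u, φ u = rowVec e (σ.mem w) m ⬝ᵥ u := fun u => rfl
    simp only [hn, sum_range_eq_dotProduct e, ← hφ'] at hp hV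
    have hU : ∀ i ≤ σ.reg R, rowVec e V' i = rowVec e V i - (φ (rowVec e V i) * c) •
        rowVec e V p := fun i hi => by
      funext x
      exact hV i hi _ (e.symm x).2
    refine ⟨fun u => ?_, fun u hu hur => ?_⟩
    · rw [rowSpan, mem_span_elimStep_iff hU hp, ← rowSpan, h1, and_assoc, hφ']
      refine and_congr_right fun _ => ⟨fun h m' hm' => ?_, fun h => ⟨fun m' hm' => ?_, ?_⟩⟩
      · rcases Nat.lt_succ_iff_lt_or_eq.1 hm' with h' | rfl
        · exact h.1 m' h'
        · exact h.2
      · exact h m' (by omega)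
      · exact h m (by omega)
    · exact sub_mem_span_elimStep hU (hu m hm) (h2 u hu hur)

theorem decoder_runs {t : ℕ} {A B C : Submodule K (ι → K)}
    (h : Code.IsErrorCorrectingPair t A B C) {a b l : ℕ} {GA : Fin a → ι → K} {GB : Fin b → ι → K}
    {GC : Fin l → ι → K} (hA : Code.IsGeneratorMatrix GA A) (hB : Code.IsGeneratorMatrix GB B)
    (hC : Code.IsGeneratorMatrix GC C) (y : ι → K) :
    Prog.decoder.Runs (decoderInput e GA GB GC y)
      (11 + 22 * (n + 1) + 29 * (n + 1) ^ 2 + 12 * (n + 1) ^ 3)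
      fun τ => ∀ x ∈ C, hammingDist y x ≤ t → ∀ j : Fin n, τ.mem 4 0 j = x (e j) := by
  have hn : Fintype.card ι = n := by simpa using Fintype.card_congr e.symm
  -- Generator matrices have independent rows, hence at most n of them; with the extra row, n + 1
  -- bounds all loops.
  have hcard : ∀ {r : ℕ} {G : Fin r → ι → K}, LinearIndependent K G → r ≤ n :=
    fun hG => by simpa [hn] using hG.fintype_card_le_finrank
  have ha := hcard hA.1
  have hb := hcard hB.1
  have hl := hcard hC.1
  set σ := decoderInput e GA GB GC y with hσ
  have hσ0 : σ.mem 0 = toArray e GA := rfl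
  have hσ1 : σ.mem 1 = toArray e GB := rfl
  have hσ2 : σ.mem 2 = toArray e GC := rfl
  have hσ3 : ∀ j : Fin n, σ.mem 3 0 j = y (e j) := fun j => by
    simp [hσ, decoderInput, toArray]
  have hσ5 : ∀ i j, σ.mem 5 i j = 0 := fun i j => rfl
  have r0 : σ.reg 0 = n := rfl
  have r1 : σ.reg 1 = a := rfl
  have r2 : σ.reg 2 = b := rfl
  have r3 : σ.reg 3 = l := rfl
  have r9 : σ.reg 9 = 0 := rfl
  clear_value σ
  refine ((Prog.scaleRows_runs (N := n + 1) r9 (by omega) (by omega)).seq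
    (T' := 10 + 20 * (n + 1) + 27 * (n + 1) ^ 2 + 12 * (n + 1) ^ 3)
    fun τ₁ ⟨m1, s1⟩ => ?_).mono (by apply le_of_eq; ring) fun _ h => h
  have s1' : ∀ r, r < 4 ∨ 8 < r → τ₁.reg r = σ.reg r := fun r hr => s1 r (by omega) (by omega)
  refine ((Prog.elim_spec e (N := n + 1) (v := 0) (R := 1) (w := 1) (M := 2) (by norm_num)
    (by norm_num) (by norm_num) (by norm_num) (by norm_num) (by rw [s1' _ (by norm_num), r9])
    (by rw [s1' _ (by norm_num), r0]) (by omega) (by rw [s1' _ (by norm_num), r1]; omega)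
    (by rw [s1' _ (by norm_num), r2]; omega)).seq
    (T' := 7 + 14 * (n + 1) + 15 * (n + 1) ^ 2 + 6 * (n + 1) ^ 3)
    fun τ₂ ⟨⟨V2, _⟩, m2, s2⟩ => ?_).mono (by apply le_of_eq; ring) fun _ h => h
  have s2' : ∀ r, r < 4 ∨ 8 < r → τ₂.reg r = σ.reg r := fun r hr => by rw [s2 r hr, s1' r hr]
  refine ((Prog.findRow_runs (N := n + 1) (by rw [s2' _ (by norm_num), r0]; omega)
    (by rw [s2' _ (by norm_num), r1]; omega)).seq
    (T' := 6 + 12 * (n + 1) + 12 * (n + 1) ^ 2 + 6 * (n + 1) ^ 3)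
    fun τ₃ ⟨m3, s3, p3⟩ => ?_).mono (by apply le_of_eq; ring) fun _ h => h
  have s3' : ∀ r, r < 4 ∨ 8 < r → τ₃.reg r = σ.reg r := fun r hr => by
    rw [s3 r (by omega) (by omega) (by omega), s2' r hr]
  refine ((Prog.diag_runs (N := n + 1) (by rw [s3' _ (by norm_num), r0]; omega)).seq
    (T' := 5 + 10 * (n + 1) + 12 * (n + 1) ^ 2 + 6 * (n + 1) ^ 3)
    fun τ₄ ⟨m4, s4⟩ => ?_).mono (by apply le_of_eq; ring) fun _ h => h
  have s4' : ∀ r, r < 4 ∨ 8 < r → τ₄.reg r = σ.reg r := fun r hr => by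
    rw [s4 r (by omega), s3' r hr]
  refine ((Prog.appendWord_runs (N := n + 1) (by rw [s4' _ (by norm_num), r9])
    (by rw [s4' _ (by norm_num), r0]; omega)).seq
    (T' := 4 + 8 * (n + 1) + 12 * (n + 1) ^ 2 + 6 * (n + 1) ^ 3)
    fun τ₅ ⟨m5, s5⟩ => ?_).mono (by apply le_of_eq; ring) fun _ h => h
  have s5' : ∀ r, r < 4 ∨ 8 < r → τ₅.reg r = σ.reg r := fun r hr => by
    rw [s5 r (by omega), s4' r hr]
  refine ((Prog.elim_spec e (N := n + 1) (v := 2) (R := 3) (w := 5) (M := 0) (by norm_num)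
    (by norm_num) (by norm_num) (by norm_num) (by norm_num) (by rw [s5' _ (by norm_num), r9])
    (by rw [s5' _ (by norm_num), r0]) (by omega) (by rw [s5' _ (by norm_num), r3]; omega)
    (by rw [s5' _ (by norm_num), r0]; omega)).seq (T' := 1 + (n + 1) * 2)
    fun τ₆ ⟨⟨V6, E6⟩, m6, s6⟩ => ?_).mono (by apply le_of_eq; ring) fun _ h => h
  have s6' : ∀ r, r < 4 ∨ 8 < r → τ₆.reg r = σ.reg r := fun r hr => by rw [s6 r hr, s5' r hr]
  refine (Prog.output_runs (N := n + 1) (by rw [s6' _ (by norm_num), r9])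
    (by rw [s6' _ (by norm_num), r0]; omega)).mono le_rfl fun τ₇ m7 x hx hxy => ?_
  rw [hammingDist_comm, hammingDist_eq_hammingNorm, neg_add_eq_sub] at hxy
  rw [s1' 1 (by norm_num), s1' 2 (by norm_num), r1, r2] at V2
  rw [s2' 1 (by norm_num), s2' 0 (by norm_num), r0, r1] at p3
  rw [s3' 0 (by norm_num), r0, m3] at m4
  rw [s4' 0 (by norm_num), s4' 3 (by norm_num), r0, r3] at m5
  rw [s5' 0 (by norm_num), s5' 3 (by norm_num), r0, r3] at V6 E6
  rw [s6' 0 (by norm_num), s6' 3 (by norm_num), r0, r3] at m7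
  have hV2 : ∀ u, u ∈ rowSpan e (τ₂.mem 0) a ↔ u ∈ A ∧ ∀ v ∈ B, (v * y) ⬝ᵥ u = 0 := by
    intro u
    have h0 : τ₁.mem 0 = toArray e GA := by
      rw [← hσ0]
      funext i j
      rw [m1, if_neg (by omega)]
    have h1 : ∀ m : Fin b, rowVec e (τ₁.mem 1) m = GB m * y := fun m => by
      rw [rowVec_eq_iff]
      intro j
      rw [m1, if_pos ⟨rfl, by rw [r2]; exact m.2, by rw [r0]; exact j.2⟩, hσ1, hσ3]
      simp [toArray]
    rw [V2, h0, rowSpan_toArray, hA.2]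
    refine and_congr_right fun _ => ⟨fun hu v hv => ?_, fun hu m hm => ?_⟩
    · rw [← hB.2] at hv
      induction hv using Submodule.span_induction with
      | mem v hv =>
        obtain ⟨m, rfl⟩ := hv
        rw [← h1]
        exact hu m m.2
      | zero => rw [zero_mul, zero_dotProduct]
      | add v w _ _ hv hw => rw [add_mul, add_dotProduct, hv, hw, add_zero]
      | smul c v _ hv => rw [smul_mul_assoc, smul_dotProduct, hv, smul_zero]
    · rw [h1 ⟨m, hm⟩]
      exact hu _ (hB.2 ▸ Submodule.subset_span ⟨_, rfl⟩)
  -- The eliminated array is not zero, because `exists_locator` provides a nonzero word in its span.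
  obtain ⟨hp, j₀, hj₀, hpj⟩ : τ₃.reg 7 < a ∧ ∃ j < n, τ₂.mem 0 (τ₃.reg 7) j ≠ 0 := by
    refine p3.resolve_left fun hzero => ?_
    obtain ⟨v, hvA, hv0, hv⟩ := h.exists_locator hx hxy
    have hmem := (hV2 v).2 ⟨hvA, hv⟩
    have hle : rowSpan e (τ₂.mem 0) a ≤ ⊥ := by
      rw [rowSpan, Submodule.span_le]
      rintro _ ⟨i, hi, rfl⟩
      exact (rowVec_eq_iff e).2 fun j => hzero i hi j j.2
    exact hv0 (hle hmem)
  set α := rowVec e (τ₂.mem 0) (τ₃.reg 7) with hα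
  have hαspan : α ∈ rowSpan e (τ₂.mem 0) a := Submodule.subset_span ⟨_, hp, rfl⟩
  obtain ⟨hαA, hαB⟩ := (hV2 α).1 hαspan
  have hα0 : α ≠ 0 := fun h0 => hpj ((rowVec_eq_iff e).1 h0 ⟨j₀, hj₀⟩)
  have hdiag : ∀ u, (∀ m < n, rowVec e (τ₅.mem 5) m ⬝ᵥ u = 0) ↔ α * u = 0 := by
    classical
    have hrow : ∀ m : Fin n, rowVec e (τ₅.mem 5) m = Pi.single (e m) (α (e m)) := fun m => by
      rw [rowVec_eq_iff]
      intro j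
      rw [m5, if_neg (by omega), m4, m2 5 (by norm_num) (by norm_num), m1, hσ5,
        if_neg (c := 5 = 1 ∧ _) (by omega), Pi.single_apply]
      by_cases hmj : m = j
      · rw [if_pos ⟨rfl, congrArg _ hmj, j.2⟩, hmj, if_pos rfl, hα, rowVec, Equiv.symm_apply_apply]
      · rw [if_neg fun hc => hmj (Fin.ext hc.2.1), if_neg fun hc => hmj (e.injective hc).symm]
    intro u
    rw [funext_iff, ← e.forall_congr_right]
    refine ⟨fun hu m => ?_, fun hu m hm => ?_⟩
    · have := hu m m.2
      rwa [hrow, single_dotProduct] at this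
    · rw [hrow ⟨m, hm⟩, single_dotProduct]
      exact hu ⟨m, hm⟩
  have h32 : ∀ k, k = 2 ∨ k = 3 → τ₄.mem k = σ.mem k := fun k hk => by
    funext i j
    rw [m4, if_neg (by omega), m2 k (by omega) (by omega), m1, if_neg (by omega)]
  have hrow : rowVec e (τ₅.mem 2) l = y := by
    rw [rowVec_eq_iff]
    intro j
    rw [m5, if_pos ⟨rfl, rfl, j.2⟩, h32 3 (by norm_num), hσ3]
  have hspan : rowSpan e (τ₅.mem 2) l = C := by
    rw [← hC.2, ← rowSpan_toArray e GC, ← hσ2]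
    refine rowSpan_congr e fun i hi => ?_
    funext z
    rw [rowVec, rowVec, m5, if_neg (by omega), h32 2 (by norm_num)]
  simp only [hdiag, hspan] at V6 E6
  -- The extra row, initially y = (y - x) + x, is reduced to y - x plus a codeword killed by `α`,
  -- which is zero. So the row is the error itself and y minus the row is x.
  have hfin := E6 (y - x) (h.mul_eq_zero hx hxy hαA hαB) (by rwa [hrow, sub_sub_cancel])
  have hzero := h.eq_zero hαA hα0 ((V6 _).1 hfin).1 ((V6 _).1 hfin).2
  rw [sub_eq_zero, rowVec_eq_iff] at hzero
  intro j
  rw [m7 j j.2, hzero j, m6 3 (by norm_num) (by norm_num), m5, if_neg (by omega),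
    h32 3 (by norm_num), hσ3, Pi.sub_apply, sub_sub_cancel]

/-- The coefficients 11, 22, 29 and 12 of the time bound add up to 74, and (n + 1)^3 ≤ 8 n^3 for n ≥
1; hence 592 = 8 · 74. -/
theorem decoder_decodes {t : ℕ} {A B C : Submodule K (ι → K)} (hn : 0 < Fintype.card ι)
    (h : Code.IsErrorCorrectingPair t A B C) : Prog.decoder.Decodes 592 t A B C := by
  intro e a b l GA GB GC hA hB hC y
  have H := decoder_runs e h hA hB hC y
  refine ⟨H.2.trans ?_, H.1⟩
  obtain ⟨k, hk⟩ : ∃ k, Fintype.card ι = k + 1 := ⟨Fintype.card ι - 1, by omega⟩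
  rw [hk]
  nlinarith [Nat.zero_le (k ^ 3), Nat.zero_le (k ^ 2), Nat.zero_le k]

end FieldRAM
end

/-! ### The numbers of the proposition and its proof -/

namespace WeierstrassCurve.Affine

theorem support_divisorOf {K : Type*} [Field K] [DecidableEq K] {W : WeierstrassCurve.Affine K}
    (X : Finset W.Point) : (divisorOf X).support = X := by
  ext P
  simp [divisorOf_apply]

theorem evalCode_rrSpaceZero_le {K : Type*} [Field K] {W : WeierstrassCurve.Affine K}
    (D : W.Point →₀ ℤ) (P : W.Point) (S : Finset W.Point) :
    evalCode (rrSpaceZero D P) S ≤ codeL D S :=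
  fun _ ⟨f, hf, hx⟩ => ⟨f, hf.1, hx⟩

variable {k K : Type*} [Field k] [Fintype k] [Field K] [Finite K] [DecidableEq K] [Algebra k K]
  (E : WeierstrassCurve.Affine k)

/-- d + 1 is a floor, hence at most half of n - |X_m|; doubling gives an inequality of integers. -/
theorem card_primeKernels_add_le {m n d : ℕ} (h : (d : ℤ) = dStar E K m n) :
    (primeKernels E K m).card + 2 * d + 2 ≤ n := by
  rw [dStar, kernelDivisor, degree_divisorOf, eq_sub_iff_add_eq, eq_comm, Int.floor_eq_iff] at h
  have := h.1
  rw [le_div_iff₀ (by norm_num)] at this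
  push_cast at this
  have h2 : (((primeKernels E K m).card + 2 * d + 2 : ℕ) : ℚ) ≤ n := by
    push_cast
    linarith
  exact_mod_cast h2

theorem primeKernels_mono {m N : ℕ} (h : m ∣ N) (hN : N ≠ 0) :
    primeKernels E K m ⊆ primeKernels E K N := by
  rw [primeKernels, primeKernels, Set.Finite.toFinset_subset_toFinset]
  exact Set.biUnion_subset_biUnion_left (Nat.primeFactors_mono h hN)

end WeierstrassCurve.Affine

open WeierstrassCurve.Affine in
theorem proposition5p1 :
    ∃ (prog : FieldRAM.Prog) (c : ℕ),
      ∀ (k K : Type*) [Field k] [Fintype k] [Field K] [Finite K] [DecidableEq K] [Algebra k K]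
        (E : WeierstrassCurve.Affine k) [E.IsElliptic] (N m : ℕ),
        Squarefree N → m ∣ N → N ∣ Module.finrank k K →
        ∀ (S : Finset (E⁄K).Point) (P : (E⁄K).Point),
          P ∈ S → Disjoint S (kernelDivisor E K N).support →
          (kernelDivisor E K N).degree < S.card →
          ∀ d : ℕ, 0 < d → (d : ℤ) = dStar E K m (S.erase P).card →
            let S' := S.erase P
            let D := kernelDivisor E K m
            let Q : (E⁄K).Point →₀ ℤ := Finsupp.single P ((d : ℤ) + 1)
            let A := codeL Q S'
            let B := codeOmega (divisorOf S' - D - Q) S'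
            let C := codeL D S'
            let C₀ := evalCode (rrSpaceZero D P) S'
            Code.IsErrorCorrectingPair d A B C ∧ Code.IsErrorCorrectingPair d A B C₀ ∧
              prog.Decodes c d A B C ∧ prog.Decodes c d A B C₀ := by
  refine ⟨FieldRAM.Prog.decoder, 592, ?_⟩
  intro k K _ _ _ _ _ _ E _ N m hN hmN _ S P _ hdisj _ d hd hdS S' D Q A B C C₀
  have hcard := card_primeKernels_add_le E hdS
  -- Disjointness is given for X_N; it passes to X_m because m divides N and N ≠ 0.
  have hX : Disjoint S' (primeKernels E K m) := by
    rw [kernelDivisor, support_divisorOf] at hdisj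
    exact hdisj.mono (Finset.erase_subset _ _) (primeKernels_mono E hmN hN.ne_zero)
  have : (E⁄K).IsElliptic := inferInstanceAs (WeierstrassCurve.map E (algebraMap k K)).IsElliptic
  have hC : Code.IsErrorCorrectingPair d A B C :=
    isErrorCorrectingPair (Finset.notMem_erase P S) hX hd hcard
  have hC₀ := hC.mono (evalCode_rrSpaceZero_le D P S')
  have hn : 0 < Fintype.card S' := by
    rw [Fintype.card_coe]
    exact lt_of_lt_of_le (by omega) hcard
  exact ⟨hC, hC₀, FieldRAM.decoder_decodes hn hC, FieldRAM.decoder_decodes hn hC₀⟩
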